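/- **Notation.** For $q\in\mathbb C$ with $|q|<1$ put $(x;q)=\prod_{j\ge 0}(1-xq^j)$, and for $|q|,|r|<1$ put $(x;q,r)=\prod_{j,k\ge 0}(1-xq^jr^k)$; extend these to $|q|\ne1\ne|r|$ by $(x;q^{-1})=1/(qx;q)$, $(x;q^{-1},r)=1/(qx;q,r)$, $(x;q,r^{-1})=1/(rx;q,r)$. For $\tau,\sigma\in\mathbb C\smallsetminus\mathbb R$ and $x=e^{2\pi iz}$, $q=e^{2\pi i\tau}$, $r=e^{2\pi i\sigma}$ let $$\theta_0(z,\tau)=(x;q)\,(q/x;q),\qquad \Gamma(z,\tau,\sigma)=\frac{(qr/x;q,r)}{(x;q,r)}.$$ An *invertible analytic function* on $X=\mathbb C\times\mathbb C^3$ is an equivalence class of pairs $(f,D)$, where $D\subset X$ is a dense open subset and $f$ is a holomorphic nowhere vanishing function on $D$; $(f_1,D_1)$ and $(f_2,D_2)$ are equivalent if $f_1=f_2$ on $D_1\cap D_2$. They form a group for $(f_1,D_1)(f_2,D_2)=(f_1f_2,D_1\cap D_2)$. Let $G=\mathrm{SL}(3,\mathbb Z)\ltimes\mathbb Z^3$,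 with group law $(A,\vec n)(B,\vec m)=(AB,\vec m+B^{T}\vec n)$, act on $X$ by $(A,\vec n)(z,\vec x)=(z+\vec n\cdot\vec x,A\vec x)$, and on functions by $(gf)(y)=f(g^{-1}y)$. Let $e_{i,j}$ ($1\le i\ne j\le 3$) be the element of $\mathrm{SL}(3,\mathbb Z)$ which differs from the identity matrix by a $1$ in position $(i,j)$, and let $t_1,t_2,t_3$ be the canonical generators of $\mathbb Z^3$; these elements generate $G$. Let $N$ be the $G$-module of invertible analytic functions $f$ on $X$ such that $f(\lambda z,\lambda\vec x)=f(z,\vec x)$ for all $\lambda\in\mathbb C\smallsetminus\{0\}$, and $M\subset N$ the submodule of functions $\exp(2\pi if)$ with $f\in\mathbb Q(x_1/x_3,x_2/x_3)[z/x_3]$. A $1$-cocycle with values in a $G$-module is a map $u$ with $u(gh)=u(g)\cdot g\,u(h)$, and $\delta_*:H^1(G,N/M)\to H^2(G,M)$ is the connecting homomorphism of $1\to M\to N\to N/M\to1$; it is induced by $\delta u(g,h)=u(g)\cdot g\,u(h)/u(gh)$ on lifts $u:G\to N$. **Theorem.** The functions $$u(e_{1,2})=\Gamma\Bigl(\tfrac{z-x_2}{x_3},\tfrac{x_1-x_2}{x_3},-\tfrac{x_1}{x_3}\Bigr)^{-1},\qquad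 u(e_{3,2})=\Gamma\Bigl(\tfrac{z}{x_1},\tfrac{x_2-x_3}{x_1},\tfrac{x_3}{x_1}\Bigr),\qquad u(t_2)=\theta_0\Bigl(\tfrac{z-x_2}{x_1},\tfrac{x_3}{x_1}\Bigr),$$ $$u(e_{i,j})=1\ (i\ne j,\ j\neq2),\qquad u(t_j)=1\ (j\ne2)$$ define elements of $N$, and their classes in $N/M$ extend to a $1$-cocycle $u:G\to N/M$. Its cohomology class $[u]\in H^1(G,N/M)$ is independent of the choice of the extension and is non-trivial. The class $\delta_*[u]\in H^2(G,M)$ is represented by a $2$-cocycle $\phi:G^2\to M$ (normalized by $\phi(1,g)=\phi(g,1)=1$) whose restriction to $(\mathbb Z^3)^2$ is given, for all $l,m,n,l',m',n'\in\mathbb Z$, by $$\phi(t_1^lt_2^mt_3^n,\;t_1^{l'}t_2^{m'}t_3^{n'})(z,\vec x)=\exp\Bigl(\pi i\Bigl(nm'\bigl(\tfrac{2z}{x_1}+1\bigr)-m'n(n+1)\tfrac{x_3}{x_1}-nm'(m'+1+2m)\tfrac{x_2}{x_1}\Bigr)\Bigr).$$ -/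

import Mathlib

open CategoryTheory

noncomputable section

namespace EllipticGamma

/-! ### Infinite products, the theta function and the elliptic gamma function -/

/-- `(x; q) = ∏_{j ≥ 0} (1 - x q ^ j)` for `|q| < 1`, extended to `|q| > 1` by
`(x; q⁻¹) = 1 / (q x; q)`. -/
def qPoch (x q : ℂ) : ℂ :=
  if ‖q‖ < 1 then ∏' j : ℕ, (1 - x * q ^ j)
  else (∏' j : ℕ, (1 - (q⁻¹ * x) * q⁻¹ ^ j))⁻¹

/-- The double product `∏_{j, k ≥ 0} (1 - x q ^ j r ^ k)`; it is used for `|q|, |r| < 1`. -/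
def dprod (x q r : ℂ) : ℂ := ∏' p : ℕ × ℕ, (1 - x * q ^ p.1 * r ^ p.2)

/-- `(x; q, r) = ∏_{j, k ≥ 0} (1 - x q ^ j r ^ k)` for `|q|, |r| < 1`, extended to
`|q| ≠ 1 ≠ |r|` by `(x; q⁻¹, r) = 1 / (q x; q, r)` and `(x; q, r⁻¹) = 1 / (r x; q, r)`. -/
def qPoch₂ (x q r : ℂ) : ℂ :=
  if ‖q‖ < 1 then
    if ‖r‖ < 1 then dprod x q r else (dprod (r⁻¹ * x) q r⁻¹)⁻¹
  else
    if ‖r‖ < 1 then (dprod (q⁻¹ * x) q⁻¹ r)⁻¹ else dprod (q⁻¹ * r⁻¹ * x) q⁻¹ r⁻¹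

/-- `e(z) = exp (2 π i z)`. -/
def e (z : ℂ) : ℂ := Complex.exp (2 * Real.pi * Complex.I * z)

/-- `θ₀(z, τ) = (x; q) (q / x; q)` with `x = e(z)`, `q = e(τ)`, for `τ ∈ ℂ ∖ ℝ`. -/
def theta₀ (z τ : ℂ) : ℂ := qPoch (e z) (e τ) * qPoch (e τ / e z) (e τ)

/-- The elliptic gamma function `Γ(z, τ, σ) = (q r / x; q, r) / (x; q, r)` with `x = e(z)`,
`q = e(τ)`, `r = e(σ)`, for `τ, σ ∈ ℂ ∖ ℝ`. -/
def ellGamma (z τ σ : ℂ) : ℂ :=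
  qPoch₂ (e τ * e σ / e z) (e τ) (e σ) / qPoch₂ (e z) (e τ) (e σ)

/-! ### Invertible analytic functions -/

/-- The space `X = ℂ × ℂ³` of pairs `(z, (x₁, x₂, x₃))`; the index of `xᵢ` is `i - 1`. -/
abbrev X : Type := ℂ × (Fin 3 → ℂ)

/-- A pair `(f, D)` where `D` is a dense open subset of `X` and `f` is holomorphic and
nowhere vanishing on `D` (the values of `toFun` outside of `D` are irrelevant). -/
structure AnPair where
  dom : Set X
  isOpen_dom : IsOpen dom
  dense_dom : Dense dom
  toFun : X → ℂ
  holo : DifferentiableOn ℂ toFun dom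
  ne_zero : ∀ p ∈ dom, toFun p ≠ 0

/-- `(f₁, D₁)` and `(f₂, D₂)` are equivalent if `f₁ = f₂` on `D₁ ∩ D₂`. -/
instance anSetoid : Setoid AnPair where
  r a b := ∀ p ∈ a.dom ∩ b.dom, a.toFun p = b.toFun p
  iseqv :=
    { refl := fun _ _ _ => rfl
      symm := fun h p hp => (h p ⟨hp.2, hp.1⟩).symm
      trans := by
        intro a b c hab hbc p hp
        by_contra hne
        have ho : IsOpen (a.dom ∩ c.dom) := a.isOpen_dom.inter c.isOpen_dom
        have hcont : ContinuousOn (fun p => a.toFun p - c.toFun p) (a.dom ∩ c.dom) :=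
          (a.holo.continuousOn.mono Set.inter_subset_left).sub
            (c.holo.continuousOn.mono Set.inter_subset_right)
        have hU := hcont.isOpen_inter_preimage ho (isOpen_compl_singleton (x := (0 : ℂ)))
        obtain ⟨q, hq, hqb⟩ := b.dense_dom.inter_open_nonempty _ hU
          ⟨p, hp, by simpa [sub_eq_zero] using hne⟩
        exact hq.2 (by
          have := (hab q ⟨hq.1.1, hqb⟩).trans (hbc q ⟨hqb, hq.1.2⟩)
          simp [this]) }

/-- The type of invertible analytic functions on `X`. -/
def InvAn : Type := Quotient anSetoid

namespace AnPair

/-- The constant function `1`. -/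
def one : AnPair where
  dom := Set.univ
  isOpen_dom := isOpen_univ
  dense_dom := dense_univ
  toFun _ := 1
  holo := differentiableOn_const 1
  ne_zero _ _ := one_ne_zero

/-- `(f₁, D₁) (f₂, D₂) = (f₁ f₂, D₁ ∩ D₂)`. -/
def mul (a b : AnPair) : AnPair where
  dom := a.dom ∩ b.dom
  isOpen_dom := a.isOpen_dom.inter b.isOpen_dom
  dense_dom := a.dense_dom.inter_of_isOpen_left b.dense_dom a.isOpen_dom
  toFun p := a.toFun p * b.toFun p
  holo := (a.holo.mono Set.inter_subset_left).mul (b.holo.mono Set.inter_subset_right)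
  ne_zero p hp := mul_ne_zero (a.ne_zero p hp.1) (b.ne_zero p hp.2)

/-- The inverse `(1 / f, D)`. -/
def inv (a : AnPair) : AnPair where
  dom := a.dom
  isOpen_dom := a.isOpen_dom
  dense_dom := a.dense_dom
  toFun p := (a.toFun p)⁻¹
  holo := a.holo.inv a.ne_zero
  ne_zero p hp := inv_ne_zero (a.ne_zero p hp)

/-- The pull-back of `(f, D)` by a biholomorphic map `h`. -/
def comp (a : AnPair) (h : X ≃ₜ X) (hd : Differentiable ℂ h) : AnPair where
  dom := h ⁻¹' a.dom
  isOpen_dom := a.isOpen_dom.preimage h.continuous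
  dense_dom := a.dense_dom.preimage h.isOpenMap
  toFun p := a.toFun (h p)
  holo := a.holo.comp hd.differentiableOn (fun _ hp => hp)
  ne_zero p hp := a.ne_zero (h p) hp

end AnPair

namespace InvAn

/-- Invertible analytic functions form a group for the pointwise product. -/
instance : CommGroup InvAn where
  one := Quotient.mk _ AnPair.one
  mul := Quotient.map₂ AnPair.mul (by
    intro a a' ha b b' hb p hp
    change a.toFun p * b.toFun p = a'.toFun p * b'.toFun p
    rw [ha p ⟨hp.1.1, hp.2.1⟩, hb p ⟨hp.1.2, hp.2.2⟩])
  inv := Quotient.map AnPair.inv (by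
    intro a a' ha p hp
    change (a.toFun p)⁻¹ = (a'.toFun p)⁻¹
    rw [ha p hp])
  mul_assoc := by
    rintro ⟨a⟩ ⟨b⟩ ⟨c⟩
    exact Quotient.sound (fun p _ => mul_assoc (a.toFun p) (b.toFun p) (c.toFun p))
  one_mul := by
    rintro ⟨a⟩
    exact Quotient.sound (fun p _ => one_mul (a.toFun p))
  mul_one := by
    rintro ⟨a⟩
    exact Quotient.sound (fun p _ => mul_one (a.toFun p))
  inv_mul_cancel := by
    rintro ⟨a⟩
    exact Quotient.sound (fun p hp => inv_mul_cancel₀ (a.ne_zero p hp.1.1))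
  mul_comm := by
    rintro ⟨a⟩ ⟨b⟩
    exact Quotient.sound (fun p _ => mul_comm (a.toFun p) (b.toFun p))

/-- The pull-back of invertible analytic functions by a biholomorphic map `h`. -/
def comp (h : X ≃ₜ X) (hd : Differentiable ℂ h) : InvAn →* InvAn where
  toFun := Quotient.map (fun a => a.comp h hd) (fun _ _ hab p hp => hab (h p) hp)
  map_one' := Quotient.sound (fun _ _ => rfl)
  map_mul' := by
    rintro ⟨a⟩ ⟨b⟩
    exact Quotient.sound (fun _ _ => rfl)

/-- `F.IsRep f` means that `F` is the class of `(f, D)` for some dense open set `D` on which `f`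
is holomorphic and nowhere vanishing. -/
def IsRep (F : InvAn) (f : X → ℂ) : Prop :=
  ∃ a : AnPair, F = Quotient.mk _ a ∧ ∀ p ∈ a.dom, a.toFun p = f p

end InvAn

/-! ### The group `SL(3, ℤ) ⋉ ℤ³` and its action -/

/-- The elements `(A, n)` of `SL(3, ℤ) ⋉ ℤ³`. -/
@[ext]
structure G where
  A : Matrix.SpecialLinearGroup (Fin 3) ℤ
  n : Fin 3 → ℤ

namespace G

open Matrix

/-- The group law `(A, n) (B, m) = (A B, m + Bᵀ n)` of the semidirect product, which is the one
for which `(A, n) (z, x) = (z + n · x, A x)` is an action. -/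
instance : Group G where
  one := ⟨1, 0⟩
  mul g h := ⟨g.A * h.A, h.n + g.n ᵥ* (h.A : Matrix (Fin 3) (Fin 3) ℤ)⟩
  inv g := ⟨g.A⁻¹, -(g.n ᵥ* ((g.A⁻¹ : SpecialLinearGroup (Fin 3) ℤ) : Matrix (Fin 3) (Fin 3) ℤ))⟩
  mul_assoc g h k := by
    refine G.ext (mul_assoc g.A h.A k.A) ?_
    change k.n + (h.n + g.n ᵥ* h.A.1) ᵥ* k.A.1 =
      (k.n + h.n ᵥ* k.A.1) + g.n ᵥ* (h.A.1 * k.A.1)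
    rw [add_vecMul, vecMul_vecMul, add_assoc]
  one_mul g := by
    refine G.ext (one_mul g.A) ?_
    change g.n + (0 : Fin 3 → ℤ) ᵥ* _ = g.n
    simp
  mul_one g := by
    refine G.ext (mul_one g.A) ?_
    change 0 + g.n ᵥ* ((1 : SpecialLinearGroup (Fin 3) ℤ) : Matrix _ _ ℤ) = g.n
    simp
  inv_mul_cancel g := by
    refine G.ext (inv_mul_cancel g.A) ?_
    have h1 : (g.A⁻¹).1 * g.A.1 = 1 := congrArg Subtype.val (inv_mul_cancel g.A)
    change g.n + (-(g.n ᵥ* (g.A⁻¹).1)) ᵥ* g.A.1 = 0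
    rw [neg_vecMul, vecMul_vecMul, h1, vecMul_one, add_neg_cancel]

theorem one_A : (1 : G).A = 1 := rfl
theorem one_n : (1 : G).n = 0 := rfl
theorem mul_A (g h : G) : (g * h).A = g.A * h.A := rfl
theorem mul_n (g h : G) :
    (g * h).n = h.n + g.n ᵥ* (h.A : Matrix (Fin 3) (Fin 3) ℤ) := rfl

/-- The action `(A, n) (z, x) = (z + n · x, A x)` of `SL(3, ℤ) ⋉ ℤ³` on `X = ℂ × ℂ³`. -/
instance : MulAction G X where
  smul g p := (p.1 + ∑ i, (g.n i : ℂ) * p.2 i, fun i => ∑ j, (g.A i j : ℂ) * p.2 j)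
  one_smul p := by
    refine Prod.ext ?_ (funext fun i => ?_)
    · change p.1 + ∑ i, (((1 : G).n i : ℤ) : ℂ) * p.2 i = p.1
      simp [one_n]
    · change ∑ j, (((1 : G).A i j : ℤ) : ℂ) * p.2 j = p.2 i
      simp [one_A, Matrix.one_apply]
  mul_smul g h p := by
    refine Prod.ext ?_ (funext fun i => ?_)
    · change p.1 + ∑ i, (((g * h).n i : ℤ) : ℂ) * p.2 i =
        (p.1 + ∑ i, (h.n i : ℂ) * p.2 i) + ∑ i, (g.n i : ℂ) * ∑ j, (h.A i j : ℂ) * p.2 j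
      simp [mul_n, vecMul, dotProduct, Fin.sum_univ_three]
      ring
    · change ∑ j, (((g * h).A i j : ℤ) : ℂ) * p.2 j =
        ∑ k, (g.A i k : ℂ) * ∑ j, (h.A k j : ℂ) * p.2 j
      simp [mul_A, Matrix.mul_apply, Fin.sum_univ_three]
      ring

theorem smul_fst (g : G) (p : X) : (g • p).1 = p.1 + ∑ i, (g.n i : ℂ) * p.2 i := rfl
theorem smul_snd (g : G) (p : X) (i : Fin 3) :
    (g • p).2 i = ∑ j, (g.A i j : ℂ) * p.2 j := rfl

theorem differentiable_smul (g : G) : Differentiable ℂ (fun p : X => g • p) := by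
  change Differentiable ℂ (fun p : X =>
    ((p.1 + ∑ i, (g.n i : ℂ) * p.2 i, fun i => ∑ j, (g.A i j : ℂ) * p.2 j) : X))
  fun_prop

instance : ContinuousConstSMul G X := ⟨fun g => (differentiable_smul g).continuous⟩

/-- The elementary matrix `e_{i+1,j+1}` of `SL(3, ℤ)`, as an element of `SL(3, ℤ) ⋉ ℤ³`. -/
def el {i j : Fin 3} (h : i ≠ j) : G := ⟨SpecialLinearGroup.transvection h 1, 0⟩

/-- The canonical generator `t_{i+1}` of the subgroup `ℤ³` of `SL(3, ℤ) ⋉ ℤ³`. -/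
def t (i : Fin 3) : G := ⟨1, Pi.single i 1⟩

end G

/-- `g ∈ SL(3, ℤ) ⋉ ℤ³` acts on invertible analytic functions by `(g f)(y) = f (g⁻¹ y)`. -/
instance : MulDistribMulAction G InvAn where
  smul g := InvAn.comp (Homeomorph.smul g⁻¹) (G.differentiable_smul g⁻¹)
  one_smul := by
    rintro ⟨a⟩
    refine Quotient.sound (fun p _ => ?_)
    change a.toFun ((1 : G)⁻¹ • p) = a.toFun p
    rw [inv_one, one_smul]
  mul_smul := by
    rintro g h ⟨a⟩
    refine Quotient.sound (fun p _ => ?_)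
    change a.toFun ((g * h)⁻¹ • p) = a.toFun (h⁻¹ • g⁻¹ • p)
    rw [mul_inv_rev, mul_smul]
  smul_mul g := map_mul (InvAn.comp (Homeomorph.smul g⁻¹) (G.differentiable_smul g⁻¹))
  smul_one g := map_one (InvAn.comp (Homeomorph.smul g⁻¹) (G.differentiable_smul g⁻¹))

/-- The invertible analytic function `f (l z, l x)`, for `l ∈ ℂ ∖ {0}`. -/
def scale (l : ℂˣ) : InvAn →* InvAn :=
  InvAn.comp (Homeomorph.smul l) (differentiable_id.const_smul (l : ℂ))

theorem scale_smul (l : ℂˣ) (g : G) (F : InvAn) : scale l (g • F) = g • scale l F := by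
  induction F using Quotient.inductionOn with
  | _ a =>
    refine Quotient.sound (fun p _ => ?_)
    change a.toFun (g⁻¹ • l • p) = a.toFun (l • g⁻¹ • p)
    congr 1
    refine Prod.ext ?_ (funext fun i => ?_)
    · simp [G.smul_fst, Units.smul_def, Fin.sum_univ_three]
      ring
    · change (g⁻¹ • l • p).2 i = (l : ℂ) * (g⁻¹ • p).2 i
      simp [G.smul_snd, Units.smul_def, Fin.sum_univ_three]
      ring

/-! ### The modules `M ⊆ N` -/

/-- The group `N` of invertible analytic functions with `f (l z, l x) = f (z, x)` for all
`l ∈ ℂ ∖ {0}`. -/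
def N : Subgroup InvAn where
  carrier := {F | ∀ l : ℂˣ, scale l F = F}
  one_mem' l := map_one _
  mul_mem' ha hb l := by rw [map_mul, ha l, hb l]
  inv_mem' ha l := by rw [map_inv, ha l]

instance : MulDistribMulAction G N where
  smul g F := ⟨g • (F : InvAn), fun l => by rw [scale_smul, F.2 l]⟩
  one_smul F := Subtype.ext (one_smul G (F : InvAn))
  mul_smul g h F := Subtype.ext (mul_smul g h (F : InvAn))
  smul_mul g F H := Subtype.ext (smul_mul' g (F : InvAn) (H : InvAn))
  smul_one g := Subtype.ext (smul_one g)

open MvPolynomial in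
/-- `F` is the class of `exp (2 π i f)` for some `f ∈ ℚ(x₁/x₃, x₂/x₃)[z/x₃]`. With a common
denominator `Q` for the coefficients, such an `f` is `P(x₁/x₃, x₂/x₃, z/x₃) / Q(x₁/x₃, x₂/x₃)`. -/
def IsExpRat (F : InvAn) : Prop :=
  ∃ (P : MvPolynomial (Fin 3) ℚ) (Q : MvPolynomial (Fin 2) ℚ), Q ≠ 0 ∧
    ∃ a : AnPair, F = Quotient.mk _ a ∧ ∀ p ∈ a.dom,
      p.2 2 ≠ 0 ∧ aeval ![p.2 0 / p.2 2, p.2 1 / p.2 2] Q ≠ 0 ∧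
      a.toFun p = e (aeval ![p.2 0 / p.2 2, p.2 1 / p.2 2, p.1 / p.2 2] P /
        aeval ![p.2 0 / p.2 2, p.2 1 / p.2 2] Q)

theorem isOpen_x₃ : IsOpen {p : X | p.2 2 ≠ 0} :=
  isOpen_ne_fun (by fun_prop) continuous_const

theorem dense_x₃ : Dense {p : X | p.2 2 ≠ 0} := by
  have h0 : Dense {c : ℂ | c ≠ 0} := dense_compl_singleton 0
  have hs : IsOpenMap (fun p : X => p.2 2) :=
    (isOpenMap_eval (2 : Fin 3)).comp isOpenMap_snd
  exact h0.preimage hs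

theorem IsExpRat.one : IsExpRat 1 := by
  refine ⟨0, 1, one_ne_zero, ⟨_, isOpen_x₃, dense_x₃, fun _ => 1, differentiableOn_const 1,
    fun _ _ => one_ne_zero⟩, Quotient.sound (fun _ _ => rfl), fun p hp => ⟨hp, ?_, ?_⟩⟩
  · simp
  · simp [e]

theorem IsExpRat.mul {F H : InvAn} (hF : IsExpRat F) (hH : IsExpRat H) : IsExpRat (F * H) := by
  obtain ⟨P, Q, hQ, a, rfl, ha⟩ := hF
  obtain ⟨P', Q', hQ', b, rfl, hb⟩ := hH
  refine ⟨P * MvPolynomial.rename ![0, 1] Q' + P' * MvPolynomial.rename ![0, 1] Q, Q * Q',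
    mul_ne_zero hQ hQ', a.mul b, rfl, fun p hp => ⟨(ha p hp.1).1, ?_, ?_⟩⟩
  · rw [map_mul]
    exact mul_ne_zero (ha p hp.1).2.1 (hb p hp.2).2.1
  · have hv : (![p.2 0 / p.2 2, p.2 1 / p.2 2, p.1 / p.2 2] ∘ ![0, 1] : Fin 2 → ℂ) =
        ![p.2 0 / p.2 2, p.2 1 / p.2 2] := by
      ext i; fin_cases i <;> rfl
    change a.toFun p * b.toFun p = _
    rw [(ha p hp.1).2.2, (hb p hp.2).2.2, e, e, e, ← Complex.exp_add, ← mul_add]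
    simp only [map_add, map_mul, MvPolynomial.aeval_rename, hv]
    congr 2
    have h1 := (ha p hp.1).2.1
    have h2 := (hb p hp.2).2.1
    rw [div_add_div _ _ h1 h2]
    ring

theorem IsExpRat.inv {F : InvAn} (hF : IsExpRat F) : IsExpRat F⁻¹ := by
  obtain ⟨P, Q, hQ, a, rfl, ha⟩ := hF
  refine ⟨-P, Q, hQ, a.inv, rfl, fun p hp => ⟨(ha p hp).1, (ha p hp).2.1, ?_⟩⟩
  change (a.toFun p)⁻¹ = _
  rw [(ha p hp).2.2, map_neg, neg_div, e, e, ← Complex.exp_neg, mul_neg]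

theorem exists_clear_denom {ι κ : Type} (P : MvPolynomial ι ℚ) (L : ι → MvPolynomial κ ℚ)
    (d : MvPolynomial κ ℚ) : ∃ (k : ℕ) (P' : MvPolynomial κ ℚ), ∀ v : κ → ℂ,
      MvPolynomial.aeval v d ≠ 0 →
      MvPolynomial.aeval (fun i => MvPolynomial.aeval v (L i) / MvPolynomial.aeval v d) P =
        MvPolynomial.aeval v P' / MvPolynomial.aeval v d ^ k := by
  induction P using MvPolynomial.induction_on with
  | C a => exact ⟨0, MvPolynomial.C a, fun v _ => by simp⟩
  | add p q hp hq =>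
    obtain ⟨k, p', hp⟩ := hp
    obtain ⟨l, q', hq⟩ := hq
    refine ⟨k + l, p' * d ^ l + q' * d ^ k, fun v hv => ?_⟩
    rw [map_add, hp v hv, hq v hv]
    simp only [map_add, map_mul, map_pow]
    field_simp
    ring
  | mul_X p i hp =>
    obtain ⟨k, p', hp⟩ := hp
    refine ⟨k + 1, p' * L i, fun v hv => ?_⟩
    rw [map_mul, hp v hv]
    simp only [map_mul, MvPolynomial.aeval_X]
    field_simp
    ring

/-- The polynomial `c₀ X + c₁ Y + c₂`. -/
def linForm {κ : Type} (c : Fin 3 → ℤ) (X Y : MvPolynomial κ ℚ) : MvPolynomial κ ℚ :=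
  (c 0 : MvPolynomial κ ℚ) * X + (c 1 : MvPolynomial κ ℚ) * Y + (c 2 : MvPolynomial κ ℚ)

theorem aeval_linForm {κ : Type} (c : Fin 3 → ℤ) (U V : MvPolynomial κ ℚ) (v : κ → ℂ)
    (x : Fin 3 → ℂ) (hx : x 2 ≠ 0) (hU : MvPolynomial.aeval v U = x 0 / x 2)
    (hV : MvPolynomial.aeval v V = x 1 / x 2) :
    MvPolynomial.aeval v (linForm c U V) = (∑ j, (c j : ℂ) * x j) / x 2 := by
  simp only [linForm, map_add, map_mul, map_intCast, hU, hV, Fin.sum_univ_three]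
  field_simp

theorem IsExpRat.smul {F : InvAn} (g : G) (hF : IsExpRat F) : IsExpRat (g • F) := by
  obtain ⟨P, Q, hQ, a, rfl, ha⟩ := hF
  set h : G := g⁻¹ with hh
  let X₀ : MvPolynomial (Fin 2) ℚ := MvPolynomial.X 0
  let X₁ : MvPolynomial (Fin 2) ℚ := MvPolynomial.X 1
  let Y₀ : MvPolynomial (Fin 3) ℚ := MvPolynomial.X 0
  let Y₁ : MvPolynomial (Fin 3) ℚ := MvPolynomial.X 1
  let Y₂ : MvPolynomial (Fin 3) ℚ := MvPolynomial.X 2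
  obtain ⟨k, P', hP'⟩ := exists_clear_denom P
    ![linForm (h.A 0) Y₀ Y₁, linForm (h.A 1) Y₀ Y₁, Y₂ + linForm h.n Y₀ Y₁] (linForm (h.A 2) Y₀ Y₁)
  obtain ⟨l, Q', hQ'⟩ := exists_clear_denom Q
    ![linForm (h.A 0) X₀ X₁, linForm (h.A 1) X₀ X₁] (linForm (h.A 2) X₀ X₁)
  let b : AnPair := (⟨_, isOpen_x₃, dense_x₃, fun _ => 1, differentiableOn_const 1,
    fun _ _ => one_ne_zero⟩ : AnPair).mul
      (a.comp (Homeomorph.smul g⁻¹) (G.differentiable_smul g⁻¹))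
  have key : ∀ p ∈ b.dom, p.2 2 ≠ 0 ∧
      MvPolynomial.aeval ![p.2 0 / p.2 2, p.2 1 / p.2 2] (Q' * linForm (h.A 2) X₀ X₁ ^ k) ≠ 0 ∧
      b.toFun p = e (MvPolynomial.aeval ![p.2 0 / p.2 2, p.2 1 / p.2 2, p.1 / p.2 2]
          (P' * linForm (h.A 2) Y₀ Y₁ ^ l) /
        MvPolynomial.aeval ![p.2 0 / p.2 2, p.2 1 / p.2 2]
          (Q' * linForm (h.A 2) X₀ X₁ ^ k)) := by
    intro p hp
    have hx : p.2 2 ≠ 0 := hp.1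
    obtain ⟨hx', hq, hf⟩ := ha (h • p) hp.2
    set v : Fin 2 → ℂ := ![p.2 0 / p.2 2, p.2 1 / p.2 2] with hv
    set w : Fin 3 → ℂ := ![p.2 0 / p.2 2, p.2 1 / p.2 2, p.1 / p.2 2] with hw
    have hX : ∀ i, MvPolynomial.aeval v (linForm (h.A i) X₀ X₁) = (h • p).2 i / p.2 2 :=
      fun i => aeval_linForm _ _ _ _ _ hx (by simp [X₀, hv]) (by simp [X₁, hv])
    have hY : ∀ i, MvPolynomial.aeval w (linForm (h.A i) Y₀ Y₁) = (h • p).2 i / p.2 2 :=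
      fun i => aeval_linForm _ _ _ _ _ hx (by simp [Y₀, hw]) (by simp [Y₁, hw])
    have hn : MvPolynomial.aeval w (Y₂ + linForm h.n Y₀ Y₁) = (h • p).1 / p.2 2 := by
      rw [map_add, aeval_linForm _ _ _ _ _ hx (by simp [Y₀, hw]) (by simp [Y₁, hw]), G.smul_fst]
      simp [Y₂, hw, add_div]
    have hne : (h • p).2 2 / p.2 2 ≠ 0 := div_ne_zero hx' hx
    have e1 : MvPolynomial.aeval ![(h • p).2 0 / (h • p).2 2, (h • p).2 1 / (h • p).2 2] Q =
        MvPolynomial.aeval v Q' / ((h • p).2 2 / p.2 2) ^ l := by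
      rw [← hX 2, ← hQ' v (by rw [hX 2]; exact hne)]
      congr 2
      ext i
      fin_cases i <;> simp [hX, div_div_div_cancel_right₀ hx]
    have e2 : MvPolynomial.aeval ![(h • p).2 0 / (h • p).2 2, (h • p).2 1 / (h • p).2 2,
        (h • p).1 / (h • p).2 2] P =
        MvPolynomial.aeval w P' / ((h • p).2 2 / p.2 2) ^ k := by
      rw [← hY 2, ← hP' w (by rw [hY 2]; exact hne)]
      congr 2
      ext i
      fin_cases i
      · simp [hY, div_div_div_cancel_right₀ hx]
      · simp [hY, div_div_div_cancel_right₀ hx]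
      · change _ = MvPolynomial.aeval w (Y₂ + linForm h.n Y₀ Y₁) /
          MvPolynomial.aeval w (linForm (h.A 2) Y₀ Y₁)
        rw [hn, hY 2, div_div_div_cancel_right₀ hx]
        rfl
    have hq' : MvPolynomial.aeval v Q' ≠ 0 := by
      intro h0
      rw [e1, h0, zero_div] at hq
      exact hq rfl
    refine ⟨hx, ?_, ?_⟩
    · rw [map_mul, map_pow, hX 2]
      exact mul_ne_zero hq' (pow_ne_zero _ hne)
    · change 1 * a.toFun (h • p) = _
      rw [one_mul, hf, e1, e2, map_mul, map_mul, map_pow, map_pow, hX 2, hY 2]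
      congr 1
      field_simp
  refine ⟨P' * linForm (h.A 2) Y₀ Y₁ ^ l, Q' * linForm (h.A 2) X₀ X₁ ^ k, ?_, b, ?_, key⟩
  · intro h0
    obtain ⟨p, hp⟩ := b.dense_dom.nonempty
    exact (key p hp).2.1 (by rw [h0, map_zero])
  · exact Quotient.sound (fun p _ => (one_mul _).symm)

/-- The submodule `M ⊆ N` of functions `exp (2 π i f)` with `f ∈ ℚ(x₁/x₃, x₂/x₃)[z/x₃]`. -/
def M : Subgroup N where
  carrier := {F | IsExpRat (F : InvAn)}
  one_mem' := IsExpRat.one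
  mul_mem' ha hb := IsExpRat.mul ha hb
  inv_mem' ha := IsExpRat.inv ha

instance : MulDistribMulAction G M where
  smul g F := ⟨g • (F : N), IsExpRat.smul g F.2⟩
  one_smul F := Subtype.ext (one_smul G (F : N))
  mul_smul g h F := Subtype.ext (mul_smul g h (F : N))
  smul_mul g F H := Subtype.ext (smul_mul' g (F : N) (H : N))
  smul_one g := Subtype.ext (smul_one g)

instance : MulAction.QuotientAction G M where
  inv_mul_mem g F H h := by
    have := IsExpRat.smul g h
    change IsExpRat (((g • F)⁻¹ * g • H : N) : InvAn)
    rw [← smul_inv', ← smul_mul']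
    exact this

instance : MulDistribMulAction G (N ⧸ M) where
  smul_mul g := by
    rintro ⟨F⟩ ⟨H⟩
    exact congrArg (QuotientGroup.mk (s := M)) (smul_mul' g F H)
  smul_one g := congrArg (QuotientGroup.mk (s := M)) (smul_one g)

/-! ### The connecting homomorphism -/

/-- The sequence `1 → M → N → N / M → 1` of `G`-modules, written additively. -/
def seqMN : ShortComplex (Rep ℤ G) where
  X₁ := Rep.ofMulDistribMulAction G M
  X₂ := Rep.ofMulDistribMulAction G N
  X₃ := Rep.ofMulDistribMulAction G (N ⧸ M)
  f := Rep.ofHom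
    { toLinearMap := (MonoidHom.toAdditive M.subtype).toIntLinearMap
      isIntertwining' := fun _ => rfl }
  g := Rep.ofHom
    { toLinearMap := (MonoidHom.toAdditive (QuotientGroup.mk' M)).toIntLinearMap
      isIntertwining' := fun _ => rfl }
  zero := by
    ext F
    exact (QuotientGroup.eq_one_iff (N := M) (Subtype.val (p := (· ∈ M)) F)).2
      (Subtype.property (p := (· ∈ M)) F)

theorem exact_of_forall {k H : Type} [CommRing k] [Group H] (S : ShortComplex (Rep.{0} k H))
    (h : ∀ x : S.X₂, S.g.hom x = 0 → ∃ y : S.X₁, S.f.hom y = x) : S.Exact :=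
  (forget₂ (Rep.{0} k H) (ModuleCat.{0} k)).reflects_exact_of_faithful _
    ((ShortComplex.moduleCat_exact_iff _).2 h)

theorem seqMN_shortExact : seqMN.ShortExact where
  exact := exact_of_forall _ fun F hF =>
    ⟨(⟨F, (QuotientGroup.eq_one_iff (N := M) (F : N)).1 hF⟩ : M), rfl⟩
  mono_f := (Rep.mono_iff_injective _).2 (Subtype.val_injective (p := (· ∈ M)))
  epi_g := (Rep.epi_iff_surjective _).2 (QuotientGroup.mk'_surjective M)

/-- The class in `H¹(G, N / M)` of a `1`-cocycle. -/
def class₁ {u : G → N ⧸ M} (hu : groupCohomology.IsMulCocycle₁ u) :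
    groupCohomology.H1 (Rep.ofMulDistribMulAction G (N ⧸ M)) :=
  groupCohomology.H1π _ (groupCohomology.cocyclesOfIsMulCocycle₁ hu)

/-- The class in `H²(G, M)` of a `2`-cocycle. -/
def class₂ {φ : G × G → M} (hφ : groupCohomology.IsMulCocycle₂ φ) :
    groupCohomology.H2 (Rep.ofMulDistribMulAction G M) :=
  groupCohomology.H2π _ (groupCohomology.cocyclesOfIsMulCocycle₂ hφ)

/-- The connecting homomorphism `δ_* : H¹(G, N / M) → H²(G, M)` of `1 → M → N → N / M → 1`. -/
def connecting : groupCohomology.H1 (Rep.ofMulDistribMulAction G (N ⧸ M)) →ₗ[ℤ]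
    groupCohomology.H2 (Rep.ofMulDistribMulAction G M) :=
  (groupCohomology.δ seqMN_shortExact 1 2 rfl).hom

/-- `u : G → N / M` has the prescribed values on the generators: the classes of `a`, `b`, `c` on
`e_{1,2}`, `e_{3,2}`, `t₂`, and `1` on `e_{i,j}` and `t_j` for `j ≠ 2`. -/
structure IsExtension (a b c : N) (u : G → N ⧸ M) : Prop where
  e₁₂ : u (G.el (i := 0) (j := 1) (by decide)) = QuotientGroup.mk a
  e₃₂ : u (G.el (i := 2) (j := 1) (by decide)) = QuotientGroup.mk b
  e_ne : ∀ (i j : Fin 3) (h : i ≠ j), j ≠ 1 → u (G.el h) = 1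
  t₂ : u (G.t 1) = QuotientGroup.mk c
  t_ne : ∀ j : Fin 3, j ≠ 1 → u (G.t j) = 1

end EllipticGamma

end

open EllipticGamma

noncomputable section

namespace EllipticGamma

open Filter Topology
open scoped Matrix

/-! All values `u(g)` come from one two-point function. To two integral affine functions `v`, `w` on
the dual lattice with independent linear parts one attaches a product of elliptic gamma functions
over the lattice points of a box; the box depends on a third affine function `y`. Three properties
of Γ turn this into a cocycle. The distribution relation makes the product independent of `y`
(`gam_refine`, `gam_eq_gam`). The identity Γ(-z,-τ,-σ) = 1/Γ(z,τ,σ) makes it antisymmetric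
(`gam_swap`). The three-term modular relation of Felder and Varchenko (`tripleGamma_eq`), whose
right-hand side is the exponential of a cubic and so lies in `M`, gives C(v,w) C(w,y) = C(v,y) in `N
⧸ M` (`gam_triple_mem`, `cls_mul`, and `cls'_mul` for dependent linear parts). The construction is
`G`-equivariant, so `g ↦ C(v, g v)` is a 1-cocycle for each fixed `v`; for `v = (0, E₂)` it has the
prescribed values on the generators (`isExtension_u₀`). Since these elements generate `G`, no other
cocycle extends them.

The modular relation is proved by showing that the product of the three gamma functions, divided by
the exponential of the cubic, is multiplied by a constant under each of three periods. Integral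
combinations of the periods accumulate at zero, so the quotient is c exp(l z). A duplication formula
gives l = 0, and evaluation at half the sum of the periods gives c = 1.

On translations the cocycle lifts to Γ₀(z) / Γ₀(z - m x₂). The coboundary of this lift is a double
difference of Γ₀ in the directions x₂ and x₃, an explicit exponential by the quasi-periodicity of θ₀
(`ellGamma_double_difference`, `φ₀_tr_isRep`). If the class were trivial, the lifts of t₁, t₂, t₃
could be corrected to exponentials e(f₁), e(f₂), e(f₃) with f₁, f₂, f₃ polynomial in z. Differencing
their three commutation relations once more, as in a Jacobi identity, cancels every f. What remains
is the change of z/x₁ under z ↦ z - x₁: an integer invisible to e but not to the exponents, and one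
gets 1 = 0 (`false_of_commutation`). -/

/-! ### Holomorphic functions on complex normed spaces. -/

/-- One-variable Cauchy estimate on the complex line through `x` in direction `v`. The circle of
radius `R / (2‖v‖)` stays in the ball of radius `R`, which costs the factor 2. -/
theorem norm_fderiv_le_of_norm_le_on_ball {E : Type*} [NormedAddCommGroup E] [NormedSpace ℂ E]
    {g : E → ℂ} {x : E} {R C : ℝ} (hR : 0 < R) (hg : DifferentiableOn ℂ g (Metric.ball x R))
    (hC : ∀ y ∈ Metric.ball x R, ‖g y‖ ≤ C) : ‖fderiv ℂ g x‖ ≤ 2 * C / R := by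
  have hC0 : 0 ≤ C := (norm_nonneg _).trans (hC x (Metric.mem_ball_self hR))
  refine ContinuousLinearMap.opNorm_le_bound _ (by positivity) fun v => ?_
  rcases eq_or_ne v 0 with rfl | hv
  · simp
  have hv' : 0 < ‖v‖ := norm_pos_iff.2 hv
  set ρ : ℝ := R / (2 * ‖v‖) with hρ
  have hρ0 : 0 < ρ := by positivity
  have hmem : ∀ t : ℂ, ‖t‖ ≤ ρ → x + t • v ∈ Metric.ball x R := fun t ht => by
    rw [Metric.mem_ball, dist_eq_norm, add_sub_cancel_left, norm_smul]
    calc ‖t‖ * ‖v‖ ≤ ρ * ‖v‖ := by gcongr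
      _ = R / 2 := by rw [hρ]; field_simp
      _ < R := by linarith
  have hline : DifferentiableOn ℂ (fun t : ℂ => g (x + t • v)) (Metric.closedBall 0 ρ) :=
    hg.comp (by fun_prop) fun t ht => hmem t (by simpa using ht)
  have hd : HasDerivAt (fun t : ℂ => g (x + t • v)) (fderiv ℂ g x v) 0 := by
    have h1 : HasFDerivAt g (fderiv ℂ g x) (x + (0 : ℂ) • v) := by
      simpa using (hg.differentiableAt (Metric.ball_mem_nhds x hR)).hasFDerivAt
    have h2 : HasDerivAt (fun t : ℂ => x + t • v) v 0 := by
      simpa using ((hasDerivAt_id (0 : ℂ)).smul_const v).const_add x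
    exact h1.comp_hasDerivAt 0 h2
  have := Complex.norm_deriv_le_of_forall_mem_sphere_norm_le hρ0
    (hline.diffContOnCl_ball subset_rfl) (fun t ht => hC _ (hmem t (by
      have : ‖t‖ = ρ := by simpa using ht
      exact this.le)))
  rw [hd.deriv] at this
  refine this.trans (le_of_eq ?_)
  rw [hρ]; field_simp

/-- Weierstrass' theorem: by the Cauchy estimate, uniform convergence of the functions makes their
derivatives uniformly Cauchy on smaller balls. It yields joint holomorphy of the double product in
all three variables. -/
theorem differentiableOn_of_tendstoUniformlyOn {E ι : Type*} [NormedAddCommGroup E]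
    [NormedSpace ℂ E] {l : Filter ι} [l.NeBot] {U : Set E} (hU : IsOpen U) {F : ι → E → ℂ}
    {f : E → ℂ} (hF : ∀ n, DifferentiableOn ℂ (F n) U) (h : TendstoUniformlyOn F f l U) :
    DifferentiableOn ℂ f U := by
  intro x₀ hx₀
  obtain ⟨R, hR, hball⟩ := Metric.isOpen_iff.1 hU x₀ hx₀
  have hsub : ∀ x ∈ Metric.ball x₀ (R / 2), Metric.ball x (R / 2) ⊆ U := fun x hx y hy => by
    refine hball ?_
    rw [Metric.mem_ball] at *
    linarith [dist_triangle y x x₀]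
  have hcau : UniformCauchySeqOn (fun n => fderiv ℂ (F n)) l (Metric.ball x₀ (R / 2)) := by
    intro u hu
    obtain ⟨ε, hε, hεu⟩ := Metric.mem_uniformity_dist.1 hu
    -- The Cauchy estimate on balls of radius R/2 turns this into 2 (ε R / 16) / (R / 2) = ε / 4.
    have hδ : 0 < ε * R / 16 := by positivity
    filter_upwards [h.uniformCauchySeqOn _ (Metric.dist_mem_uniformity hδ)] with m hm x hx
    refine hεu ?_
    have hd : ∀ n, DifferentiableAt ℂ (F n) x := fun n => (hF n).differentiableAt
      (hU.mem_nhds (hsub x hx (Metric.mem_ball_self (by positivity))))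
    rw [dist_eq_norm, ← fderiv_sub (hd m.1) (hd m.2)]
    refine (norm_fderiv_le_of_norm_le_on_ball (R := R / 2) (C := ε * R / 16) (by positivity)
      (((hF m.1).sub (hF m.2)).mono (hsub x hx)) fun y hy => ?_).trans_lt ?_
    · have := hm y (hsub x hx hy)
      rw [dist_eq_norm] at this
      exact this.le
    · field_simp
      linarith
  choose! g' hg' using fun x (hx : x ∈ Metric.ball x₀ (R / 2)) =>
    CompleteSpace.complete (hcau.cauchy_map hx)
  have hu := hcau.tendstoUniformlyOn_of_tendsto hg'
  refine (hasFDerivAt_of_tendstoUniformlyOn (f := F) (g := f) Metric.isOpen_ball hu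
    (fun n x hx => ?_) (fun x hx => ?_)
    (Metric.mem_ball_self (by positivity))).differentiableAt.differentiableWithinAt
  · exact ((hF n).differentiableAt
      (hU.mem_nhds (hsub x hx (Metric.mem_ball_self (by positivity))))).hasFDerivAt
  · exact h.tendsto_at (hsub x hx (Metric.mem_ball_self (by positivity)))

/-! ### The infinite products for |q|, |r| < 1. -/

theorem summable_dprod (x : ℂ) {q r : ℂ} (hq : ‖q‖ < 1) (hr : ‖r‖ < 1) :
    Summable fun p : ℕ × ℕ => ‖-(x * q ^ p.1 * r ^ p.2)‖ := by
  have := ((summable_geometric_of_lt_one (norm_nonneg q) hq).mul_of_nonneg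
    (summable_geometric_of_lt_one (norm_nonneg r) hr) (fun _ => by positivity)
    (fun _ => by positivity)).mul_left ‖x‖
  simpa [mul_assoc] using this

theorem multipliable_dprod (x : ℂ) {q r : ℂ} (hq : ‖q‖ < 1) (hr : ‖r‖ < 1) :
    Multipliable fun p : ℕ × ℕ => 1 - x * q ^ p.1 * r ^ p.2 := by
  simpa [sub_eq_add_neg] using multipliable_one_add_of_summable (summable_dprod x hq hr)

theorem summable_qp (x : ℂ) {q : ℂ} (hq : ‖q‖ < 1) : Summable fun j : ℕ => ‖-(x * q ^ j)‖ := by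
  simpa using (summable_geometric_of_lt_one (norm_nonneg q) hq).mul_left ‖x‖

theorem multipliable_qp (x : ℂ) {q : ℂ} (hq : ‖q‖ < 1) :
    Multipliable fun j : ℕ => 1 - x * q ^ j := by
  simpa [sub_eq_add_neg] using multipliable_one_add_of_summable (summable_qp x hq)

/-- The product `∏_{j ≥ 0} (1 - x q ^ j)`, used for `|q| < 1`. -/
def sprod (x q : ℂ) : ℂ := ∏' j : ℕ, (1 - x * q ^ j)

theorem sprod_ne_zero {x q : ℂ} (hq : ‖q‖ < 1) (h : ∀ j : ℕ, x * q ^ j ≠ 1) : sprod x q ≠ 0 := by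
  have := tprod_one_add_ne_zero_of_summable (f := fun j : ℕ => -(x * q ^ j))
    (fun j => by rw [← sub_eq_add_neg]; exact sub_ne_zero.2 (h j).symm) (summable_qp x hq)
  simpa [sprod, sub_eq_add_neg] using this

theorem dprod_ne_zero {x q r : ℂ} (hq : ‖q‖ < 1) (hr : ‖r‖ < 1)
    (h : ∀ j k : ℕ, x * q ^ j * r ^ k ≠ 1) : dprod x q r ≠ 0 := by
  have := tprod_one_add_ne_zero_of_summable (f := fun p : ℕ × ℕ => -(x * q ^ p.1 * r ^ p.2))
    (fun p => by rw [← sub_eq_add_neg]; exact sub_ne_zero.2 (h p.1 p.2).symm)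
    (summable_dprod x hq hr)
  simpa [dprod, sub_eq_add_neg] using this

theorem tprod_eq_zero_mul_complex {f : ℕ → ℂ} (hf : Multipliable fun j => f (j + 1)) :
    ∏' j, f j = f 0 * ∏' j, f (j + 1) := by
  exact (hf.hasProd.zero_mul).tprod_eq

theorem sprod_eq (x : ℂ) {q : ℂ} (hq : ‖q‖ < 1) : sprod x q = (1 - x) * sprod (q * x) q := by
  have h : ∀ j : ℕ, 1 - x * q ^ (j + 1) = 1 - q * x * q ^ j := fun j => by ring
  rw [sprod, tprod_eq_zero_mul_complex (by simpa only [h] using multipliable_qp (q * x) hq)]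
  simp only [h, sprod, pow_zero, mul_one]

theorem dprod_comm (x q r : ℂ) : dprod x q r = dprod x r q := by
  rw [dprod, ← (Equiv.prodComm ℕ ℕ).tprod_eq]
  simp only [Equiv.prodComm_apply, Prod.fst_swap, Prod.snd_swap, dprod]
  exact tprod_congr fun p => by ring

theorem dprod_eq_tprod_sprod (x : ℂ) {q r : ℂ} (hq : ‖q‖ < 1) (hr : ‖r‖ < 1) :
    dprod x q r = ∏' j : ℕ, sprod (x * r ^ j) q := by
  rw [dprod_comm, dprod, (multipliable_dprod x hr hq).tprod_prod' fun j => ?_]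
  · rfl
  · exact multipliable_qp (x * r ^ j) hq

/-- The factors with exponent zero in `r` form the single product. This is the source of Γ(z + σ) =
θ₀(z, τ) Γ(z). -/
theorem dprod_eq (x : ℂ) {q r : ℂ} (hq : ‖q‖ < 1) (hr : ‖r‖ < 1) :
    dprod x q r = sprod x q * dprod (r * x) q r := by
  have key : HasProd (fun j : ℕ => sprod (r * x * r ^ j) q) (dprod (r * x) q r) := by
    have h := (multipliable_dprod (r * x) hr hq).hasProd.prod_fiberwise
      (g := fun j => sprod (r * x * r ^ j) q) fun j => (multipliable_qp (r * x * r ^ j) hq).hasProd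
    rwa [show ∏' p : ℕ × ℕ, (1 - r * x * r ^ p.1 * q ^ p.2) = dprod (r * x) q r from
      dprod_comm _ _ _] at h
  have h : ∀ j : ℕ, sprod (x * r ^ (j + 1)) q = sprod (r * x * r ^ j) q := fun j => by
    congr 1; ring
  rw [dprod_eq_tprod_sprod x hq hr,
    tprod_eq_zero_mul_complex (by simpa only [h] using key.multipliable)]
  simp only [h, key.tprod_eq, pow_zero, mul_one]

/-- The exponents of `q` are sorted by their residue modulo `n`. -/
theorem sprod_distrib (x : ℂ) {q : ℂ} (hq : ‖q‖ < 1) {n : ℕ} (hn : 0 < n) :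
    sprod x q = ∏ i ∈ Finset.range n, sprod (x * q ^ i) (q ^ n) := by
  have : NeZero n := ⟨hn.ne'⟩
  have hqn : ‖q ^ n‖ < 1 := by rw [norm_pow]; exact pow_lt_one₀ (norm_nonneg _) hq hn.ne'
  rw [sprod, ← (Nat.divModEquiv n).symm.tprod_eq, ← (Equiv.prodComm _ _).tprod_eq]
  have hm := (Equiv.prodComm (Fin n) ℕ).multipliable_iff.2
    ((Nat.divModEquiv n).symm.multipliable_iff.2 (multipliable_qp x hq))
  refine (Multipliable.tprod_prod' hm fun i => ?_).trans ?_
  · refine (multipliable_qp (x * q ^ (i : ℕ)) hqn).congr fun j => ?_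
    simp [pow_add, pow_mul]
    ring
  · rw [tprod_fintype, Finset.prod_range]
    refine Finset.prod_congr rfl fun i _ => tprod_congr fun j => ?_
    simp [pow_add, pow_mul]
    ring

theorem dprod_distrib_left (x : ℂ) {q r : ℂ} (hq : ‖q‖ < 1) (hr : ‖r‖ < 1) {n : ℕ} (hn : 0 < n) :
    dprod x q r = ∏ i ∈ Finset.range n, dprod (x * q ^ i) (q ^ n) r := by
  have hqn : ‖q ^ n‖ < 1 := by rw [norm_pow]; exact pow_lt_one₀ (norm_nonneg _) hq hn.ne'
  rw [dprod_eq_tprod_sprod x hq hr]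
  have key : ∀ i, HasProd (fun j : ℕ => sprod (x * q ^ i * r ^ j) (q ^ n))
      (dprod (x * q ^ i) (q ^ n) r) := fun i => by
    have h := (multipliable_dprod (x * q ^ i) hr hqn).hasProd.prod_fiberwise
      (g := fun j => sprod (x * q ^ i * r ^ j) (q ^ n))
      fun j => (multipliable_qp (x * q ^ i * r ^ j) hqn).hasProd
    rwa [show ∏' p : ℕ × ℕ, (1 - x * q ^ i * r ^ p.1 * (q ^ n) ^ p.2) = dprod (x * q ^ i) (q ^ n) r
      from dprod_comm _ _ _] at h
  rw [← (hasProd_prod fun i (_ : i ∈ Finset.range n) => key i).tprod_eq]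
  refine tprod_congr fun j => ?_
  rw [sprod_distrib _ hq hn]
  exact Finset.prod_congr rfl fun i _ => by rw [mul_right_comm]

theorem dprod_distrib (x : ℂ) {q r : ℂ} (hq : ‖q‖ < 1) (hr : ‖r‖ < 1) {n : ℕ} (hn : 0 < n) :
    dprod x q r = ∏ i ∈ Finset.range n, ∏ j ∈ Finset.range n,
      dprod (x * q ^ i * r ^ j) (q ^ n) (r ^ n) := by
  have hqn : ‖q ^ n‖ < 1 := by rw [norm_pow]; exact pow_lt_one₀ (norm_nonneg _) hq hn.ne'
  rw [dprod_distrib_left x hq hr hn]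
  refine Finset.prod_congr rfl fun i _ => ?_
  rw [dprod_comm, dprod_distrib_left _ hr hqn hn]
  exact Finset.prod_congr rfl fun j _ => by rw [dprod_comm]

theorem dprod_sq (x : ℂ) {q r : ℂ} (hq : ‖q‖ < 1) (hr : ‖r‖ < 1) :
    dprod (x ^ 2) (q ^ 2) (r ^ 2) = dprod x q r * dprod (-x) q r := by
  rw [dprod, dprod, dprod, ← (multipliable_dprod x hq hr).tprod_mul (multipliable_dprod (-x) hq hr)]
  exact tprod_congr fun p => by ring

/-- On a polydisc |x| ≤ R, |q|, |r| ≤ ρ < 1 the product is dominated by the geometric series R ρ^j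
ρ^k, so its polynomial partial products converge uniformly. -/
theorem differentiableAt_dprod {t : ℂ × ℂ × ℂ} (hq : ‖t.2.1‖ < 1) (hr : ‖t.2.2‖ < 1) :
    DifferentiableAt ℂ (fun t : ℂ × ℂ × ℂ => dprod t.1 t.2.1 t.2.2) t := by
  obtain ⟨ρ, h1, hρ⟩ := exists_between (max_lt hq hr)
  obtain ⟨hq', hr'⟩ := max_lt_iff.1 h1
  have hρ0 : 0 < ρ := (norm_nonneg _).trans_lt hq'
  set R : ℝ := ‖t.1‖ + 1
  have hR : 0 < R := by positivity
  set K : Set (ℂ × ℂ × ℂ) :=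
    Metric.closedBall 0 R ×ˢ (Metric.closedBall 0 ρ ×ˢ Metric.closedBall 0 ρ) with hKdef
  set U : Set (ℂ × ℂ × ℂ) := Metric.ball 0 R ×ˢ (Metric.ball 0 ρ ×ˢ Metric.ball 0 ρ)
  have hU : IsOpen U := Metric.isOpen_ball.prod (Metric.isOpen_ball.prod Metric.isOpen_ball)
  have hUK : U ⊆ K := Set.prod_mono Metric.ball_subset_closedBall
    (Set.prod_mono Metric.ball_subset_closedBall Metric.ball_subset_closedBall)
  have hK : IsCompact K := (isCompact_closedBall _ _).prod
    ((isCompact_closedBall _ _).prod (isCompact_closedBall _ _))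
  have hu : Summable fun p : ℕ × ℕ => R * ρ ^ p.1 * ρ ^ p.2 := by
    have := ((summable_geometric_of_lt_one hρ0.le hρ).mul_of_nonneg
      (summable_geometric_of_lt_one hρ0.le hρ) (fun _ => by positivity)
      (fun _ => by positivity)).mul_left R
    simpa [mul_assoc] using this
  have hprod := hu.hasProdUniformlyOn_one_add (K := K)
    (f := fun p (t : ℂ × ℂ × ℂ) => -(t.1 * t.2.1 ^ p.1 * t.2.2 ^ p.2)) hK
    (Eventually.of_forall fun p s hs => by
      simp only [hKdef, Set.mem_prod, mem_closedBall_zero_iff] at hs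
      rw [norm_neg, norm_mul, norm_mul, norm_pow, norm_pow]
      gcongr
      exacts [hs.1, hs.2.1, hs.2.2]) (fun p => by fun_prop)
  rw [hasProdUniformlyOn_iff_tendstoUniformlyOn] at hprod
  have := differentiableOn_of_tendstoUniformlyOn hU (fun s => ?_) (hprod.mono hUK)
  · refine (this.congr fun s _ => ?_).differentiableAt (hU.mem_nhds ?_)
    · simp [dprod, sub_eq_add_neg]
    · simp [U, R, hq', hr']
  · refine Differentiable.differentiableOn ?_
    classical
    induction s using Finset.induction_on with
    | empty => simp
    | insert a s ha ih =>
      simp only [Finset.prod_insert ha]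
      exact Differentiable.mul (by fun_prop) ih

/-! ### The exponential `e`. -/

theorem e_add (z w : ℂ) : e (z + w) = e z * e w := by
  rw [e, e, e, ← Complex.exp_add, mul_add]

theorem e_ne_zero (z : ℂ) : e z ≠ 0 := Complex.exp_ne_zero _

theorem e_neg (z : ℂ) : e (-z) = (e z)⁻¹ := by rw [e, e, ← Complex.exp_neg, mul_neg]

theorem e_sub (z w : ℂ) : e (z - w) = e z / e w := by
  rw [sub_eq_add_neg, e_add, e_neg, div_eq_mul_inv]

@[simp] theorem e_zero : e 0 = 1 := by simp [e]

@[simp] theorem e_intCast (n : ℤ) : e n = 1 := by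
  rw [e, mul_comm, Complex.exp_int_mul_two_pi_mul_I]

@[simp] theorem e_one : e 1 = 1 := by simpa using e_intCast 1

@[simp] theorem e_half : e (1 / 2) = -1 := by
  rw [e, show 2 * (Real.pi : ℂ) * Complex.I * (1 / 2) = Real.pi * Complex.I by ring,
    Complex.exp_pi_mul_I]

theorem e_nat_mul (n : ℕ) (z : ℂ) : e (n * z) = e z ^ n := by
  rw [e, e, ← Complex.exp_nat_mul]; ring_nf

theorem e_two_mul (z : ℂ) : e (2 * z) = e z ^ 2 := by exact_mod_cast e_nat_mul 2 z

theorem e_eq_one_iff {z : ℂ} : e z = 1 ↔ ∃ n : ℤ, z = n := by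
  rw [e, Complex.exp_eq_one_iff]
  refine exists_congr fun n => ⟨fun h => ?_, fun h => by rw [h]; ring⟩
  have : (2 * Real.pi * Complex.I : ℂ) ≠ 0 := Complex.two_pi_I_ne_zero
  exact mul_left_cancel₀ this (by rw [h]; ring)

theorem e_eq_e_iff {z w : ℂ} : e z = e w ↔ ∃ n : ℤ, z = w + n := by
  rw [← div_eq_one_iff_eq (e_ne_zero w), ← e_sub, e_eq_one_iff]
  exact exists_congr fun n => sub_eq_iff_eq_add'

theorem norm_e (z : ℂ) : ‖e z‖ = Real.exp (-(2 * Real.pi * z.im)) := by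
  rw [e, Complex.norm_exp]; simp

theorem norm_e_lt_one {z : ℂ} : ‖e z‖ < 1 ↔ 0 < z.im := by
  rw [norm_e, Real.exp_lt_one_iff, neg_lt_zero]
  simp [Real.pi_pos]

theorem differentiable_e : Differentiable ℂ e := by unfold e; fun_prop

/-! ### Functional equations of Γ and θ₀. -/

/-- `z ∉ ℤ + ℤ τ + ℤ σ`. -/
def OffLattice (z τ σ : ℂ) : Prop := ∀ a b c : ℤ, z ≠ a + b * τ + c * σ

theorem OffLattice.neg_left {z τ σ : ℂ} (h : OffLattice z (-τ) σ) : OffLattice z τ σ :=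
  fun a b c hz => h a (-b) c (by rw [hz]; push_cast; ring)

theorem OffLattice.neg_right {z τ σ : ℂ} (h : OffLattice z τ (-σ)) : OffLattice z τ σ :=
  fun a b c hz => h a b (-c) (by rw [hz]; push_cast; ring)

theorem OffLattice.add_left {z τ σ : ℂ} (h : OffLattice z τ σ) : OffLattice (z + τ) τ σ :=
  fun a b c hz => h a (b - 1) c (by push_cast; linear_combination hz)

theorem OffLattice.add_right {z τ σ : ℂ} (h : OffLattice z τ σ) : OffLattice (z + σ) τ σ :=
  fun a b c hz => h a b (c - 1) (by push_cast; linear_combination hz)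

theorem OffLattice.swap {z τ σ : ℂ} (h : OffLattice z τ σ) : OffLattice z σ τ :=
  fun a b c hz => h a c b (by rw [hz]; ring)

theorem one_le_norm_inv {q : ℂ} (hq0 : q ≠ 0) (hq : ‖q‖ < 1) : ¬ ‖q⁻¹‖ < 1 := by
  rw [norm_inv, not_lt]
  exact (one_lt_inv₀ (norm_pos_iff.2 hq0)).2 hq |>.le

theorem qPoch_of_norm_lt {x q : ℂ} (hq : ‖q‖ < 1) : qPoch x q = sprod x q := if_pos hq

theorem qPoch_inv {x q : ℂ} (hq0 : q ≠ 0) (hq : ‖q‖ < 1) :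
    qPoch x q⁻¹ = (sprod (q * x) q)⁻¹ := by
  rw [qPoch, if_neg (one_le_norm_inv hq0 hq), inv_inv, sprod]

theorem qPoch₂_of_norm_lt {x q r : ℂ} (hq : ‖q‖ < 1) (hr : ‖r‖ < 1) :
    qPoch₂ x q r = dprod x q r := by
  rw [qPoch₂, if_pos hq, if_pos hr]

theorem qPoch₂_comm (x q r : ℂ) : qPoch₂ x q r = qPoch₂ x r q := by
  unfold qPoch₂
  split_ifs <;> simp only [dprod_comm _ q r, dprod_comm _ q⁻¹ r, dprod_comm _ q r⁻¹,
    dprod_comm _ q⁻¹ r⁻¹, mul_comm q⁻¹ r⁻¹]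

theorem qPoch₂_inv_left {x q r : ℂ} (hq0 : q ≠ 0) (hq : ‖q‖ < 1) :
    qPoch₂ x q⁻¹ r = (qPoch₂ (q * x) q r)⁻¹ := by
  unfold qPoch₂
  rw [if_neg (one_le_norm_inv hq0 hq), if_pos hq]
  split_ifs
  · rw [inv_inv]
  · rw [inv_inv, inv_inv]
    congr 1
    ring

theorem ellGamma_comm (z τ σ : ℂ) : ellGamma z τ σ = ellGamma z σ τ := by
  rw [ellGamma, ellGamma, qPoch₂_comm, qPoch₂_comm (e z), mul_comm (e τ)]

theorem ellGamma_neg_left (z : ℂ) {τ : ℂ} (σ : ℂ) (hτ : τ.im ≠ 0) :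
    ellGamma z (-τ) σ = (ellGamma (z + τ) τ σ)⁻¹ := by
  have key : ∀ (z τ : ℂ), 0 < τ.im → ellGamma z (-τ) σ = (ellGamma (z + τ) τ σ)⁻¹ := by
    intro z τ hτ
    have hq := norm_e_lt_one.2 hτ
    have h0 := e_ne_zero τ
    rw [ellGamma, ellGamma, e_neg, qPoch₂_inv_left h0 hq, qPoch₂_inv_left h0 hq, inv_div_inv,
      inv_div, e_add]
    congr 2
    · ring
    · field_simp [e_ne_zero z]
  rcases hτ.lt_or_gt with h | h
  · rw [← inv_inv (ellGamma z (-τ) σ)]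
    have := key (z + τ) (-τ) (by simpa using h)
    rw [neg_neg, add_neg_cancel_right] at this
    rw [this]
  · exact key z τ h

theorem ellGamma_neg_right (z τ : ℂ) {σ : ℂ} (hσ : σ.im ≠ 0) :
    ellGamma z τ (-σ) = (ellGamma (z + σ) τ σ)⁻¹ := by
  rw [ellGamma_comm, ellGamma_neg_left z τ hσ, ellGamma_comm]

theorem ellGamma_add_one (z τ σ : ℂ) : ellGamma (z + 1) τ σ = ellGamma z τ σ := by
  rw [ellGamma, ellGamma, e_add, e_one, mul_one]

theorem ellGamma_congr {z z' τ τ' σ σ' : ℂ} (h : e z = e z') (hτ : e τ = e τ') (hσ : e σ = e σ') :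
    ellGamma z τ σ = ellGamma z' τ' σ' := by
  rw [ellGamma, ellGamma, h, hτ, hσ]

/-- Reduces identities for nonreal τ, σ to the upper half plane, where Γ is given by convergent
products. The sign flips are controlled by `ellGamma_neg_left` and `ellGamma_neg_right`. -/
theorem flip_induction {P : ℂ → ℂ → Prop}
    (hpos : ∀ τ σ : ℂ, 0 < τ.im → 0 < σ.im → P τ σ)
    (hl : ∀ τ σ : ℂ, τ.im ≠ 0 → σ.im ≠ 0 → P τ σ → P (-τ) σ)
    (hr : ∀ τ σ : ℂ, τ.im ≠ 0 → σ.im ≠ 0 → P τ σ → P τ (-σ))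
    {τ σ : ℂ} (hτ : τ.im ≠ 0) (hσ : σ.im ≠ 0) : P τ σ := by
  have h1 : ∀ τ σ : ℂ, τ.im ≠ 0 → 0 < σ.im → P τ σ := fun τ σ hτ hσ => by
    rcases hτ.lt_or_gt with h | h
    · simpa using hl (-τ) σ (by simpa using hτ) hσ.ne' (hpos (-τ) σ (by simpa using h) hσ)
    · exact hpos τ σ h hσ
  rcases hσ.lt_or_gt with h | h
  · simpa using hr τ (-σ) hτ (by simpa using hσ) (h1 τ (-σ) hτ (by simpa using h))
  · exact h1 τ σ hτ h

theorem ellGamma_of_pos {τ σ : ℂ} (z : ℂ) (hτ : 0 < τ.im) (hσ : 0 < σ.im) :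
    ellGamma z τ σ =
      dprod (e τ * e σ / e z) (e τ) (e σ) / dprod (e z) (e τ) (e σ) := by
  rw [ellGamma, qPoch₂_of_norm_lt (norm_e_lt_one.2 hτ) (norm_e_lt_one.2 hσ),
    qPoch₂_of_norm_lt (norm_e_lt_one.2 hτ) (norm_e_lt_one.2 hσ)]

/-- Gives a pole-free form of Γ in z, to which the identity theorem applies. A sign flip of τ or σ
exchanges the roles of `U` and `V`. -/
theorem exists_entire_ratio {τ σ : ℂ} (hτ : τ.im ≠ 0) (hσ : σ.im ≠ 0) :
    ∃ U V : ℂ → ℂ, Differentiable ℂ U ∧ Differentiable ℂ V ∧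
      (∀ z, ellGamma z τ σ = U z / V z) ∧ ∀ z, OffLattice z τ σ → U z ≠ 0 ∧ V z ≠ 0 := by
  refine flip_induction (P := fun τ σ => ∃ U V : ℂ → ℂ, Differentiable ℂ U ∧ Differentiable ℂ V ∧
      (∀ z, ellGamma z τ σ = U z / V z) ∧ ∀ z, OffLattice z τ σ → U z ≠ 0 ∧ V z ≠ 0) ?_ ?_ ?_ hτ hσ
  · intro τ σ hτ hσ
    have hq := norm_e_lt_one.2 hτ
    have hr := norm_e_lt_one.2 hσ
    have hd : ∀ f : ℂ → ℂ, Differentiable ℂ f → Differentiable ℂ fun z => dprod (f z) (e τ) (e σ) :=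
      fun f hf z => by
        have h1 := differentiableAt_dprod (t := (f z, e τ, e σ)) hq hr
        have h2 : DifferentiableAt ℂ (fun z => (f z, e τ, e σ)) z :=
          (hf z).prodMk (differentiableAt_const _)
        exact h1.comp z h2
    have hn : Differentiable ℂ fun z => e τ * e σ * e (-z) :=
      (differentiable_e.comp differentiable_neg).const_mul _
    refine ⟨fun z => dprod (e τ * e σ * e (-z)) (e τ) (e σ), fun z => dprod (e z) (e τ) (e σ),
      hd _ hn, hd _ differentiable_e, fun z => ?_, fun z hz => ⟨?_, ?_⟩⟩
    · simp only [ellGamma_of_pos z hτ hσ, e_neg, div_eq_mul_inv (e τ * e σ)]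
    · refine dprod_ne_zero hq hr fun j k h => ?_
      rw [← e_nat_mul, ← e_nat_mul, ← e_add, ← e_add, ← e_add, ← e_add, e_eq_one_iff] at h
      obtain ⟨n, hn⟩ := h
      exact hz (-n) (j + 1) (k + 1) (by push_cast; linear_combination -hn)
    · refine dprod_ne_zero hq hr fun j k h => ?_
      rw [← e_nat_mul, ← e_nat_mul, ← e_add, ← e_add, e_eq_one_iff] at h
      obtain ⟨n, hn⟩ := h
      exact hz n (-j) (-k) (by push_cast; linear_combination hn)
  · rintro τ σ hτ - ⟨U, V, hU, hV, h, h0⟩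
    refine ⟨fun z => V (z + τ), fun z => U (z + τ), by fun_prop, by fun_prop, fun z => ?_,
      fun z hz => (h0 _ hz.neg_left.add_left).symm⟩
    rw [ellGamma_neg_left z σ hτ, h, inv_div]
  · rintro τ σ - hσ ⟨U, V, hU, hV, h, h0⟩
    refine ⟨fun z => V (z + σ), fun z => U (z + σ), by fun_prop, by fun_prop, fun z => ?_,
      fun z hz => (h0 _ hz.neg_right.add_right).symm⟩
    rw [ellGamma_neg_right z τ hσ, h, inv_div]

theorem ellGamma_ne_zero {z τ σ : ℂ} (hτ : τ.im ≠ 0) (hσ : σ.im ≠ 0) (hz : OffLattice z τ σ) :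
    ellGamma z τ σ ≠ 0 := by
  obtain ⟨U, V, -, -, h, h0⟩ := exists_entire_ratio hτ hσ
  rw [h]
  exact div_ne_zero (h0 z hz).1 (h0 z hz).2

theorem ellGamma_neg_neg_neg (z : ℂ) {τ σ : ℂ} (hτ : τ.im ≠ 0) (hσ : σ.im ≠ 0) :
    ellGamma (-z) (-τ) (-σ) = (ellGamma z τ σ)⁻¹ := by
  rw [ellGamma_neg_left _ _ hτ, ellGamma_neg_right _ _ hσ, inv_inv, ellGamma, ellGamma, inv_div]
  have h : e (-z + τ + σ) = e τ * e σ / e z := by rw [e_add, e_add, e_neg]; ring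
  rw [h]
  congr 2
  field_simp [e_ne_zero z, e_ne_zero τ, e_ne_zero σ]

/-- If x² = qr, then qr/x = x, so numerator and denominator of Γ coincide. This normalizes the
modular relation. -/
theorem ellGamma_eq_one {z τ σ : ℂ} (hτ : τ.im ≠ 0) (hσ : σ.im ≠ 0) (hz : OffLattice z τ σ)
    (h : e z ^ 2 = e τ * e σ) : ellGamma z τ σ = 1 := by
  have h0 := ellGamma_ne_zero hτ hσ hz
  rw [ellGamma, ← h, pow_two, mul_div_cancel_left₀ _ (e_ne_zero z)] at *
  exact div_self (div_ne_zero_iff.1 h0).1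

theorem theta₀_of_pos (z : ℂ) {τ : ℂ} (hτ : 0 < τ.im) :
    theta₀ z τ = sprod (e z) (e τ) * sprod (e τ / e z) (e τ) := by
  rw [theta₀, qPoch_of_norm_lt (norm_e_lt_one.2 hτ), qPoch_of_norm_lt (norm_e_lt_one.2 hτ)]

theorem theta₀_neg (z : ℂ) {τ : ℂ} (hτ : τ.im ≠ 0) : theta₀ z (-τ) = (theta₀ (z + τ) τ)⁻¹ := by
  have key : ∀ (z τ : ℂ), 0 < τ.im → theta₀ z (-τ) = (theta₀ (z + τ) τ)⁻¹ := by
    intro z τ hτ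
    have hq := norm_e_lt_one.2 hτ
    have h0 := e_ne_zero τ
    rw [theta₀_of_pos _ hτ, theta₀, e_neg, qPoch_inv h0 hq, qPoch_inv h0 hq, mul_inv, e_add]
    congr 3
    · ring
    · field_simp [e_ne_zero z]
  rcases hτ.lt_or_gt with h | h
  · rw [← inv_inv (theta₀ z (-τ))]
    have := key (z + τ) (-τ) (by simpa using h)
    rw [neg_neg, add_neg_cancel_right] at this
    rw [this]
  · exact key z τ h

theorem theta₀_add_one (z τ : ℂ) : theta₀ (z + 1) τ = theta₀ z τ := by
  rw [theta₀, theta₀, e_add, e_one, mul_one]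

theorem theta₀_add (z : ℂ) {τ : ℂ} (hτ : τ.im ≠ 0) :
    theta₀ (z + τ) τ = -e (-z) * theta₀ z τ := by
  have key : ∀ (z τ : ℂ), 0 < τ.im → theta₀ (z + τ) τ = -e (-z) * theta₀ z τ := by
    intro z τ hτ
    have hq := norm_e_lt_one.2 hτ
    have h0 := e_ne_zero τ
    have hz := e_ne_zero z
    rw [theta₀_of_pos _ hτ, theta₀_of_pos _ hτ, sprod_eq (e z) hq, e_add,
      show e τ / (e z * e τ) = (e z)⁻¹ by field_simp, sprod_eq (e z)⁻¹ hq, e_neg,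
      mul_comm (e z) (e τ), ← div_eq_mul_inv (e τ)]
    field_simp
    ring
  rcases hτ.lt_or_gt with h | h
  · have h' : 0 < (-τ).im := by simpa using h
    have h1 := theta₀_neg (z + τ) h'.ne'
    have h2 := theta₀_neg z h'.ne'
    rw [neg_neg] at h1 h2
    rw [add_neg_cancel_right] at h1
    have h3 := key (z + -τ) (-τ) h'
    rw [h1, h2, ← sub_eq_add_neg]
    have h4 := key z (-τ) h'
    rw [← sub_eq_add_neg] at h4
    rw [h4, e_neg]
    have := e_ne_zero z
    field_simp
  · exact key z τ h

theorem theta₀_ne_zero {z τ : ℂ} (hτ : τ.im ≠ 0) (hz : ∀ a b : ℤ, z ≠ a + b * τ) :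
    theta₀ z τ ≠ 0 := by
  have key : ∀ (z τ : ℂ), 0 < τ.im → (∀ a b : ℤ, z ≠ a + b * τ) → theta₀ z τ ≠ 0 := by
    intro z τ hτ hz
    have hq := norm_e_lt_one.2 hτ
    rw [theta₀_of_pos _ hτ]
    refine mul_ne_zero (sprod_ne_zero hq fun j h => ?_) (sprod_ne_zero hq fun j h => ?_)
    · rw [← e_nat_mul, ← e_add, e_eq_one_iff] at h
      obtain ⟨n, hn⟩ := h
      exact hz n (-j) (by push_cast; linear_combination hn)
    · rw [← e_nat_mul, ← e_sub, ← e_add, e_eq_one_iff] at h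
      obtain ⟨n, hn⟩ := h
      exact hz (-n) (j + 1) (by push_cast; linear_combination -hn)
  rcases hτ.lt_or_gt with h | h
  · have h' : 0 < (-τ).im := by simpa using h
    have h1 := theta₀_neg z h'.ne'
    rw [neg_neg] at h1
    rw [h1]
    refine inv_ne_zero (key _ _ h' fun a b hab => hz a (1 - b) ?_)
    push_cast
    linear_combination hab
  · exact key z τ h hz

/-- Nonvanishing of the two values excludes zeros and also poles, since division by zero gives zero.
`theta_isRep` needs this form: the equation has to hold on an open set, and the lattice ℤ + ℤτ + ℤσ
is not closed in general. -/
theorem ellGamma_add_right_of_ne_zero {z τ σ : ℂ} (hτ : τ.im ≠ 0) (hσ : σ.im ≠ 0)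
    (h : ellGamma z τ σ ≠ 0) (h' : ellGamma (z + σ) τ σ ≠ 0) :
    ellGamma (z + σ) τ σ = theta₀ z τ * ellGamma z τ σ := by
  refine flip_induction (P := fun τ σ => ∀ z, ellGamma z τ σ ≠ 0 → ellGamma (z + σ) τ σ ≠ 0 →
    ellGamma (z + σ) τ σ = theta₀ z τ * ellGamma z τ σ) ?_ ?_ ?_ hτ hσ z h h'
  · intro τ σ hτ hσ z h0 _
    have hq := norm_e_lt_one.2 hτ
    have hr := norm_e_lt_one.2 hσ
    rw [ellGamma_of_pos _ hτ hσ] at h0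
    have h1 := (div_ne_zero_iff.1 h0).2
    have hx := e_ne_zero z
    have hr0 := e_ne_zero σ
    rw [ellGamma_of_pos _ hτ hσ, ellGamma_of_pos _ hτ hσ, theta₀_of_pos _ hτ]
    rw [dprod_eq _ hq hr] at h1 ⊢
    rw [dprod_eq (e z) hq hr, e_add]
    obtain ⟨h2, h3⟩ := mul_ne_zero_iff.1 h1
    rw [show e σ * (e τ * e σ / (e z * e σ)) = e τ * e σ / e z by field_simp,
      show e τ * e σ / (e z * e σ) = e τ / e z by field_simp, mul_comm (e z) (e σ)]
    field_simp
  · intro τ σ hτ hσ ih z h h'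
    rw [ellGamma_neg_left _ _ hτ, ne_eq, inv_eq_zero] at h h'
    rw [add_right_comm] at h'
    rw [ellGamma_neg_left _ _ hτ, ellGamma_neg_left _ _ hτ, add_right_comm,
      ih _ h h', theta₀_neg _ hτ, mul_inv]
  · intro τ σ hτ hσ ih z h h'
    rw [ellGamma_neg_right _ _ hσ, ne_eq, inv_eq_zero] at h h'
    rw [neg_add_cancel_right] at h'
    have h1 := ih z h' h
    rw [ellGamma_neg_right _ _ hσ, ellGamma_neg_right _ _ hσ, neg_add_cancel_right, h1, mul_inv,
      ← mul_assoc, mul_inv_cancel₀, one_mul]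
    rw [h1] at h
    exact left_ne_zero_of_mul h

theorem ellGamma_add_right {z τ σ : ℂ} (hτ : τ.im ≠ 0) (hσ : σ.im ≠ 0) (hz : OffLattice z τ σ) :
    ellGamma (z + σ) τ σ = theta₀ z τ * ellGamma z τ σ :=
  ellGamma_add_right_of_ne_zero hτ hσ (ellGamma_ne_zero hτ hσ hz)
    (ellGamma_ne_zero hτ hσ hz.add_right)

theorem ellGamma_add_left {z τ σ : ℂ} (hτ : τ.im ≠ 0) (hσ : σ.im ≠ 0) (hz : OffLattice z τ σ) :
    ellGamma (z + τ) τ σ = theta₀ z σ * ellGamma z τ σ := by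
  rw [ellGamma_comm, ellGamma_add_right hσ hτ hz.swap, ellGamma_comm]

/-- Both exponents are sorted by their residues modulo `n`. This distribution relation is what later
makes the product over a box independent of the third covector. -/
theorem ellGamma_distrib {τ σ : ℂ} (hτ : τ.im ≠ 0) (hσ : σ.im ≠ 0) {n : ℕ} (hn : 0 < n) (z : ℂ) :
    ellGamma z τ σ = ∏ i ∈ Finset.range n, ∏ j ∈ Finset.range n,
      ellGamma (z + i * τ + j * σ) (n * τ) (n * σ) := by
  have hn' : (0 : ℝ) < n := by exact_mod_cast hn
  have him : ∀ τ : ℂ, (n * τ).im = n * τ.im := fun τ => by simp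
  refine flip_induction (P := fun τ σ => ∀ z, ellGamma z τ σ = ∏ i ∈ Finset.range n,
    ∏ j ∈ Finset.range n, ellGamma (z + i * τ + j * σ) (n * τ) (n * σ)) ?_ ?_ ?_ hτ hσ z
  · intro τ σ hτ hσ z
    have hq := norm_e_lt_one.2 hτ
    have hr := norm_e_lt_one.2 hσ
    have h1 : 0 < (n * τ).im := by rw [him]; positivity
    have h2 : 0 < (n * σ).im := by rw [him]; positivity
    have hx := e_ne_zero z
    have hq0 := e_ne_zero τ
    have hr0 := e_ne_zero σ
    rw [ellGamma_of_pos _ hτ hσ, dprod_distrib _ hq hr hn, dprod_distrib (e z) hq hr hn]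
    simp only [ellGamma_of_pos _ h1 h2, Finset.prod_div_distrib, e_add, e_nat_mul]
    congr 1
    -- In the numerator x enters inverted: the residue class i corresponds to the shift of z by (n -
    -- 1 - i) τ.
    rw [← Finset.prod_range_reflect]
    refine Finset.prod_congr rfl fun i hi => ?_
    rw [← Finset.prod_range_reflect]
    refine Finset.prod_congr rfl fun j hj => ?_
    congr 1
    have hi' : e τ ^ n = e τ ^ (n - 1 - i) * e τ ^ i * e τ := by
      rw [← pow_add, ← pow_succ]; congr 1; have := Finset.mem_range.1 hi; omega
    have hj' : e σ ^ n = e σ ^ (n - 1 - j) * e σ ^ j * e σ := by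
      rw [← pow_add, ← pow_succ]; congr 1; have := Finset.mem_range.1 hj; omega
    rw [hi', hj']
    field_simp
  · intro τ σ hτ hσ ih z
    have h1 : (n * τ).im ≠ 0 := by rw [him]; positivity
    rw [ellGamma_neg_left _ _ hτ, ih, ← Finset.prod_inv_distrib, ← Finset.prod_range_reflect]
    refine Finset.prod_congr rfl fun i hi => ?_
    rw [← Finset.prod_inv_distrib]
    refine Finset.prod_congr rfl fun j _ => ?_
    rw [mul_neg (n : ℂ), ellGamma_neg_left _ _ h1]
    congr 2
    rw [Nat.sub_sub, Nat.cast_sub (by have := Finset.mem_range.1 hi; omega)]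
    push_cast
    ring
  · intro τ σ hτ hσ ih z
    have h1 : (n * σ).im ≠ 0 := by rw [him]; positivity
    rw [ellGamma_neg_right _ _ hσ, ih, ← Finset.prod_inv_distrib]
    refine Finset.prod_congr rfl fun i _ => ?_
    rw [← Finset.prod_inv_distrib, ← Finset.prod_range_reflect]
    refine Finset.prod_congr rfl fun j hj => ?_
    rw [mul_neg (n : ℂ), ellGamma_neg_right _ _ h1]
    congr 2
    rw [Nat.sub_sub, Nat.cast_sub (by have := Finset.mem_range.1 hj; omega)]
    push_cast
    ring

/-- Factorwise this is 1 - y² = (1 - y)(1 + y); the shift by 1/2 changes the sign of x. -/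
theorem ellGamma_two_mul {τ σ : ℂ} (hτ : τ.im ≠ 0) (hσ : σ.im ≠ 0) (z : ℂ) :
    ellGamma (2 * z) (2 * τ) (2 * σ) = ellGamma z τ σ * ellGamma (z + 1 / 2) τ σ := by
  refine flip_induction (P := fun τ σ => ∀ z, ellGamma (2 * z) (2 * τ) (2 * σ) =
    ellGamma z τ σ * ellGamma (z + 1 / 2) τ σ) ?_ ?_ ?_ hτ hσ z
  · intro τ σ hτ hσ z
    have hq := norm_e_lt_one.2 hτ
    have hr := norm_e_lt_one.2 hσ
    rw [ellGamma_of_pos _ (by simpa using hτ) (by simpa using hσ), ellGamma_of_pos _ hτ hσ,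
      ellGamma_of_pos _ hτ hσ, e_two_mul, e_two_mul, e_two_mul, ← mul_pow, ← div_pow,
      dprod_sq _ hq hr, dprod_sq _ hq hr, e_add, e_half, mul_neg_one, div_neg, div_mul_div_comm]
  · intro τ σ hτ hσ ih z
    rw [mul_neg, ellGamma_neg_left _ _ (by simpa using hτ), ← mul_add, ih, ellGamma_neg_left _ _ hτ,
      ellGamma_neg_left _ _ hτ, mul_inv, add_right_comm]
  · intro τ σ hτ hσ ih z
    rw [mul_neg, ellGamma_neg_right _ _ (by simpa using hσ), ← mul_add, ih,
      ellGamma_neg_right _ _ hσ, ellGamma_neg_right _ _ hσ, mul_inv, add_right_comm]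

/-! ### Doubly periodic functions and the modular transformation of θ₀. -/

theorem im_inv_ne_zero {z : ℂ} (h : z.im ≠ 0) : z⁻¹.im ≠ 0 := by
  have hz : z ≠ 0 := fun h0 => h (by simp [h0])
  rw [Complex.inv_im]
  exact div_ne_zero (neg_ne_zero.2 h) (Complex.normSq_pos.2 hz).ne'

theorem im_div_ne_zero_swap {z w : ℂ} (h : (z / w).im ≠ 0) : (w / z).im ≠ 0 := by
  rw [← inv_div]; exact im_inv_ne_zero h

theorem ne_zero_of_im_div {z w : ℂ} (h : (z / w).im ≠ 0) : z ≠ 0 ∧ w ≠ 0 :=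
  ⟨fun h0 => h (by simp [h0]), fun h0 => h (by simp [h0])⟩

theorem exists_real_coords {w₁ w₂ : ℂ} (h : (w₂ / w₁).im ≠ 0) :
    ∃ s t : ℂ → ℝ, Continuous s ∧ Continuous t ∧ (∀ z, z = s z * w₁ + t z * w₂) ∧
      ∀ (z : ℂ) (a b : ℝ), z = a * w₁ + b * w₂ → s z = a ∧ t z = b := by
  have hw := (ne_zero_of_im_div h).2
  refine ⟨fun z => (z / w₁).re - (z / w₁).im / (w₂ / w₁).im * (w₂ / w₁).re,
    fun z => (z / w₁).im / (w₂ / w₁).im, by fun_prop, by fun_prop, fun z => ?_, ?_⟩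
  · have : z / w₁ = (((z / w₁).re - (z / w₁).im / (w₂ / w₁).im * (w₂ / w₁).re : ℝ) : ℂ) +
        (((z / w₁).im / (w₂ / w₁).im : ℝ) : ℂ) * (w₂ / w₁) := by
      apply Complex.ext
      · simp [-Complex.ofReal_sub, -Complex.ofReal_div, -Complex.ofReal_mul]
      · simp [-Complex.ofReal_sub, -Complex.ofReal_div, -Complex.ofReal_mul]
        field_simp
    calc z = z / w₁ * w₁ := by field_simp
      _ = _ := by
        conv_lhs => rw [this]
        field_simp
  · rintro z a b rfl
    have : (a * w₁ + b * w₂) / w₁ = a + b * (w₂ / w₁) := by field_simp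
    simp only [this]
    have h2 : ((a : ℂ) + b * (w₂ / w₁)).im = b * (w₂ / w₁).im := by simp
    have h3 : ((a : ℂ) + b * (w₂ / w₁)).re = a + b * (w₂ / w₁).re := by simp
    rw [h2, h3]
    constructor <;> field_simp
    ring

/-- A function with two real-independent periods which extends holomorphically over the origin,
and whose only singularities lie in the period lattice, is constant. -/
theorem eq_const_of_doubly_periodic {w₁ w₂ : ℂ} (h : (w₂ / w₁).im ≠ 0) {g k : ℂ → ℂ}
    (hg : ∀ z, (∀ a b : ℤ, z ≠ a * w₁ + b * w₂) → DifferentiableAt ℂ g z)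
    (h₁ : ∀ z, (∀ a b : ℤ, z ≠ a * w₁ + b * w₂) → g (z + w₁) = g z)
    (h₂ : ∀ z, (∀ a b : ℤ, z ≠ a * w₁ + b * w₂) → g (z + w₂) = g z)
    (hk : DifferentiableAt ℂ k 0) (hgk : ∀ᶠ z in 𝓝[≠] 0, g z = k z) :
    ∃ c, ∀ z, (∀ a b : ℤ, z ≠ a * w₁ + b * w₂) → g z = c := by
  classical
  obtain ⟨s, t, hs, ht, hst, huniq⟩ := exists_real_coords h
  set Λ : Set ℂ := {z | ∃ a b : ℤ, z = a * w₁ + b * w₂} with hΛ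
  have hnot : ∀ z, z ∉ Λ ↔ ∀ a b : ℤ, z ≠ a * w₁ + b * w₂ := fun z => by simp [hΛ]
  have hmem : ∀ z, z ∈ Λ ↔ s z ∈ Set.range ((↑) : ℤ → ℝ) ∧ t z ∈ Set.range ((↑) : ℤ → ℝ) := by
    intro z
    constructor
    · rintro ⟨a, b, hab⟩
      have := huniq z a b (by rw [hab]; push_cast; ring)
      exact ⟨⟨a, this.1.symm⟩, ⟨b, this.2.symm⟩⟩
    · rintro ⟨⟨a, ha⟩, ⟨b, hb⟩⟩
      refine ⟨a, b, ?_⟩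
      rw [hst z, ← ha, ← hb]
      push_cast
      ring
  have hclosed : IsClosed Λ := by
    have : Λ = s ⁻¹' Set.range ((↑) : ℤ → ℝ) ∩ t ⁻¹' Set.range ((↑) : ℤ → ℝ) := by
      ext z; exact hmem z
    rw [this]
    exact (Int.isClosedEmbedding_coe_real.isClosed_range.preimage hs).inter
      (Int.isClosedEmbedding_coe_real.isClosed_range.preimage ht)
  have hΛadd : ∀ (z : ℂ) (a b : ℤ), z + (a * w₁ + b * w₂) ∈ Λ ↔ z ∈ Λ := by
    intro z a b
    constructor
    · rintro ⟨c, d, hcd⟩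
      exact ⟨c - a, d - b, by push_cast; linear_combination hcd⟩
    · rintro ⟨c, d, hcd⟩
      exact ⟨c + a, d + b, by push_cast; linear_combination hcd⟩
  have hiso : ∀ᶠ z in 𝓝[≠] (0 : ℂ), z ∉ Λ := by
    have hs0 := (huniq 0 0 0 (by simp))
    have e1 : ∀ᶠ z in 𝓝 (0 : ℂ), s z ∈ Set.Ioo (-1 : ℝ) 1 :=
      hs.continuousAt.eventually_mem (by rw [hs0.1]; exact Ioo_mem_nhds (by norm_num) (by norm_num))
    have e2 : ∀ᶠ z in 𝓝 (0 : ℂ), t z ∈ Set.Ioo (-1 : ℝ) 1 :=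
      ht.continuousAt.eventually_mem (by rw [hs0.2]; exact Ioo_mem_nhds (by norm_num) (by norm_num))
    filter_upwards [nhdsWithin_le_nhds e1, nhdsWithin_le_nhds e2, self_mem_nhdsWithin]
      with z hz1 hz2 hz0 hz
    obtain ⟨⟨a, ha⟩, ⟨b, hb⟩⟩ := (hmem z).1 hz
    rw [← ha] at hz1
    rw [← hb] at hz2
    have ha0 : a = 0 := by
      have h1 : (-1 : ℤ) < a := by exact_mod_cast hz1.1
      have h2 : a < (1 : ℤ) := by exact_mod_cast hz1.2
      omega
    have hb0 : b = 0 := by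
      have h1 : (-1 : ℤ) < b := by exact_mod_cast hz2.1
      have h2 : b < (1 : ℤ) := by exact_mod_cast hz2.2
      omega
    apply hz0
    rw [Set.mem_singleton_iff, hst z, ← ha, ← hb, ha0, hb0]
    simp
  have hgΛ : ∀ (z : ℂ), z ∉ Λ → ∀ a b : ℤ, g (z + (a * w₁ + b * w₂)) = g z := by
    have H1 : ∀ (a : ℤ) (z : ℂ), z ∉ Λ → g (z + a * w₁) = g z := by
      intro a
      induction a with
      | zero => intro z _; simp
      | succ n ih =>
        intro z hz
        have hz' : z + (n : ℤ) * w₁ ∉ Λ := by simpa using (hΛadd z n 0).not.2 hz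
        rw [← ih z hz, ← h₁ _ ((hnot _).1 hz')]
        congr 1; push_cast; ring
      | pred n ih =>
        intro z hz
        have hz' : z + (-(n : ℤ) - 1 : ℤ) * w₁ ∉ Λ := by
          simpa using (hΛadd z (-(n : ℤ) - 1) 0).not.2 hz
        rw [← ih z hz, ← h₁ _ ((hnot _).1 hz')]
        congr 1; push_cast; ring
    have H2 : ∀ (b : ℤ) (z : ℂ), z ∉ Λ → g (z + b * w₂) = g z := by
      intro a
      induction a with
      | zero => intro z _; simp
      | succ n ih =>
        intro z hz
        have hz' : z + (n : ℤ) * w₂ ∉ Λ := by simpa using (hΛadd z 0 n).not.2 hz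
        rw [← ih z hz, ← h₂ _ ((hnot _).1 hz')]
        congr 1; push_cast; ring
      | pred n ih =>
        intro z hz
        have hz' : z + (-(n : ℤ) - 1 : ℤ) * w₂ ∉ Λ := by
          simpa using (hΛadd z 0 (-(n : ℤ) - 1)).not.2 hz
        rw [← ih z hz, ← h₂ _ ((hnot _).1 hz')]
        congr 1; push_cast; ring
    intro z hz a b
    have hz' : z + a * w₁ ∉ Λ := by simpa using (hΛadd z a 0).not.2 hz
    rw [← add_assoc, H2 b _ hz', H1 a z hz]
  -- The value at 0 of the holomorphic extension `k` is put at all lattice points; periodicity then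
  -- carries differentiability at 0 to each of them.
  let f : ℂ → ℂ := fun z => if z ∈ Λ then k 0 else g z
  have hfper : ∀ (z : ℂ) (a b : ℤ), f (z + (a * w₁ + b * w₂)) = f z := by
    intro z a b
    by_cases hz : z ∈ Λ
    · simp only [f, if_pos hz, if_pos ((hΛadd z a b).2 hz)]
    · simp only [f, if_neg hz, if_neg ((hΛadd z a b).not.2 hz), hgΛ z hz]
  have hf0 : DifferentiableAt ℂ f 0 := by
    refine hk.congr_of_eventuallyEq ?_
    have : ∀ᶠ z in 𝓝[≠] (0 : ℂ), f z = k z := by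
      filter_upwards [hiso, hgk] with z hz hz'
      simp only [f, if_neg hz, hz']
    rw [eventually_nhdsWithin_iff] at this
    filter_upwards [this] with z hz
    by_cases h0 : z = 0
    · subst h0
      simp only [f]
      rw [if_pos ⟨0, 0, by simp⟩]
    · exact hz h0
  have hf : Differentiable ℂ f := by
    intro z
    by_cases hz : z ∈ Λ
    · obtain ⟨a, b, hab⟩ := hz
      have h1 : f = fun y => f (y - (a * w₁ + b * w₂)) := by
        funext y
        have := hfper (y - (a * w₁ + b * w₂)) a b
        rw [sub_add_cancel] at this
        exact this
      rw [h1]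
      have h2 : DifferentiableAt ℂ f (z - (a * w₁ + b * w₂)) := by
        rw [hab, sub_self]; exact hf0
      exact h2.comp z (by fun_prop : DifferentiableAt ℂ (fun y => y - (a * w₁ + b * w₂)) z)
    · refine (hg z ((hnot z).1 hz)).congr_of_eventuallyEq ?_
      filter_upwards [hclosed.isOpen_compl.mem_nhds hz] with y hy
      simp only [f, if_neg (show y ∉ Λ from hy)]
  -- All values are taken on the compact fundamental parallelogram, so Liouville's theorem applies.
  have hbdd : Bornology.IsBounded (Set.range f) := by
    have hK : IsCompact ((fun p : ℝ × ℝ => (p.1 : ℂ) * w₁ + p.2 * w₂) ''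
        (Set.Icc 0 1 ×ˢ Set.Icc 0 1)) :=
      (isCompact_Icc.prod isCompact_Icc).image (by fun_prop)
    refine (hK.image hf.continuous).isBounded.subset ?_
    rintro _ ⟨z, rfl⟩
    refine ⟨_, ⟨(Int.fract (s z), Int.fract (t z)), ⟨⟨Int.fract_nonneg _, (Int.fract_lt_one _).le⟩,
      ⟨Int.fract_nonneg _, (Int.fract_lt_one _).le⟩⟩, rfl⟩, ?_⟩
    rw [← hfper _ ⌊s z⌋ ⌊t z⌋]
    congr 1
    conv_rhs => rw [hst z, ← Int.floor_add_fract (s z), ← Int.floor_add_fract (t z)]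
    push_cast
    ring
  refine ⟨f 0, fun z hz => ?_⟩
  rw [← hf.apply_eq_apply_of_bounded hbdd z 0]
  simp only [f, if_neg ((hnot z).2 hz)]

/-- The entire function `(1 - e z) / z`. -/
def oneSubE (z : ℂ) : ℂ := dslope (fun z => 1 - e z) 0 z

theorem mul_oneSubE (z : ℂ) : z * oneSubE z = 1 - e z := by
  have := sub_smul_dslope (fun z => 1 - e z) 0 z
  simpa [oneSubE] using this

theorem differentiableAt_oneSubE : DifferentiableAt ℂ oneSubE 0 := by
  have h : DifferentiableOn ℂ (dslope (fun z => 1 - e z) 0) Set.univ :=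
    (Complex.differentiableOn_dslope univ_mem).2
      ((differentiable_const 1).sub differentiable_e).differentiableOn
  exact h.differentiableAt univ_mem

theorem oneSubE_zero_ne : oneSubE 0 ≠ 0 := by
  have h : HasDerivAt (fun z => 1 - e z) (-(e 0 * (2 * Real.pi * Complex.I))) 0 := by
    have h1 : HasDerivAt (fun z : ℂ => 2 * (Real.pi : ℂ) * Complex.I * z)
        (2 * Real.pi * Complex.I) 0 := by
      simpa using (hasDerivAt_id (0 : ℂ)).const_mul (2 * (Real.pi : ℂ) * Complex.I)
    exact h1.cexp.const_sub 1
  rw [oneSubE, dslope_same, h.deriv]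
  simp [Real.pi_ne_zero]

/-- `θ₀(z, τ) / z` for `Im τ > 0`. -/
def thetaReg (τ z : ℂ) : ℂ := oneSubE z * (sprod (e τ * e z) (e τ) * sprod (e τ / e z) (e τ))

theorem theta₀_eq_mul_thetaReg (z : ℂ) {τ : ℂ} (hτ : 0 < τ.im) :
    theta₀ z τ = z * thetaReg τ z := by
  rw [theta₀_of_pos _ hτ, sprod_eq (e z) (norm_e_lt_one.2 hτ), thetaReg, ← mul_assoc z,
    mul_oneSubE, mul_assoc]

/-- The single product is the double product at r = 0, so its holomorphy is a special case. -/
theorem differentiable_sprod_comp {q : ℂ} (hq : ‖q‖ < 1) {f : ℂ → ℂ} (hf : Differentiable ℂ f) :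
    Differentiable ℂ fun z => sprod (f z) q := by
  have h : ∀ x, sprod x q = dprod x q 0 := fun x => by
    rw [dprod_eq x hq (by simp), zero_mul]
    simp [dprod]
  simp only [h]
  intro z
  have h1 := differentiableAt_dprod (t := (f z, q, 0)) hq (by simp)
  have h2 : DifferentiableAt ℂ (fun z => (f z, q, (0 : ℂ))) z :=
    (hf z).prodMk (differentiableAt_const _)
  exact h1.comp z h2

theorem differentiable_theta₀ {τ : ℂ} (hτ : 0 < τ.im) : Differentiable ℂ fun z => theta₀ z τ := by
  have hq := norm_e_lt_one.2 hτ
  simp only [theta₀_of_pos _ hτ, div_eq_mul_inv, ← e_neg]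
  exact (differentiable_sprod_comp hq differentiable_e).mul (differentiable_sprod_comp hq
    ((differentiable_e.comp differentiable_neg).const_mul _))

theorem differentiableAt_thetaReg {τ : ℂ} (hτ : 0 < τ.im) :
    DifferentiableAt ℂ (thetaReg τ) 0 := by
  have hq := norm_e_lt_one.2 hτ
  have : thetaReg τ = fun z =>
      oneSubE z * (sprod (e τ * e z) (e τ) * sprod (e τ * e (-z)) (e τ)) := by
    funext z; rw [thetaReg, e_neg, div_eq_mul_inv]
  rw [this]
  exact differentiableAt_oneSubE.mul (((differentiable_sprod_comp hq
    (differentiable_e.const_mul _)).mul (differentiable_sprod_comp hq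
    ((differentiable_e.comp differentiable_neg).const_mul _))) 0)

theorem thetaReg_zero_ne {τ : ℂ} (hτ : 0 < τ.im) : thetaReg τ 0 ≠ 0 := by
  have hq := norm_e_lt_one.2 hτ
  have h : ∀ j : ℕ, e τ * e τ ^ j ≠ 1 := fun j h => by
    have h1 : ‖e τ * e τ ^ j‖ < 1 := by
      rw [← pow_succ', norm_pow]; exact pow_lt_one₀ (norm_nonneg _) hq (by simp)
    rw [h] at h1
    simp at h1
  rw [thetaReg, e_zero, mul_one, div_one]
  exact mul_ne_zero oneSubE_zero_ne (mul_ne_zero (sprod_ne_zero hq h) (sprod_ne_zero hq h))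

/-- The exponent in the modular transformation of `θ₀`. -/
def thetaExp (w₁ w₂ z : ℂ) : ℂ := -z ^ 2 / (2 * w₁ * w₂) + z / (2 * w₁) + z / (2 * w₂)

/-- The quadratic `thetaExp` has the increments that cancel the quasi-periodicity factors, so the
quotient is doubly periodic. The constant may stay unknown: the modular relation for Γ uses this
only up to a multiplier. -/
theorem theta₀_modular {w₁ w₂ : ℂ} (h : (w₂ / w₁).im ≠ 0) :
    ∃ c : ℂ, ∀ z, (∀ a b : ℤ, z ≠ a * w₁ + b * w₂) →
      theta₀ (z / w₁) (w₂ / w₁) * theta₀ (z / w₂) (w₁ / w₂) = c * e (thetaExp w₁ w₂ z) := by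
  wlog hpos : 0 < (w₂ / w₁).im generalizing w₁ w₂
  · have h' := im_div_ne_zero_swap h
    have hneg : (w₂ / w₁).im < 0 := lt_of_le_of_ne (not_lt.1 hpos) h
    obtain ⟨c, hc⟩ := this h' (by
      rw [← inv_div, Complex.inv_im]
      exact div_pos (by linarith) (Complex.normSq_pos.2 (fun h0 => h (by simp [h0]))))
    refine ⟨c, fun z hz => ?_⟩
    rw [mul_comm, hc z fun a b hab => hz b a (by rw [hab]; ring), thetaExp, thetaExp]
    congr 2
    ring
  obtain ⟨hw₂, hw₁⟩ := ne_zero_of_im_div h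
  have h' := im_div_ne_zero_swap h
  have hτ' : 0 < (-(w₁ / w₂)).im := by
    rw [← inv_div, Complex.neg_im, Complex.inv_im, neg_div, neg_neg]
    exact div_pos hpos (Complex.normSq_pos.2 (fun h0 => h (by simp [h0])))
  -- One of the two ratios lies in the lower half plane, where θ₀ is the inverse of a theta function
  -- with parameter τ'. Its pole at the origin cancels the zero of the other factor.
  set τ' := -(w₁ / w₂) with hτ'def
  have hB : ∀ z, theta₀ (z / w₂) (w₁ / w₂) = (theta₀ (z / w₂ + τ') τ')⁻¹ := fun z => by
    rw [← theta₀_neg _ hτ'.ne', hτ'def, neg_neg]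
  have hB' : ∀ z, theta₀ (z / w₂ + τ') τ' = -e (-(z / w₂)) * ((z / w₂) * thetaReg τ' (z / w₂)) :=
    fun z => by rw [theta₀_add _ hτ'.ne', theta₀_eq_mul_thetaReg _ hτ']
  have hoff₁ : ∀ z, (∀ a b : ℤ, z ≠ a * w₁ + b * w₂) → ∀ a b : ℤ, z / w₁ ≠ a + b * (w₂ / w₁) :=
    fun z hz a b hab => hz a b (by field_simp at hab; linear_combination hab)
  have hoff₂ : ∀ z, (∀ a b : ℤ, z ≠ a * w₁ + b * w₂) → ∀ a b : ℤ, z / w₂ ≠ a + b * (w₁ / w₂) :=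
    fun z hz a b hab => hz b a (by field_simp at hab; linear_combination hab)
  have hE : ∀ z, e (thetaExp w₁ w₂ z) ≠ 0 := fun z => e_ne_zero _
  suffices hconst : ∃ c, ∀ z, (∀ a b : ℤ, z ≠ a * w₁ + b * w₂) →
      theta₀ (z / w₁) (w₂ / w₁) * theta₀ (z / w₂) (w₁ / w₂) / e (thetaExp w₁ w₂ z) = c by
    obtain ⟨c, hc⟩ := hconst
    exact ⟨c, fun z hz => by rw [← hc z hz, div_mul_cancel₀ _ (hE z)]⟩
  refine eq_const_of_doubly_periodic h
    (g := fun z => theta₀ (z / w₁) (w₂ / w₁) * theta₀ (z / w₂) (w₁ / w₂) / e (thetaExp w₁ w₂ z))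
    (k := fun z => w₂ / w₁ * thetaReg (w₂ / w₁) (z / w₁) /
      (-e (-(z / w₂)) * thetaReg τ' (z / w₂)) / e (thetaExp w₁ w₂ z)) ?_ ?_ ?_ ?_ ?_
  · intro z hz
    have hEd : DifferentiableAt ℂ (fun z => e (thetaExp w₁ w₂ z)) z := by
      unfold thetaExp; exact (differentiable_e.comp (by fun_prop)) z
    refine DifferentiableAt.div (DifferentiableAt.mul ?_ ?_) hEd (hE z)
    · exact ((differentiable_theta₀ hpos).comp (by fun_prop : Differentiable ℂ fun z => z / w₁)) z
    · simp only [hB]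
      refine DifferentiableAt.inv ?_ ?_
      · exact ((differentiable_theta₀ hτ').comp
          (by fun_prop : Differentiable ℂ fun z => z / w₂ + τ')) z
      · have := theta₀_ne_zero h' (hoff₂ z hz)
        rw [hB] at this
        exact fun h0 => this (by rw [h0, inv_zero])
  · intro z hz
    have e1 : theta₀ ((z + w₁) / w₁) (w₂ / w₁) = theta₀ (z / w₁) (w₂ / w₁) := by
      rw [add_div, div_self hw₁, theta₀_add_one]
    have e2 : theta₀ ((z + w₁) / w₂) (w₁ / w₂) = -e (-(z / w₂)) * theta₀ (z / w₂) (w₁ / w₂) := by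
      rw [add_div, theta₀_add _ h']
    have e3 : thetaExp w₁ w₂ (z + w₁) = thetaExp w₁ w₂ z + (-(z / w₂) + 1 / 2) := by
      unfold thetaExp; field_simp; ring
    rw [e1, e2, e3, e_add _ (-(z / w₂) + 1 / 2), e_add, e_half]
    have := e_ne_zero (-(z / w₂))
    have := hE z
    field_simp
  · intro z hz
    have e1 : theta₀ ((z + w₂) / w₂) (w₁ / w₂) = theta₀ (z / w₂) (w₁ / w₂) := by
      rw [add_div, div_self hw₂, theta₀_add_one]
    have e2 : theta₀ ((z + w₂) / w₁) (w₂ / w₁) = -e (-(z / w₁)) * theta₀ (z / w₁) (w₂ / w₁) := by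
      rw [add_div, theta₀_add _ h]
    have e3 : thetaExp w₁ w₂ (z + w₂) = thetaExp w₁ w₂ z + (-(z / w₁) + 1 / 2) := by
      unfold thetaExp; field_simp; ring
    rw [e1, e2, e3, e_add _ (-(z / w₁) + 1 / 2), e_add, e_half]
    have := e_ne_zero (-(z / w₁))
    have := hE z
    field_simp
  · have hEd : DifferentiableAt ℂ (fun z => e (thetaExp w₁ w₂ z)) 0 := by
      unfold thetaExp; exact (differentiable_e.comp (by fun_prop)) 0
    have d1 : DifferentiableAt ℂ (fun z => thetaReg (w₂ / w₁) (z / w₁)) 0 :=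
      DifferentiableAt.comp (g := thetaReg (w₂ / w₁)) (f := fun z => z / w₁) 0
        (by rw [zero_div]; exact differentiableAt_thetaReg hpos) (by fun_prop)
    have d2 : DifferentiableAt ℂ (fun z => thetaReg τ' (z / w₂)) 0 :=
      DifferentiableAt.comp (g := thetaReg τ') (f := fun z => z / w₂) 0
        (by rw [zero_div]; exact differentiableAt_thetaReg hτ') (by fun_prop)
    have d3 : DifferentiableAt ℂ (fun z => -e (-(z / w₂))) 0 :=
      ((differentiable_e.comp (by fun_prop : Differentiable ℂ fun z => -(z / w₂))) 0).neg
    refine ((d1.const_mul _).div (d3.mul d2) ?_).div hEd (hE 0)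
    simp only [Pi.mul_apply, zero_div]
    exact mul_ne_zero (neg_ne_zero.2 (e_ne_zero _)) (thetaReg_zero_ne hτ')
  · filter_upwards [self_mem_nhdsWithin] with z hz
    have hz : z ≠ 0 := hz
    rw [hB, hB', theta₀_eq_mul_thetaReg _ hpos]
    congr 1
    have := e_ne_zero (-(z / w₂))
    by_cases h0 : thetaReg τ' (z / w₂) = 0
    · simp [h0]
    · field_simp

/-! ### The modular relation for three elliptic gamma functions. -/

/-- Multiples of w₃ reduced modulo ℤw₁ + ℤw₂ stay in a compact set. Successive differences along a
convergent subsequence tend to 0, and they are nonzero by independence. -/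
theorem exists_small_combinations {w₁ w₂ w₃ : ℂ} (h : (w₂ / w₁).im ≠ 0)
    (hind : ∀ a b c : ℤ, a * w₁ + b * w₂ + c * w₃ = 0 → a = 0 ∧ b = 0 ∧ c = 0) :
    ∃ p : ℕ → ℂ, Tendsto p atTop (𝓝[≠] 0) ∧
      ∀ n, ∃ a b c : ℤ, p n = a * w₁ + b * w₂ + c * w₃ := by
  obtain ⟨s, t, -, -, hst, -⟩ := exists_real_coords h
  set f : ℕ → ℂ := fun n => n * w₃ - ⌊n * s w₃⌋ * w₁ - ⌊n * t w₃⌋ * w₂ with hf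
  have hfK : ∀ n, f n ∈ Metric.closedBall (0 : ℂ) (‖w₁‖ + ‖w₂‖) := by
    intro n
    have : f n = (Int.fract (n * s w₃) : ℝ) * w₁ + (Int.fract (n * t w₃) : ℝ) * w₂ := by
      rw [hf]
      simp only [Int.fract]
      push_cast
      linear_combination (n : ℂ) * hst w₃
    rw [this, mem_closedBall_zero_iff]
    refine (norm_add_le _ _).trans ?_
    rw [norm_mul, norm_mul, Complex.norm_real, Complex.norm_real, Real.norm_eq_abs, Int.abs_fract,
      Real.norm_eq_abs, Int.abs_fract]
    exact add_le_add (mul_le_of_le_one_left (norm_nonneg _) (Int.fract_lt_one _).le)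
      (mul_le_of_le_one_left (norm_nonneg _) (Int.fract_lt_one _).le)
  obtain ⟨l, -, φ, hφ, hl⟩ := (isCompact_closedBall (0 : ℂ) (‖w₁‖ + ‖w₂‖)).tendsto_subseq hfK
  have hcomb : ∀ n, ∃ a b : ℤ, f (φ (n + 1)) - f (φ n) =
      a * w₁ + b * w₂ + ((φ (n + 1) - φ n : ℤ) : ℂ) * w₃ := fun n =>
    ⟨⌊φ n * s w₃⌋ - ⌊φ (n + 1) * s w₃⌋, ⌊φ n * t w₃⌋ - ⌊φ (n + 1) * t w₃⌋, by
      rw [hf]; push_cast; ring⟩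
  refine ⟨fun n => f (φ (n + 1)) - f (φ n), tendsto_nhdsWithin_iff.2 ⟨?_, .of_forall fun n h0 => ?_⟩,
    fun n => ?_⟩
  · simpa using (hl.comp (tendsto_add_atTop_nat 1)).sub hl
  · obtain ⟨a, b, hab⟩ := hcomb n
    rw [Set.mem_singleton_iff.1 h0] at hab
    have h3 := (hind a b _ hab.symm).2.2
    have h4 : φ n < φ (n + 1) := hφ (Nat.lt_succ_self n)
    omega
  · obtain ⟨a, b, hab⟩ := hcomb n
    exact ⟨a, b, _, hab⟩

theorem countable_combinations (w₁ w₂ w₃ : ℂ) :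
    {z : ℂ | ∃ a b c : ℤ, z = a * w₁ + b * w₂ + c * w₃}.Countable := by
  refine (Set.countable_range fun p : ℤ × ℤ × ℤ => (p.1 * w₁ + p.2.1 * w₂ + p.2.2 * w₃ : ℂ)).mono ?_
  rintro z ⟨a, b, c, rfl⟩
  exact ⟨(a, b, c), rfl⟩

/-- If the quotient of two entire functions has multiplicative quasi-periods accumulating at
zero, then it is an exponential. -/
theorem eq_exp_mul_of_small_multipliers {U V : ℂ → ℂ} (hU : Differentiable ℂ U)
    (hV : Differentiable ℂ V) {z₀ : ℂ} (hU₀ : U z₀ ≠ 0) (hV₀ : V z₀ ≠ 0) {p : ℕ → ℂ}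
    (hp : Tendsto p atTop (𝓝[≠] 0))
    (hper : ∀ n, ∃ μ : ℂ, ∀ z, U (z + p n) * V z = μ * (U z * V (z + p n))) :
    ∃ c l : ℂ, ∀ z, U z = c * Complex.exp (l * z) * V z := by
  have hU' : Differentiable ℂ (deriv U) := hU.deriv
  have hV' : Differentiable ℂ (deriv V) := hV.deriv
  set l : ℂ := (deriv U z₀ * V z₀ - U z₀ * deriv V z₀) / (U z₀ * V z₀) with hl
  have hl' : deriv U z₀ * V z₀ - U z₀ * deriv V z₀ = l * (U z₀ * V z₀) := by
    rw [hl]; field_simp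
  -- The identity says that U/V has constant logarithmic derivative l. A constant multiplier forces
  -- the same logarithmic derivative at z₀ + p n as at z₀; these points accumulate at z₀, so the
  -- identity theorem applies.
  have hwr : ∀ z, deriv U z * V z - U z * deriv V z = l * (U z * V z) := by
    have h1 : Tendsto (fun n => z₀ + p n) atTop (𝓝[≠] z₀) := by
      refine tendsto_nhdsWithin_iff.2 ⟨?_, ?_⟩
      · simpa using (tendsto_nhdsWithin_iff.1 hp).1.const_add z₀
      · filter_upwards [(tendsto_nhdsWithin_iff.1 hp).2] with n hn h
        exact hn (by simpa using h)
    have h2 : ∀ᶠ z in 𝓝[≠] z₀, U z ≠ 0 ∧ V z ≠ 0 := nhdsWithin_le_nhds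
      ((hU.continuous.continuousAt.eventually_ne hU₀).and
        (hV.continuous.continuousAt.eventually_ne hV₀))
    have h3 : ∀ᶠ n in atTop, deriv U (z₀ + p n) * V (z₀ + p n) - U (z₀ + p n) * deriv V (z₀ + p n) =
        l * (U (z₀ + p n) * V (z₀ + p n)) := by
      filter_upwards [h1.eventually h2] with n hn
      obtain ⟨μ, hμ⟩ := hper n
      have hs : ∀ f : ℂ → ℂ, Differentiable ℂ f →
          HasDerivAt (fun z => f (z + p n)) (deriv f (z₀ + p n)) z₀ := fun f hf =>
        (hf (z₀ + p n)).hasDerivAt.comp_add_const z₀ (p n)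
      have d1 := (hs U hU).mul (hV z₀).hasDerivAt
      have d2 := (((hU z₀).hasDerivAt).mul (hs V hV)).const_mul μ
      have d3 := d1.unique (d2.congr_of_eventuallyEq (Eventually.of_forall hμ))
      have e0 := hμ z₀
      set A := U (z₀ + p n)
      set B := V (z₀ + p n)
      have hμ0 : μ = A * V z₀ / (U z₀ * B) := by
        rw [e0]; field_simp [hn.2]
      rw [hμ0] at d3
      have hA : A ≠ 0 := hn.1
      have hB : B ≠ 0 := hn.2
      field_simp at d3
      have : U z₀ * V z₀ ≠ 0 := mul_ne_zero hU₀ hV₀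
      apply mul_left_cancel₀ this
      linear_combination d3 + A * B * hl'
    have h4 : ∃ᶠ y in 𝓝[≠] z₀, deriv U y * V y - U y * deriv V y = l * (U y * V y) :=
      h1.frequently (p := fun y => deriv U y * V y - U y * deriv V y = l * (U y * V y))
        h3.frequently
    have han : ∀ f : ℂ → ℂ, Differentiable ℂ f → AnalyticOnNhd ℂ f Set.univ := fun f hf =>
      hf.differentiableOn.analyticOnNhd isOpen_univ
    intro z
    exact (han _ ((hU'.mul hV).sub (hU.mul hV'))).eqOn_of_preconnected_of_frequently_eq
      (han _ ((hU.mul hV).const_mul l)) isPreconnected_univ (Set.mem_univ z₀) h4 (Set.mem_univ z)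
  obtain ⟨R, hR, hball⟩ := Metric.eventually_nhds_iff_ball.1
    (hV.continuous.continuousAt.eventually_ne hV₀)
  -- By `hwr` the derivative of Q vanishes near z₀.
  set Q : ℂ → ℂ := fun z => U z * Complex.exp (-(l * z)) / V z with hQ
  have hexp : ∀ z, HasDerivAt (fun z => Complex.exp (-(l * z))) (Complex.exp (-(l * z)) * -l) z :=
    fun z => by
      have : HasDerivAt (fun z => -(l * z)) (-l) z := by
        simpa using ((hasDerivAt_id z).const_mul l).fun_neg
      exact this.cexp
  have hQd : ∀ z ∈ Metric.ball z₀ R, HasDerivAt Q 0 z := fun z hz => by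
    have := (((hU z).hasDerivAt.mul (hexp z)).div (hV z).hasDerivAt (hball z hz))
    refine this.congr_deriv ?_
    rw [div_eq_zero_iff]
    left
    simp only [Pi.mul_apply]
    linear_combination Complex.exp (-(l * z)) * hwr z
  have hconst : ∀ z ∈ Metric.ball z₀ R, Q z = Q z₀ := fun z hz =>
    (convex_ball z₀ R).is_const_of_fderivWithin_eq_zero (𝕜 := ℂ)
      (fun y hy => (hQd y hy).differentiableAt.differentiableWithinAt)
      (fun y hy => by
        rw [fderivWithin_of_isOpen Metric.isOpen_ball hy]
        ext
        simp [(hQd y hy).deriv]) hz (Metric.mem_ball_self hR)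
  refine ⟨Q z₀, l, fun z => ?_⟩
  have han : ∀ f : ℂ → ℂ, Differentiable ℂ f → AnalyticOnNhd ℂ f Set.univ := fun f hf =>
    hf.differentiableOn.analyticOnNhd isOpen_univ
  refine (han _ hU).eqOn_of_preconnected_of_eventuallyEq (z₀ := z₀)
    (han (fun z => Q z₀ * Complex.exp (l * z) * V z) (by fun_prop)) isPreconnected_univ
    (Set.mem_univ z₀) ?_ (Set.mem_univ z)
  filter_upwards [Metric.ball_mem_nhds z₀ hR] with y hy
  rw [← hconst y hy, hQ]
  have hv := hball y hy
  simp only [Complex.exp_neg]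
  have := Complex.exp_ne_zero (l * y)
  field_simp

/-- The conditions on three periods under which the modular relation holds. -/
structure Generic (w₁ w₂ w₃ : ℂ) : Prop where
  im₂₁ : (w₂ / w₁).im ≠ 0
  im₃₁ : (w₃ / w₁).im ≠ 0
  im₃₂ : (w₃ / w₂).im ≠ 0
  indep : ∀ a b c : ℤ, a * w₁ + b * w₂ + c * w₃ = 0 → a = 0 ∧ b = 0 ∧ c = 0

namespace Generic

variable {w₁ w₂ w₃ : ℂ}

theorem rotate (h : Generic w₁ w₂ w₃) : Generic w₂ w₃ w₁ where
  im₂₁ := h.im₃₂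
  im₃₁ := im_div_ne_zero_swap h.im₂₁
  im₃₂ := im_div_ne_zero_swap h.im₃₁
  indep a b c habc := by
    have := h.indep c a b (by linear_combination habc)
    tauto

theorem ne_zero (h : Generic w₁ w₂ w₃) : w₁ ≠ 0 ∧ w₂ ≠ 0 ∧ w₃ ≠ 0 :=
  ⟨(ne_zero_of_im_div h.im₂₁).2, (ne_zero_of_im_div h.im₂₁).1, (ne_zero_of_im_div h.im₃₁).1⟩

end Generic

/-- The product of the three elliptic gamma functions in the modular relation. -/
def tripleGamma (w₁ w₂ w₃ z : ℂ) : ℂ :=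
  ellGamma (z / w₁) (w₂ / w₁) (w₃ / w₁) * ellGamma (z / w₂) (w₃ / w₂) (w₁ / w₂) *
    ellGamma (z / w₃) (w₁ / w₃) (w₂ / w₃)

/-- The cubic polynomial in the modular relation. -/
def cubicExp (w₁ w₂ w₃ z : ℂ) : ℂ :=
  -((z - (w₁ + w₂ + w₃) / 2) ^ 3 -
    (w₁ ^ 2 + w₂ ^ 2 + w₃ ^ 2) / 4 * (z - (w₁ + w₂ + w₃) / 2)) / (6 * (w₁ * w₂ * w₃))

theorem tripleGamma_rotate (w₁ w₂ w₃ z : ℂ) : tripleGamma w₂ w₃ w₁ z = tripleGamma w₁ w₂ w₃ z := by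
  unfold tripleGamma; ring

theorem cubicExp_rotate (w₁ w₂ w₃ z : ℂ) : cubicExp w₂ w₃ w₁ z = cubicExp w₁ w₂ w₃ z := by
  unfold cubicExp; congr 1 <;> ring

theorem OffLattice.of_div {w₁ w₂ w₃ z : ℂ} (h0 : w₁ ≠ 0)
    (hz : ∀ a b c : ℤ, z ≠ a * w₁ + b * w₂ + c * w₃) :
    OffLattice (z / w₁) (w₂ / w₁) (w₃ / w₁) := fun a b c habc => hz a b c (by
  field_simp at habc
  linear_combination habc)

section triple

variable {w₁ w₂ w₃ : ℂ} (h : Generic w₁ w₂ w₃)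
include h

theorem Generic.off {z : ℂ} (hz : ∀ a b c : ℤ, z ≠ a * w₁ + b * w₂ + c * w₃) :
    OffLattice (z / w₁) (w₂ / w₁) (w₃ / w₁) ∧ OffLattice (z / w₂) (w₃ / w₂) (w₁ / w₂) ∧
      OffLattice (z / w₃) (w₁ / w₃) (w₂ / w₃) :=
  ⟨.of_div h.ne_zero.1 hz,
   .of_div h.ne_zero.2.1 fun a b c habc => hz c a b (by rw [habc]; ring),
   .of_div h.ne_zero.2.2 fun a b c habc => hz b c a (by rw [habc]; ring)⟩

theorem tripleGamma_ne_zero {z : ℂ} (hz : ∀ a b c : ℤ, z ≠ a * w₁ + b * w₂ + c * w₃) :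
    tripleGamma w₁ w₂ w₃ z ≠ 0 := by
  obtain ⟨o1, o2, o3⟩ := h.off hz
  exact mul_ne_zero (mul_ne_zero (ellGamma_ne_zero h.im₂₁ h.im₃₁ o1)
    (ellGamma_ne_zero h.im₃₂ (im_div_ne_zero_swap h.im₂₁) o2))
    (ellGamma_ne_zero (im_div_ne_zero_swap h.im₃₁) (im_div_ne_zero_swap h.im₃₂) o3)

/-- The factor with denominator w₁ is 1-periodic in z/w₁. The two others produce theta functions
whose product is given by `theta₀_modular`, and the increment of the cubic is the corresponding
quadratic up to a constant. -/
theorem tripleGamma_add_aux : ∃ μ : ℂ, ∀ z, (∀ a b c : ℤ, z ≠ a * w₁ + b * w₂ + c * w₃) →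
    tripleGamma w₁ w₂ w₃ (z + w₁) / e (cubicExp w₁ w₂ w₃ (z + w₁)) =
      μ * (tripleGamma w₁ w₂ w₃ z / e (cubicExp w₁ w₂ w₃ z)) := by
  obtain ⟨c, hc⟩ := theta₀_modular h.im₃₂
  obtain ⟨h1, h2, h3⟩ := h.ne_zero
  have i12 := im_div_ne_zero_swap h.im₂₁
  have i13 := im_div_ne_zero_swap h.im₃₁
  have i23 := im_div_ne_zero_swap h.im₃₂
  refine ⟨c * e (cubicExp w₁ w₂ w₃ 0 - cubicExp w₁ w₂ w₃ w₁), fun z hz => ?_⟩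
  obtain ⟨o1, o2, o3⟩ := h.off hz
  have hexp : cubicExp w₁ w₂ w₃ (z + w₁) = cubicExp w₁ w₂ w₃ z + thetaExp w₂ w₃ z -
      (cubicExp w₁ w₂ w₃ 0 - cubicExp w₁ w₂ w₃ w₁) := by
    unfold cubicExp thetaExp
    field_simp
    ring
  have ht := hc z fun a b hab => hz 0 a b (by rw [hab]; simp)
  rw [hexp, e_sub, e_add, tripleGamma, tripleGamma, add_div, add_div, add_div, div_self h1,
    ellGamma_add_one, ellGamma_add_right h.im₃₂ i12 o2, ellGamma_add_left i13 i23 o3]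
  have n1 := e_ne_zero (cubicExp w₁ w₂ w₃ z)
  have n2 := e_ne_zero (thetaExp w₂ w₃ z)
  have n3 := e_ne_zero (cubicExp w₁ w₂ w₃ 0 - cubicExp w₁ w₂ w₃ w₁)
  field_simp
  linear_combination ellGamma (z / w₁) (w₂ / w₁) (w₃ / w₁) *
    ellGamma (z / w₂) (w₃ / w₂) (w₁ / w₂) * ellGamma (z / w₃) (w₁ / w₃) (w₂ / w₃) * ht

theorem tripleGamma_add_combination (a b c : ℤ) :
    ∃ μ : ℂ, ∀ z, (∀ a b c : ℤ, z ≠ a * w₁ + b * w₂ + c * w₃) →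
      tripleGamma w₁ w₂ w₃ (z + (a * w₁ + b * w₂ + c * w₃)) /
          e (cubicExp w₁ w₂ w₃ (z + (a * w₁ + b * w₂ + c * w₃))) =
        μ * (tripleGamma w₁ w₂ w₃ z / e (cubicExp w₁ w₂ w₃ z)) := by
  set Off : ℂ → Prop := fun z => ∀ a b c : ℤ, z ≠ a * w₁ + b * w₂ + c * w₃ with hOff
  set T : ℂ → ℂ := fun z => tripleGamma w₁ w₂ w₃ z / e (cubicExp w₁ w₂ w₃ z) with hT
  have hT0 : ∀ z, Off z → T z ≠ 0 := fun z hz => div_ne_zero (tripleGamma_ne_zero h hz) (e_ne_zero _)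
  have hOffadd : ∀ z (a b c : ℤ), Off z → Off (z + (a * w₁ + b * w₂ + c * w₃)) :=
    fun z a b c hz a' b' c' h' => hz (a' - a) (b' - b) (c' - c) (by
      push_cast; linear_combination h')
  -- The periods with a constant multiplier form a group. Stability of `Off` under subtraction is
  -- included so that the inverse multiplier can be read off at z - p.
  let S : AddSubgroup ℂ :=
    { carrier := {p | (∀ z, Off z → Off (z + p)) ∧ (∀ z, Off z → Off (z - p)) ∧
        ∃ μ : ℂ, ∀ z, Off z → T (z + p) = μ * T z}
      zero_mem' := ⟨by simp, by simp, 1, by simp⟩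
      add_mem' := by
        rintro p q ⟨hp, hp', μ, hμ⟩ ⟨hq, hq', ν, hν⟩
        refine ⟨fun z hz => ?_, fun z hz => ?_, ν * μ, fun z hz => ?_⟩
        · rw [← add_assoc]; exact hq _ (hp _ hz)
        · rw [← sub_sub]; exact hq' _ (hp' _ hz)
        · rw [← add_assoc, hν _ (hp _ hz), hμ _ hz, mul_assoc]
      neg_mem' := by
        rintro p ⟨hp, hp', μ, hμ⟩
        refine ⟨by simpa [← sub_eq_add_neg] using hp', by simpa using hp, μ⁻¹, fun z hz => ?_⟩
        have h1 := hμ (z - p) (hp' z hz)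
        rw [sub_add_cancel] at h1
        have h2 : μ ≠ 0 := fun h0 => hT0 z hz (by rw [h1, h0, zero_mul])
        rw [h1, inv_mul_cancel_left₀ h2, sub_eq_add_neg] }
  have hmem : ∀ p, (∃ a b c : ℤ, p = a * w₁ + b * w₂ + c * w₃) →
      (∃ μ : ℂ, ∀ z, Off z → T (z + p) = μ * T z) → p ∈ S := by
    rintro p ⟨a, b, c, habc⟩ hp
    refine ⟨fun z hz => by rw [habc]; exact hOffadd _ _ _ _ hz, fun z hz => ?_, hp⟩
    have := hOffadd z (-a) (-b) (-c) hz
    rw [habc]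
    convert this using 1
    push_cast
    ring
  have m1 : w₁ ∈ S := hmem _ ⟨1, 0, 0, by simp⟩ (tripleGamma_add_aux h)
  have m2 : w₂ ∈ S := hmem _ ⟨0, 1, 0, by simp⟩ (by
    obtain ⟨μ, hμ⟩ := tripleGamma_add_aux h.rotate
    refine ⟨μ, fun z hz => ?_⟩
    have := hμ z fun a b c habc => hz c a b (by rw [habc]; ring)
    simpa only [tripleGamma_rotate, cubicExp_rotate] using this)
  have m3 : w₃ ∈ S := hmem _ ⟨0, 0, 1, by simp⟩ (by
    obtain ⟨μ, hμ⟩ := tripleGamma_add_aux h.rotate.rotate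
    refine ⟨μ, fun z hz => ?_⟩
    have := hμ z fun a b c habc => hz b c a (by rw [habc]; ring)
    simpa only [tripleGamma_rotate, cubicExp_rotate] using this)
  have := S.add_mem (S.add_mem (S.zsmul_mem m1 a) (S.zsmul_mem m2 b)) (S.zsmul_mem m3 c)
  simp only [zsmul_eq_mul] at this
  exact this.2.2

/-- In each factor, `ellGamma_distrib` with n = 2 supplies the half-shifts by the two other periods
and `ellGamma_two_mul` the half-shift by its own. The formula serves to determine an unknown factor
c exp(l z). -/
theorem tripleGamma_two_mul (z : ℂ) : tripleGamma w₁ w₂ w₃ (2 * z) =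
    ∏ i ∈ Finset.range 2, ∏ j ∈ Finset.range 2, ∏ k ∈ Finset.range 2,
      tripleGamma w₁ w₂ w₃ (z + (i * w₁ + j * w₂ + k * w₃) / 2) := by
  obtain ⟨h1, h2, h3⟩ := h.ne_zero
  have key : ∀ {v₁ v₂ v₃ : ℂ}, Generic v₁ v₂ v₃ → ellGamma (2 * z / v₁) (v₂ / v₁) (v₃ / v₁) =
      ∏ j ∈ Finset.range 2, ∏ k ∈ Finset.range 2, ∏ i ∈ Finset.range 2,
        ellGamma ((z + (i * v₁ + j * v₂ + k * v₃) / 2) / v₁) (v₂ / v₁) (v₃ / v₁) := by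
    intro v₁ v₂ v₃ hv
    have hv1 := hv.ne_zero.1
    rw [ellGamma_distrib hv.im₂₁ hv.im₃₁ (n := 2) (by norm_num)]
    refine Finset.prod_congr rfl fun j _ => Finset.prod_congr rfl fun k _ => ?_
    push_cast
    rw [show 2 * z / v₁ + j * (v₂ / v₁) + k * (v₃ / v₁) =
      2 * ((z + (j * v₂ + k * v₃) / 2) / v₁) by field_simp; ring, ellGamma_two_mul hv.im₂₁ hv.im₃₁]
    rw [Finset.prod_range_succ, Finset.prod_range_one]
    congr 2
    · push_cast; ring
    · push_cast; field_simp; ring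
  have k1 := key h
  have k2 := key h.rotate
  have k3 := key h.rotate.rotate
  simp only [show ∀ i j k : ℕ, (i * w₂ + j * w₃ + k * w₁ : ℂ) = k * w₁ + i * w₂ + j * w₃ from
    fun i j k => by ring] at k2
  simp only [show ∀ i j k : ℕ, (i * w₃ + j * w₁ + k * w₂ : ℂ) = j * w₁ + k * w₂ + i * w₃ from
    fun i j k => by ring] at k3
  rw [tripleGamma, k1, k2, k3]
  simp only [Finset.prod_range_succ, Finset.prod_range_zero, one_mul, tripleGamma]
  ring

/-- The modular relation of Felder and Varchenko for the elliptic gamma function. -/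
theorem tripleGamma_eq {z : ℂ} (hz : ∀ a b c : ℤ, z ≠ a * w₁ + b * w₂ + c * w₃) :
    tripleGamma w₁ w₂ w₃ z = e (cubicExp w₁ w₂ w₃ z) := by
  obtain ⟨h1, h2, h3⟩ := h.ne_zero
  have i12 := im_div_ne_zero_swap h.im₂₁
  have i13 := im_div_ne_zero_swap h.im₃₁
  have i23 := im_div_ne_zero_swap h.im₃₂
  obtain ⟨U₁, V₁, hU₁, hV₁, e₁, o₁⟩ := exists_entire_ratio h.im₂₁ h.im₃₁
  obtain ⟨U₂, V₂, hU₂, hV₂, e₂, o₂⟩ := exists_entire_ratio h.im₃₂ i12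
  obtain ⟨U₃, V₃, hU₃, hV₃, e₃, o₃⟩ := exists_entire_ratio i13 i23
  set Off : ℂ → Prop := fun z => ∀ a b c : ℤ, z ≠ a * w₁ + b * w₂ + c * w₃ with hOff
  set U : ℂ → ℂ := fun z => U₁ (z / w₁) * U₂ (z / w₂) * U₃ (z / w₃) with hU
  set V : ℂ → ℂ := fun z => V₁ (z / w₁) * V₂ (z / w₂) * V₃ (z / w₃) *
    e (cubicExp w₁ w₂ w₃ z) with hV
  have hUd : Differentiable ℂ U := by fun_prop
  have hed := differentiable_e
  have hVd : Differentiable ℂ V := by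
    have : Differentiable ℂ fun z => e (cubicExp w₁ w₂ w₃ z) := by
      unfold cubicExp; exact differentiable_e.comp (by fun_prop)
    fun_prop
  have hT : ∀ z, tripleGamma w₁ w₂ w₃ z / e (cubicExp w₁ w₂ w₃ z) = U z / V z := fun z => by
    rw [tripleGamma, e₁, e₂, e₃, div_mul_div_comm, div_mul_div_comm, div_div]
  have hU0 : ∀ z, Off z → U z ≠ 0 := fun z hz =>
    mul_ne_zero (mul_ne_zero (o₁ _ (h.off hz).1).1 (o₂ _ (h.off hz).2.1).1) (o₃ _ (h.off hz).2.2).1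
  have hV0 : ∀ z, Off z → V z ≠ 0 := fun z hz =>
    mul_ne_zero (mul_ne_zero (mul_ne_zero (o₁ _ (h.off hz).1).2 (o₂ _ (h.off hz).2.1).2)
      (o₃ _ (h.off hz).2.2).2) (e_ne_zero _)
  have hcount := countable_combinations w₁ w₂ w₃
  have hOffadd : ∀ z (a b c : ℤ), Off z → Off (z + (a * w₁ + b * w₂ + c * w₃)) :=
    fun z a b c hz a' b' c' h' => hz (a' - a) (b' - b) (c' - c) (by
      push_cast; linear_combination h')
  have hdense : Dense {z | Off z} := by
    have := hcount.dense_compl ℝ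
    refine this.mono ?_
    intro z hz a b c habc
    exact hz ⟨a, b, c, habc⟩
  obtain ⟨z₀, hz₀⟩ := hdense.nonempty
  obtain ⟨p, hp, hpc⟩ := exists_small_combinations h.im₂₁ h.indep
  obtain ⟨c, l, hcl⟩ := eq_exp_mul_of_small_multipliers hUd hVd (hU0 z₀ hz₀) (hV0 z₀ hz₀) hp
    (fun n => by
      obtain ⟨a, b, c, habc⟩ := hpc n
      obtain ⟨μ, hμ⟩ := tripleGamma_add_combination h a b c
      refine ⟨μ, fun z => ?_⟩
      have : (fun z => U (z + p n) * V z) = fun z => μ * (U z * V (z + p n)) := by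
        refine Continuous.ext_on hdense ?_ ?_ fun z hz => ?_
        · have := hUd.continuous
          have := hVd.continuous
          fun_prop
        · have := hUd.continuous
          have := hVd.continuous
          fun_prop
        · have e1 := hμ z hz
          rw [hT, hT, ← habc] at e1
          have e2 := hV0 _ hz
          have e3 := hV0 _ (hOffadd z a b c hz)
          rw [← habc] at e3
          field_simp at e1
          linear_combination e1
      exact congrFun this z)
  have hform : ∀ z, Off z → tripleGamma w₁ w₂ w₃ z / e (cubicExp w₁ w₂ w₃ z) =
      c * Complex.exp (l * z) := fun z hz => by
    rw [hT, hcl, mul_div_cancel_right₀ _ (hV0 z hz)]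
  -- The cubic satisfies the additive form of the same duplication formula, so the remaining factor
  -- c exp(l z) must satisfy the multiplicative one.
  have hcub : ∀ z, cubicExp w₁ w₂ w₃ (2 * z) =
      ∑ i ∈ Finset.range 2, ∑ j ∈ Finset.range 2, ∑ k ∈ Finset.range 2,
      cubicExp w₁ w₂ w₃ (z + (i * w₁ + j * w₂ + k * w₃) / 2) := fun z => by
    simp only [Finset.sum_range_succ, Finset.sum_range_zero, cubicExp, Nat.cast_zero, Nat.cast_one]
    field_simp
    ring
  have hdist : ∀ z, Off (2 * z) → c * Complex.exp (l * (2 * z)) =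
      ∏ i ∈ Finset.range 2, ∏ j ∈ Finset.range 2, ∏ k ∈ Finset.range 2,
        (c * Complex.exp (l * (z + (i * w₁ + j * w₂ + k * w₃) / 2))) := fun z hz => by
    have hz' : ∀ i j k : ℕ, Off (z + (i * w₁ + j * w₂ + k * w₃) / 2) := fun i j k a b c habc =>
      hz (2 * a - i) (2 * b - j) (2 * c - k) (by push_cast; linear_combination 2 * habc)
    simp only [← hform _ hz, ← hform _ (hz' _ _ _)]
    rw [tripleGamma_two_mul h, hcub]
    simp only [Finset.prod_range_succ, Finset.prod_range_zero, Finset.sum_range_succ,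
      Finset.sum_range_zero, zero_add, one_mul, e_add, div_mul_div_comm]
  have hdense2 : Dense {z | Off (2 * z)} := by
    have hc2 : {z : ℂ | ∃ a b c : ℤ, 2 * z = a * w₁ + b * w₂ + c * w₃}.Countable :=
      hcount.preimage (mul_right_injective₀ (two_ne_zero (α := ℂ)))
    refine (hc2.dense_compl ℝ).mono ?_
    intro z hz a b c habc
    exact hz ⟨a, b, c, habc⟩
  have hdist' : (fun z => c * Complex.exp (l * (2 * z))) = fun z =>
      ∏ i ∈ Finset.range 2, ∏ j ∈ Finset.range 2, ∏ k ∈ Finset.range 2,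
        (c * Complex.exp (l * (z + (i * w₁ + j * w₂ + k * w₃) / 2))) :=
    Continuous.ext_on hdense2 (by fun_prop) (by fun_prop) hdist
  have hexp : ∀ z, Complex.exp (l * (2 * z)) * c = c ^ 8 * Complex.exp (l * (8 * z)) *
      Complex.exp (l * (2 * (w₁ + w₂ + w₃))) := fun z => by
    have := congrFun hdist' z
    simp only [Finset.prod_range_succ, Finset.prod_range_zero, one_mul] at this
    rw [mul_comm, this, mul_assoc (c ^ 8), ← Complex.exp_add]
    have hx : ∀ x y : ℂ, c * Complex.exp x * (c * Complex.exp y) = c ^ 2 * Complex.exp (x + y) :=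
      fun x y => by rw [Complex.exp_add]; ring
    have hx2 : ∀ x y : ℂ, c ^ 2 * Complex.exp x * (c ^ 2 * Complex.exp y) =
      c ^ 4 * Complex.exp (x + y) := fun x y => by rw [Complex.exp_add]; ring
    have hx4 : ∀ x y : ℂ, c ^ 4 * Complex.exp x * (c ^ 4 * Complex.exp y) =
      c ^ 8 * Complex.exp (x + y) := fun x y => by rw [Complex.exp_add]; ring
    rw [hx, hx, hx2, hx, hx, hx2, hx4]
    congr 2
    push_cast
    ring
  have hc0 : c ≠ 0 := fun h0 => by
    have := hcl z₀
    rw [h0, zero_mul, zero_mul] at this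
    exact hU0 z₀ hz₀ this
  -- The two sides of `hexp` grow like exp(2 l z) and exp(8 l z). Comparing z = 0 with z = 1/(6 l)
  -- would give exp 1 = 1.
  have hl : l = 0 := by
    by_contra hl
    have e1 := hexp 0
    have e2 := hexp (1 / (6 * l))
    rw [show l * (2 * (1 / (6 * l))) = 1 / 3 by field_simp; norm_num,
      show l * (8 * (1 / (6 * l))) = 1 + 1 / 3 by field_simp; norm_num] at e2
    simp only [mul_zero, Complex.exp_zero, one_mul, mul_one] at e1
    rw [Complex.exp_add] at e2
    have n3 : Complex.exp 1 = 1 := by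
      refine mul_left_cancel₀ (mul_ne_zero (Complex.exp_ne_zero (1 / 3)) hc0) ?_
      linear_combination Complex.exp (1 / 3) * Complex.exp 1 * e1 - e2
    rw [Complex.exp_eq_one_iff] at n3
    obtain ⟨n, hn⟩ := n3
    have := congrArg Complex.re hn
    simp at this
  -- At half the sum of the periods all three gamma factors are 1 and the cubic, odd about this
  -- point, vanishes. The point avoids the lattice because 1 - 2a is never 0.
  have hκ : Off ((w₁ + w₂ + w₃) / 2) := fun a b c habc => by
    have := (h.indep (1 - 2 * a) (1 - 2 * b) (1 - 2 * c)
      (by push_cast; linear_combination 2 * habc)).1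
    omega
  have hone : tripleGamma w₁ w₂ w₃ ((w₁ + w₂ + w₃) / 2) = 1 := by
    obtain ⟨k1, k2, k3⟩ := h.off hκ
    rw [tripleGamma, ellGamma_eq_one h.im₂₁ h.im₃₁ k1, ellGamma_eq_one h.im₃₂ i12 k2,
      ellGamma_eq_one i13 i23 k3]
    · ring
    all_goals
      rw [← e_two_mul, ← e_add, e_eq_e_iff]
      refine ⟨1, ?_⟩
      field_simp
      push_cast
      ring
  have hc1 : c = 1 := by
    have e1 := hform _ hκ
    rw [hone, hl, zero_mul, Complex.exp_zero, mul_one] at e1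
    rw [← e1, cubicExp, sub_self]
    simp
  have := hform z hz
  rw [hl, hc1, zero_mul, Complex.exp_zero, mul_one, div_eq_one_iff_eq (e_ne_zero _)] at this
  exact this

end triple

/-! ### Invertible analytic functions and their representatives. -/

namespace InvAn

theorem IsRep.mul {F H : InvAn} {f h : X → ℂ} (hF : F.IsRep f) (hH : H.IsRep h) :
    (F * H).IsRep fun p => f p * h p := by
  obtain ⟨a, rfl, ha⟩ := hF
  obtain ⟨b, rfl, hb⟩ := hH
  exact ⟨a.mul b, rfl, fun p hp => congrArg₂ (· * ·) (ha p hp.1) (hb p hp.2)⟩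

theorem IsRep.inv {F : InvAn} {f : X → ℂ} (hF : F.IsRep f) : F⁻¹.IsRep fun p => (f p)⁻¹ := by
  obtain ⟨a, rfl, ha⟩ := hF
  exact ⟨a.inv, rfl, fun p hp => congrArg (·⁻¹) (ha p hp)⟩

theorem isRep_one : (1 : InvAn).IsRep fun _ => 1 := ⟨AnPair.one, rfl, fun _ _ => rfl⟩

theorem IsRep.prod {ι : Type*} (s : Finset ι) {F : ι → InvAn} {f : ι → X → ℂ}
    (h : ∀ i ∈ s, (F i).IsRep (f i)) : (∏ i ∈ s, F i).IsRep fun p => ∏ i ∈ s, f i p := by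
  classical
  induction s using Finset.induction_on with
  | empty => simpa using isRep_one
  | insert a s ha ih =>
    simp only [Finset.prod_insert ha]
    exact (h a (Finset.mem_insert_self a s)).mul (ih fun i hi => h i (Finset.mem_insert_of_mem hi))

theorem IsRep.smul {F : InvAn} {f : X → ℂ} (hF : F.IsRep f) (g : G) :
    (g • F).IsRep fun p => f (g⁻¹ • p) := by
  obtain ⟨a, rfl, ha⟩ := hF
  exact ⟨a.comp (Homeomorph.smul g⁻¹) (G.differentiable_smul g⁻¹), rfl,
    fun p hp => ha (g⁻¹ • p) hp⟩

theorem IsRep.scale {F : InvAn} {f : X → ℂ} (hF : F.IsRep f) (l : ℂˣ) :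
    (scale l F).IsRep fun p => f (l • p) := by
  obtain ⟨a, rfl, ha⟩ := hF
  exact ⟨a.comp (Homeomorph.smul l) (differentiable_id.const_smul (l : ℂ)), rfl,
    fun p hp => ha (l • p) hp⟩

theorem mk_eq_mk_of_dense {a b : AnPair} {D : Set X} (hD : Dense D)
    (h : ∀ p ∈ D, p ∈ a.dom → p ∈ b.dom → a.toFun p = b.toFun p) :
    (Quotient.mk _ a : InvAn) = Quotient.mk _ b := by
  refine Quotient.sound fun p hp => ?_
  by_contra hne
  have ho : IsOpen (a.dom ∩ b.dom) := a.isOpen_dom.inter b.isOpen_dom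
  have hcont : ContinuousOn (fun p => a.toFun p - b.toFun p) (a.dom ∩ b.dom) :=
    (a.holo.continuousOn.mono Set.inter_subset_left).sub
      (b.holo.continuousOn.mono Set.inter_subset_right)
  obtain ⟨q, hq, hqD⟩ := hD.inter_open_nonempty _
    (hcont.isOpen_inter_preimage ho (isOpen_compl_singleton (x := (0 : ℂ))))
    ⟨p, hp, by simpa [sub_eq_zero] using hne⟩
  exact hq.2 (by simp [h q hqD hq.1.1 hq.1.2])

/-- By Baire's theorem a residual set is dense, so countably many genericity conditions can be
imposed before two functions are compared. -/
theorem IsRep.eq {F H : InvAn} {f h : X → ℂ} (hF : F.IsRep f) (hH : H.IsRep h)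
    (hfh : ∀ᶠ p in residual X, f p = h p) : F = H := by
  obtain ⟨a, rfl, ha⟩ := hF
  obtain ⟨b, rfl, hb⟩ := hH
  refine mk_eq_mk_of_dense (dense_of_mem_residual hfh) fun p hp hpa hpb => ?_
  rw [ha p hpa, hb p hpb]
  exact hp

theorem IsRep.mem_N {F : InvAn} {f : X → ℂ} (hF : F.IsRep f)
    (h : ∀ (l : ℂˣ) (p : X), f (l • p) = f p) : F ∈ N := fun l =>
  (hF.scale l).eq hF (Eventually.of_forall (h l))

theorem IsRep.congr {F : InvAn} {f h : X → ℂ} (hF : F.IsRep f) (hfh : ∀ p, h p = f p) :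
    F.IsRep h := by
  rwa [funext hfh]

theorem IsRep.congr_on {F : InvAn} {f h : X → ℂ} (hF : F.IsRep f) {U : Set X} (hU : IsOpen U)
    (hd : Dense U) (hfh : ∀ p ∈ U, f p ≠ 0 → f p = h p) : F.IsRep h := by
  obtain ⟨a, rfl, ha⟩ := hF
  refine ⟨⟨a.dom ∩ U, a.isOpen_dom.inter hU, a.dense_dom.inter_of_isOpen_left hd a.isOpen_dom,
    a.toFun, a.holo.mono Set.inter_subset_left, fun p hp => a.ne_zero p hp.1⟩,
    Quotient.sound fun _ _ => rfl, fun p hp => ?_⟩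
  have h0 := a.ne_zero p hp.1
  rw [ha p hp.1] at h0
  exact (ha p hp.1).trans (hfh p hp.2 h0)

end InvAn

/-! ### Generic points of `X`. -/

/-- The value of an integral covector at a point of `ℂ³`. -/
def ev (d : Fin 3 → ℤ) (x : Fin 3 → ℂ) : ℂ := ∑ i, (d i : ℂ) * x i

theorem ev_add (d d' : Fin 3 → ℤ) (x : Fin 3 → ℂ) : ev (d + d') x = ev d x + ev d' x := by
  simp [ev, Fin.sum_univ_three]; ring

theorem ev_smul (n : ℤ) (d : Fin 3 → ℤ) (x : Fin 3 → ℂ) : ev (n • d) x = n * ev d x := by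
  simp [ev, Fin.sum_univ_three]; ring

theorem ev_neg (d : Fin 3 → ℤ) (x : Fin 3 → ℂ) : ev (-d) x = -ev d x := by
  simp [ev]

theorem ev_scale (d : Fin 3 → ℤ) (l : ℂˣ) (p : X) : ev d (l • p).2 = l * ev d p.2 := by
  simp only [ev, Finset.mul_sum]
  refine Finset.sum_congr rfl fun i _ => ?_
  change (d i : ℂ) * ((l : ℂ) * p.2 i) = _
  ring

theorem scale_fst (l : ℂˣ) (p : X) : (l • p).1 = l * p.1 := rfl

theorem ev_add_smul (d : Fin 3 → ℤ) (x y : Fin 3 → ℂ) (t : ℂ) :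
    ev d (x + t • y) = ev d x + t * ev d y := by
  simp [ev, Fin.sum_univ_three]; ring

@[fun_prop] theorem differentiable_ev (d : Fin 3 → ℤ) : Differentiable ℂ (ev d) := by
  unfold ev; fun_prop

@[fun_prop] theorem continuous_ev (d : Fin 3 → ℤ) : Continuous (ev d) :=
  (differentiable_ev d).continuous

/-- Points at which no nontrivial integral relation holds between the coordinates, and at which
the quotient of two independent integral covectors is not real. -/
structure IsGen (p : X) : Prop where
  lin : ∀ (n : ℤ) (d : Fin 3 → ℤ), n ≠ 0 ∨ d ≠ 0 → n * p.1 + ev d p.2 ≠ 0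
  im : ∀ a c : Fin 3 → ℤ, crossProduct a c ≠ 0 → (ev a p.2 / ev c p.2).im ≠ 0

theorem dense_of_forall_line {S : Set X} (h : ∀ p : X, ∃ y : X, {t : ℝ | p + (t : ℂ) • y ∉ S}.Countable) :
    Dense S := by
  intro p
  obtain ⟨y, hy⟩ := h p
  have h1 : Dense {t : ℝ | p + (t : ℂ) • y ∈ S} := by
    have := hy.dense_compl ℝ
    refine this.mono ?_
    intro t ht
    simpa using ht
  have h2 : Continuous fun t : ℝ => p + (t : ℂ) • y := by fun_prop
  have := map_mem_closure (t := S) h2 (h1 0) (fun t ht => ht)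
  simpa using this

theorem eventually_lin {n : ℤ} {d : Fin 3 → ℤ} (h : n ≠ 0 ∨ d ≠ 0) :
    ∀ᶠ p : X in residual X, n * p.1 + ev d p.2 ≠ 0 := by
  refine residual_of_dense_open (isOpen_ne_fun (by fun_prop) continuous_const) ?_
  obtain ⟨y, hy⟩ : ∃ y : X, n * y.1 + ev d y.2 ≠ 0 := by
    by_cases hn : n = 0
    · obtain ⟨i, hi⟩ := Function.ne_iff.1 (h.resolve_left (not_not.2 hn))
      refine ⟨(0, Pi.single i 1), ?_⟩
      simpa [ev, Pi.single_apply] using hi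
    · exact ⟨(1, 0), by simpa [ev] using hn⟩
  refine dense_of_forall_line fun p => ⟨y, Set.Subsingleton.countable ?_⟩
  intro s hs t ht
  have hs : ¬ (n * (p + (s : ℂ) • y).1 + ev d (p + (s : ℂ) • y).2 ≠ 0) := hs
  have ht : ¬ (n * (p + (t : ℂ) • y).1 + ev d (p + (t : ℂ) • y).2 ≠ 0) := ht
  rw [not_not] at hs ht
  simp only [Prod.fst_add, Prod.smul_fst, Prod.snd_add, Prod.smul_snd, ev_add_smul,
    smul_eq_mul] at hs ht
  have : ((s : ℂ) - t) * (n * y.1 + ev d y.2) = 0 := by linear_combination hs - ht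
  have := (mul_eq_zero.1 this).resolve_right hy
  exact_mod_cast sub_eq_zero.1 this

theorem exists_ev_eq {a c : Fin 3 → ℤ} (h : crossProduct a c ≠ 0) (u v : ℂ) :
    ∃ y, ev a y = u ∧ ev c y = v := by
  rw [cross_apply] at h
  set k₀ := a 1 * c 2 - a 2 * c 1
  set k₁ := a 2 * c 0 - a 0 * c 2
  set k₂ := a 0 * c 1 - a 1 * c 0
  have hD : (k₀ ^ 2 + k₁ ^ 2 + k₂ ^ 2 : ℤ) ≠ 0 := by
    intro h0
    have h1 : k₀ = 0 := by nlinarith [sq_nonneg k₀, sq_nonneg k₁, sq_nonneg k₂]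
    have h2 : k₁ = 0 := by nlinarith [sq_nonneg k₀, sq_nonneg k₁, sq_nonneg k₂]
    have h3 : k₂ = 0 := by nlinarith [sq_nonneg k₀, sq_nonneg k₁, sq_nonneg k₂]
    exact h (by rw [h1, h2, h3]; ext i; fin_cases i <;> rfl)
  have hD' : (k₀ ^ 2 + k₁ ^ 2 + k₂ ^ 2 : ℂ) ≠ 0 := by exact_mod_cast hD
  -- With k = a × c, the vectors c × k and k × a, divided by |k|², are dual to a and c.
  refine ⟨![(u * (c 1 * k₂ - c 2 * k₁) + v * (k₁ * a 2 - k₂ * a 1)) / (k₀ ^ 2 + k₁ ^ 2 + k₂ ^ 2),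
    (u * (c 2 * k₀ - c 0 * k₂) + v * (k₂ * a 0 - k₀ * a 2)) / (k₀ ^ 2 + k₁ ^ 2 + k₂ ^ 2),
    (u * (c 0 * k₁ - c 1 * k₀) + v * (k₀ * a 1 - k₁ * a 0)) / (k₀ ^ 2 + k₁ ^ 2 + k₂ ^ 2)], ?_, ?_⟩
  · simp only [ev, Fin.sum_univ_three, Matrix.cons_val]
    field_simp
    simp only [k₀, k₁, k₂]
    push_cast
    ring
  · simp only [ev, Fin.sum_univ_three, Matrix.cons_val]
    field_simp
    simp only [k₀, k₁, k₂]
    push_cast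
    ring

/-- Replaces the quotient by a continuous expression, so that the condition is visibly open. -/
theorem im_div_ne_zero_iff (u v : ℂ) : (u / v).im ≠ 0 ↔ (u * (starRingEnd ℂ) v).im ≠ 0 := by
  by_cases hv : v = 0
  · simp [hv]
  · rw [div_eq_mul_inv, Complex.inv_def, ← mul_assoc, Complex.im_mul_ofReal, mul_ne_zero_iff]
    simp [hv]

theorem isOpen_im_ne_zero (a c : Fin 3 → ℤ) : IsOpen {p : X | (ev a p.2 / ev c p.2).im ≠ 0} := by
  simp only [im_div_ne_zero_iff]
  exact isOpen_ne_fun (by fun_prop) continuous_const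

theorem eventually_im {a c : Fin 3 → ℤ} (h : crossProduct a c ≠ 0) :
    ∀ᶠ p : X in residual X, (ev a p.2 / ev c p.2).im ≠ 0 := by
  simp only [im_div_ne_zero_iff]
  refine residual_of_dense_open (isOpen_ne_fun (by fun_prop) continuous_const) ?_
  -- Along a direction with a(y) = i and c(y) = 1 the imaginary part becomes the monic quadratic A +
  -- B t + t², which has at most two real roots.
  obtain ⟨y, hy1, hy2⟩ := exists_ev_eq h Complex.I 1
  refine dense_of_forall_line fun p => ⟨(0, y), ?_⟩
  set A := (ev a p.2 * (starRingEnd ℂ) (ev c p.2)).im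
  set B := (ev a p.2).im + (ev c p.2).re
  have hq : ∀ t : ℝ, p + (t : ℂ) • ((0, y) : X) ∉
      {p : X | (ev a p.2 * (starRingEnd ℂ) (ev c p.2)).im ≠ 0} → A + B * t + t ^ 2 = 0 := by
    intro t ht
    have ht : ¬ ((ev a (p + (t : ℂ) • ((0, y) : X)).2 *
      (starRingEnd ℂ) (ev c (p + (t : ℂ) • ((0, y) : X)).2)).im ≠ 0) := ht
    rw [not_not] at ht
    simp only [Prod.snd_add, Prod.smul_snd, ev_add_smul, hy1, hy2] at ht
    simp only [map_add, mul_one, Complex.conj_ofReal] at ht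
    simp at ht
    simp only [A, B]
    simp
    linear_combination ht
  rcases Set.eq_empty_or_nonempty {t : ℝ | p + (t : ℂ) • ((0, y) : X) ∉
      {p : X | (ev a p.2 * (starRingEnd ℂ) (ev c p.2)).im ≠ 0}} with h0 | ⟨s, hs⟩
  · rw [h0]; exact Set.countable_empty
  · refine (Set.Finite.subset (Set.toFinite {s, -B - s}) ?_).countable
    intro t ht
    have e1 := hq s hs
    have e2 := hq t ht
    have : (t - s) * (t - (-B - s)) = 0 := by linear_combination e2 - e1
    rcases mul_eq_zero.1 this with h1 | h1
    · exact Or.inl (by linarith)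
    · exact Or.inr (by rw [Set.mem_singleton_iff]; linarith)

theorem eventually_isGen : ∀ᶠ p : X in residual X, IsGen p := by
  have h1 : ∀ᶠ p : X in residual X, ∀ (n : ℤ) (d : Fin 3 → ℤ), n ≠ 0 ∨ d ≠ 0 →
      n * p.1 + ev d p.2 ≠ 0 := by
    simp only [eventually_countable_forall]
    exact fun n d h => eventually_lin h
  have h2 : ∀ᶠ p : X in residual X, ∀ a c : Fin 3 → ℤ, crossProduct a c ≠ 0 →
      (ev a p.2 / ev c p.2).im ≠ 0 := by
    simp only [eventually_countable_forall]
    exact fun a c h => eventually_im h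
  filter_upwards [h1, h2] with p hp1 hp2 using ⟨hp1, hp2⟩

theorem IsGen.ev_ne_zero {p : X} (hp : IsGen p) {d : Fin 3 → ℤ} (hd : d ≠ 0) : ev d p.2 ≠ 0 := by
  simpa using hp.lin 0 d (Or.inr hd)

/-! ### Gamma functions attached to covectors, as elements of `N`. -/

/-- A nonzero value rules out a pole too, because division by zero gives zero; so the single
hypothesis suffices for differentiability in all three variables. -/
theorem differentiableAt_ellGamma {z τ σ : ℂ} (hτ : τ.im ≠ 0) (hσ : σ.im ≠ 0)
    (h : ellGamma z τ σ ≠ 0) :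
    DifferentiableAt ℂ (fun t : ℂ × ℂ × ℂ => ellGamma t.1 t.2.1 t.2.2) (z, τ, σ) := by
  have hev : ∀ {t : ℂ × ℂ × ℂ}, t.2.1.im ≠ 0 → ∀ᶠ s in 𝓝 t, s.2.1.im ≠ 0 := fun {t} ht =>
    ContinuousAt.eventually_ne (g := fun s : ℂ × ℂ × ℂ => s.2.1.im) (by fun_prop) ht
  have hev' : ∀ {t : ℂ × ℂ × ℂ}, t.2.2.im ≠ 0 → ∀ᶠ s in 𝓝 t, s.2.2.im ≠ 0 := fun {t} ht =>
    ContinuousAt.eventually_ne (g := fun s : ℂ × ℂ × ℂ => s.2.2.im) (by fun_prop) ht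
  refine flip_induction (P := fun τ σ => ∀ z, ellGamma z τ σ ≠ 0 → DifferentiableAt ℂ
    (fun t : ℂ × ℂ × ℂ => ellGamma t.1 t.2.1 t.2.2) (z, τ, σ)) ?_ ?_ ?_ hτ hσ z h
  · intro τ σ hτ hσ z h
    have hc : (fun t : ℂ × ℂ × ℂ => ellGamma t.1 t.2.1 t.2.2) =ᶠ[𝓝 (z, τ, σ)]
        fun t => dprod (e t.2.1 * e t.2.2 * e (-t.1)) (e t.2.1) (e t.2.2) /
          dprod (e t.1) (e t.2.1) (e t.2.2) := by
      have h1 : ∀ᶠ s : ℂ × ℂ × ℂ in 𝓝 (z, τ, σ), 0 < s.2.1.im :=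
        (by fun_prop : ContinuousAt (fun s : ℂ × ℂ × ℂ => s.2.1.im) (z, τ, σ)).tendsto.eventually
          (lt_mem_nhds hτ)
      have h2 : ∀ᶠ s : ℂ × ℂ × ℂ in 𝓝 (z, τ, σ), 0 < s.2.2.im :=
        (by fun_prop : ContinuousAt (fun s : ℂ × ℂ × ℂ => s.2.2.im) (z, τ, σ)).tendsto.eventually
          (lt_mem_nhds hσ)
      filter_upwards [h1, h2] with t ht1 ht2
      rw [ellGamma_of_pos _ ht1 ht2, e_neg, div_eq_mul_inv (e t.2.1 * e t.2.2)]
    refine DifferentiableAt.congr_of_eventuallyEq ?_ hc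
    have hq := norm_e_lt_one.2 hτ
    have hr := norm_e_lt_one.2 hσ
    have he : ∀ f : ℂ × ℂ × ℂ → ℂ, Differentiable ℂ f → Differentiable ℂ fun t => e (f t) :=
      fun f hf => differentiable_e.comp hf
    have hd : ∀ f : ℂ × ℂ × ℂ → ℂ, Differentiable ℂ f → DifferentiableAt ℂ
        (fun t : ℂ × ℂ × ℂ => dprod (f t) (e t.2.1) (e t.2.2)) (z, τ, σ) := fun f hf => by
      have h1 := differentiableAt_dprod (t := (f (z, τ, σ), e τ, e σ)) hq hr
      have h2 : DifferentiableAt ℂ (fun t : ℂ × ℂ × ℂ => (f t, e t.2.1, e t.2.2)) (z, τ, σ) :=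
        (hf _).prodMk ((he (fun t => t.2.1) (by fun_prop) _).prodMk
          (he (fun t => t.2.2) (by fun_prop) _))
      exact h1.comp (z, τ, σ) h2
    rw [ellGamma_of_pos _ hτ hσ] at h
    have h1 := he (fun t => t.2.1) (by fun_prop)
    have h2 := he (fun t => t.2.2) (by fun_prop)
    have h3 := he (fun t => -t.1) (by fun_prop)
    simp only [div_eq_mul_inv]
    exact (hd _ ((h1.fun_mul h2).fun_mul h3)).fun_mul
      ((hd _ (he (fun t => t.1) (by fun_prop))).fun_inv (div_ne_zero_iff.1 h).2)
  · intro τ σ hτ hσ ih z h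
    rw [ellGamma_neg_left _ _ hτ] at h
    have h0 : ellGamma (z + τ) τ σ ≠ 0 := fun h0 => h (by rw [h0, inv_zero])
    have h1 := ih _ h0
    have hc : (fun t : ℂ × ℂ × ℂ => ellGamma t.1 t.2.1 t.2.2) =ᶠ[𝓝 (z, -τ, σ)]
        fun t => (ellGamma (t.1 - t.2.1) (-t.2.1) t.2.2)⁻¹ := by
      filter_upwards [hev (t := (z, -τ, σ)) (by simpa using hτ)] with t ht
      rw [← neg_neg t.2.1, ellGamma_neg_left _ _ (by simpa using ht), neg_neg, sub_eq_add_neg]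
    refine DifferentiableAt.congr_of_eventuallyEq ?_ hc
    refine DifferentiableAt.inv ?_ (by simpa using h0)
    exact DifferentiableAt.comp (g := fun t : ℂ × ℂ × ℂ => ellGamma t.1 t.2.1 t.2.2)
      (f := fun t : ℂ × ℂ × ℂ => (t.1 - t.2.1, -t.2.1, t.2.2)) (z, -τ, σ)
      (by simpa using h1) (by fun_prop)
  · intro τ σ hτ hσ ih z h
    rw [ellGamma_neg_right _ _ hσ] at h
    have h0 : ellGamma (z + σ) τ σ ≠ 0 := fun h0 => h (by rw [h0, inv_zero])
    have h1 := ih _ h0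
    have hc : (fun t : ℂ × ℂ × ℂ => ellGamma t.1 t.2.1 t.2.2) =ᶠ[𝓝 (z, τ, -σ)]
        fun t => (ellGamma (t.1 - t.2.2) t.2.1 (-t.2.2))⁻¹ := by
      filter_upwards [hev' (t := (z, τ, -σ)) (by simpa using hσ)] with t ht
      rw [← neg_neg t.2.2, ellGamma_neg_right _ _ (by simpa using ht), neg_neg, sub_eq_add_neg]
    refine DifferentiableAt.congr_of_eventuallyEq ?_ hc
    refine DifferentiableAt.inv ?_ (by simpa using h0)
    exact DifferentiableAt.comp (g := fun t : ℂ × ℂ × ℂ => ellGamma t.1 t.2.1 t.2.2)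
      (f := fun t : ℂ × ℂ × ℂ => (t.1 - t.2.2, t.2.1, -t.2.2)) (z, τ, -σ)
      (by simpa using h1) (by fun_prop)

/-- The function `Γ((z + d(x)) / c(x), a(x) / c(x), b(x) / c(x))` on `X`. -/
def gammaFun (d a b c : Fin 3 → ℤ) (p : X) : ℂ :=
  ellGamma ((p.1 + ev d p.2) / ev c p.2) (ev a p.2 / ev c p.2) (ev b p.2 / ev c p.2)

section gammaFun

variable {d a b c : Fin 3 → ℤ}

theorem cross_ne_zero_right (ha : crossProduct a c ≠ 0) : c ≠ 0 := fun h => ha (by simp [h])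

theorem cross_ne_zero_left (ha : crossProduct a c ≠ 0) : a ≠ 0 := fun h => ha (by simp [h])

theorem IsGen.offLattice {p : X} (hp : IsGen p) (hc : c ≠ 0) :
    OffLattice ((p.1 + ev d p.2) / ev c p.2) (ev a p.2 / ev c p.2) (ev b p.2 / ev c p.2) := by
  intro i j k hijk
  have h0 := hp.ev_ne_zero hc
  refine hp.lin 1 (d + (-i) • c + (-j) • a + (-k) • b) (Or.inl one_ne_zero) ?_
  field_simp at hijk
  simp only [ev_add, ev_smul]
  push_cast
  linear_combination hijk

theorem IsGen.gammaFun_ne_zero {p : X} (hp : IsGen p) (ha : crossProduct a c ≠ 0)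
    (hb : crossProduct b c ≠ 0) : gammaFun d a b c p ≠ 0 :=
  ellGamma_ne_zero (hp.im _ _ ha) (hp.im _ _ hb) (hp.offLattice (cross_ne_zero_right ha))

/-- The nonvanishing cross products say that a/c and b/c are nonconstant, so generic points are good
and the domain is dense. Homogeneity of degree 0 places the function in `N`. -/
theorem exists_gammaFun (ha : crossProduct a c ≠ 0) (hb : crossProduct b c ≠ 0) :
    ∃ F : N, (F : InvAn).IsRep (gammaFun d a b c) := by
  set D : Set X := {p | (ev a p.2 / ev c p.2).im ≠ 0 ∧ (ev b p.2 / ev c p.2).im ≠ 0 ∧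
    gammaFun d a b c p ≠ 0} with hD
  have hc : ∀ p ∈ D, ev c p.2 ≠ 0 := fun p hp h0 => hp.1 (by simp [h0])
  have hr : ∀ f : X → ℂ, Differentiable ℂ f → ∀ p ∈ D,
      DifferentiableAt ℂ (fun p => f p / ev c p.2) p := fun f hf p hp => by
    have h2 : DifferentiableAt ℂ (fun p : X => ev c p.2) p := by fun_prop
    simpa only [div_eq_mul_inv] using (hf p).fun_mul (h2.fun_inv (hc p hp))
  have hd : ∀ p ∈ D, DifferentiableAt ℂ (gammaFun d a b c) p := fun p hp =>
    DifferentiableAt.comp (g := fun t : ℂ × ℂ × ℂ => ellGamma t.1 t.2.1 t.2.2)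
      (f := fun p : X => ((p.1 + ev d p.2) / ev c p.2, ev a p.2 / ev c p.2, ev b p.2 / ev c p.2)) p
      (differentiableAt_ellGamma hp.1 hp.2.1 hp.2.2)
      ((hr _ (by fun_prop) p hp).prodMk ((hr _ (by fun_prop) p hp).prodMk
        (hr _ (by fun_prop) p hp)))
  have hopen : IsOpen D := isOpen_iff_mem_nhds.2 fun p hp => by
    have h1 : ∀ᶠ p in 𝓝 p, (ev a p.2 / ev c p.2).im ≠ 0 :=
      (Complex.continuous_im.continuousAt.comp
        (hr (fun p => ev a p.2) (by fun_prop) p hp).continuousAt).eventually_ne hp.1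
    have h2 : ∀ᶠ p in 𝓝 p, (ev b p.2 / ev c p.2).im ≠ 0 :=
      (Complex.continuous_im.continuousAt.comp
        (hr (fun p => ev b p.2) (by fun_prop) p hp).continuousAt).eventually_ne hp.2.1
    filter_upwards [h1, h2, (hd p hp).continuousAt.eventually_ne hp.2.2] with q q1 q2 q3
      using ⟨q1, q2, q3⟩
  have hdense : Dense D := (dense_of_mem_residual eventually_isGen).mono fun p hp =>
    ⟨hp.im _ _ ha, hp.im _ _ hb, hp.gammaFun_ne_zero ha hb⟩
  let A : AnPair := ⟨D, hopen, hdense, gammaFun d a b c,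
    fun p hp => (hd p hp).differentiableWithinAt, fun p hp => hp.2.2⟩
  have hA : InvAn.IsRep (Quotient.mk _ A) (gammaFun d a b c) := ⟨A, rfl, fun _ _ => rfl⟩
  refine ⟨⟨Quotient.mk _ A, hA.mem_N fun l p => ?_⟩, hA⟩
  have hl : (l : ℂ) ≠ 0 := l.ne_zero
  simp only [gammaFun, ev_scale, scale_fst, ← mul_add, mul_div_mul_left _ _ hl]

end gammaFun

theorem N.eq_of_isRep {F H : N} {f h : X → ℂ} (hF : (F : InvAn).IsRep f) (hH : (H : InvAn).IsRep h)
    (hfh : ∀ p, IsGen p → f p = h p) : F = H :=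
  Subtype.ext (hF.eq hH (eventually_isGen.mono hfh))

theorem N.isRep_prod {ι : Type*} (s : Finset ι) {F : ι → N} {f : ι → X → ℂ}
    (h : ∀ i ∈ s, (F i : InvAn).IsRep (f i)) :
    ((∏ i ∈ s, F i : N) : InvAn).IsRep fun p => ∏ i ∈ s, f i p := by
  rw [Subgroup.val_finsetProd]
  exact InvAn.IsRep.prod s h

/-- The determinant of three vectors. -/
def det3 (a b c : Fin 3 → ℤ) : ℤ := a ⬝ᵥ crossProduct b c

theorem det3_eq (a b c : Fin 3 → ℤ) : det3 a b c = a 0 * (b 1 * c 2 - b 2 * c 1) +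
    a 1 * (b 2 * c 0 - b 0 * c 2) + a 2 * (b 0 * c 1 - b 1 * c 0) := by
  simp only [det3, cross_apply, dotProduct, Fin.sum_univ_three, Matrix.cons_val]

theorem det3_rotate (a b c : Fin 3 → ℤ) : det3 b c a = det3 a b c := by
  simp only [det3_eq]; ring

theorem det3_swap (a b c : Fin 3 → ℤ) : det3 b a c = -det3 a b c := by
  simp only [det3_eq]; ring

theorem cross_ne_zero_of_det3 {a b c : Fin 3 → ℤ} (h : det3 a b c ≠ 0) :
    crossProduct b c ≠ 0 := fun h0 => h (by simp [det3, h0])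

theorem cross_symm_ne_zero {a b : Fin 3 → ℤ} (h : crossProduct a b ≠ 0) : crossProduct b a ≠ 0 := by
  rw [← cross_anticomm]; exact neg_ne_zero.2 h

theorem cross_zsmul_ne_zero {a c : Fin 3 → ℤ} (h : crossProduct a c ≠ 0) {n : ℤ} (hn : n ≠ 0) :
    crossProduct (n • a) c ≠ 0 := by
  rw [map_smul, LinearMap.smul_apply]
  exact smul_ne_zero hn h

theorem cross_neg_ne_zero {a c : Fin 3 → ℤ} (h : crossProduct a c ≠ 0) :
    crossProduct a (-c) ≠ 0 := by
  rw [map_neg]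
  exact neg_ne_zero.2 h

theorem cross_add_zsmul (a c : Fin 3 → ℤ) (s : ℤ) :
    crossProduct (a + s • c) c = crossProduct a c := by
  rw [map_add, LinearMap.add_apply, map_smul, LinearMap.smul_apply, cross_self, smul_zero, add_zero]

/-- The invertible analytic function given by `gammaFun`. -/
def gN (d a b c : Fin 3 → ℤ) : N :=
  open Classical in
  if h : crossProduct a c ≠ 0 ∧ crossProduct b c ≠ 0 then
    (exists_gammaFun (d := d) h.1 h.2).choose else 1

section gN

variable {a b c : Fin 3 → ℤ} (d : Fin 3 → ℤ)

theorem gN_isRep (ha : crossProduct a c ≠ 0) (hb : crossProduct b c ≠ 0) :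
    (gN d a b c : InvAn).IsRep (gammaFun d a b c) := by
  rw [gN, dif_pos ⟨ha, hb⟩]
  exact (exists_gammaFun ha hb).choose_spec

/-- Γ depends on τ only through e(τ), and adding s c to a changes a/c by the integer s. -/
theorem gN_add_zsmul_left (ha : crossProduct a c ≠ 0) (hb : crossProduct b c ≠ 0) (s : ℤ) :
    gN d (a + s • c) b c = gN d a b c := by
  refine N.eq_of_isRep (gN_isRep d (by rwa [cross_add_zsmul]) hb) (gN_isRep d ha hb) fun p hp => ?_
  have h0 := hp.ev_ne_zero (cross_ne_zero_right ha)
  refine ellGamma_congr rfl (e_eq_e_iff.2 ⟨s, ?_⟩) rfl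
  rw [ev_add, ev_smul]
  field_simp

theorem gN_add_zsmul_right (ha : crossProduct a c ≠ 0) (hb : crossProduct b c ≠ 0) (s : ℤ) :
    gN d a (b + s • c) c = gN d a b c := by
  refine N.eq_of_isRep (gN_isRep d ha (by rwa [cross_add_zsmul])) (gN_isRep d ha hb) fun p hp => ?_
  have h0 := hp.ev_ne_zero (cross_ne_zero_right ha)
  refine ellGamma_congr rfl rfl (e_eq_e_iff.2 ⟨s, ?_⟩)
  rw [ev_add, ev_smul]
  field_simp

theorem gN_add_zsmul (ha : crossProduct a c ≠ 0) (hb : crossProduct b c ≠ 0) (s : ℤ) :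
    gN (d + s • c) a b c = gN d a b c := by
  refine N.eq_of_isRep (gN_isRep _ ha hb) (gN_isRep d ha hb) fun p hp => ?_
  have h0 := hp.ev_ne_zero (cross_ne_zero_right ha)
  refine ellGamma_congr (e_eq_e_iff.2 ⟨s, ?_⟩) rfl rfl
  rw [ev_add, ev_smul]
  field_simp
  ring

theorem gN_neg (ha : crossProduct a c ≠ 0) (hb : crossProduct b c ≠ 0) :
    gN d b a (-c) = (gN d a b c)⁻¹ := by
  refine N.eq_of_isRep (gN_isRep d (cross_neg_ne_zero hb) (cross_neg_ne_zero ha))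
    (gN_isRep d ha hb).inv fun p hp => ?_
  simp only [gammaFun, ev_neg, div_neg]
  rw [ellGamma_comm, ellGamma_neg_neg_neg _ (hp.im _ _ ha) (hp.im _ _ hb)]

theorem gN_distrib (ha : crossProduct a c ≠ 0) (hb : crossProduct b c ≠ 0) {n : ℕ} (hn : 0 < n) :
    gN d a b c = ∏ i ∈ Finset.range n, ∏ j ∈ Finset.range n,
      gN (d + (i : ℤ) • a + (j : ℤ) • b) ((n : ℤ) • a) ((n : ℤ) • b) c := by
  have hn' : (n : ℤ) ≠ 0 := by exact_mod_cast hn.ne'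
  refine N.eq_of_isRep (gN_isRep d ha hb) (N.isRep_prod _ fun i _ => N.isRep_prod _ fun j _ =>
    gN_isRep _ (cross_zsmul_ne_zero ha hn') (cross_zsmul_ne_zero hb hn')) fun p hp => ?_
  rw [gammaFun, ellGamma_distrib (hp.im _ _ ha) (hp.im _ _ hb) hn]
  refine Finset.prod_congr rfl fun i _ => Finset.prod_congr rfl fun j _ => ?_
  simp only [gammaFun, ev_add, ev_smul]
  push_cast
  congr 1 <;> ring

theorem smul_gN (ha : crossProduct a c ≠ 0) (hb : crossProduct b c ≠ 0) (g : G)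
    (ha' : crossProduct (a ᵥ* (g⁻¹).A.1) (c ᵥ* (g⁻¹).A.1) ≠ 0)
    (hb' : crossProduct (b ᵥ* (g⁻¹).A.1) (c ᵥ* (g⁻¹).A.1) ≠ 0) :
    g • gN d a b c = gN (d ᵥ* (g⁻¹).A.1 + (g⁻¹).n) (a ᵥ* (g⁻¹).A.1) (b ᵥ* (g⁻¹).A.1)
      (c ᵥ* (g⁻¹).A.1) := by
  have hev : ∀ (c : Fin 3 → ℤ) (p : X), ev c (g⁻¹ • p).2 = ev (c ᵥ* (g⁻¹).A.1) p.2 := by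
    intro c p
    simp only [ev, G.smul_snd, Fin.sum_univ_three, Matrix.vecMul, dotProduct]
    push_cast
    ring
  refine N.eq_of_isRep (F := g • gN d a b c) ((gN_isRep d ha hb).smul g) (gN_isRep _ ha' hb')
    fun p _ => ?_
  simp only [gammaFun, hev, ev_add]
  have h1 : (g⁻¹ • p).1 = p.1 + ev (g⁻¹).n p.2 := rfl
  rw [h1, add_assoc, add_comm (ev (g⁻¹).n p.2)]

end gN

/-! ### The modular relation modulo `M`. -/

theorem IsGen.generic {p : X} (hp : IsGen p) {a b c : Fin 3 → ℤ} (h : det3 a b c ≠ 0) :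
    Generic (ev a p.2) (ev b p.2) (ev c p.2) where
  im₂₁ := hp.im _ _ (cross_symm_ne_zero (cross_ne_zero_of_det3 (by rwa [det3_rotate b c a,
    det3_rotate])))
  im₃₁ := hp.im _ _ (cross_ne_zero_of_det3 (by rwa [det3_rotate]))
  im₃₂ := hp.im _ _ (cross_symm_ne_zero (cross_ne_zero_of_det3 h))
  indep i j k hijk := by
    by_cases h0 : i • a + j • b + k • c = 0
    · have h1 : i * det3 a b c = 0 := by
        have : det3 (i • a + j • b + k • c) b c = i * det3 a b c := by
          simp only [det3_eq, Pi.add_apply, Pi.smul_apply, smul_eq_mul]; ring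
        rw [← this, h0]; simp [det3]
      have h2 : j * det3 a b c = 0 := by
        have : det3 a (i • a + j • b + k • c) c = j * det3 a b c := by
          simp only [det3_eq, Pi.add_apply, Pi.smul_apply, smul_eq_mul]; ring
        rw [← this, h0]; simp [det3]
      have h3 : k * det3 a b c = 0 := by
        have : det3 a b (i • a + j • b + k • c) = k * det3 a b c := by
          simp only [det3_eq, Pi.add_apply, Pi.smul_apply, smul_eq_mul]; ring
        rw [← this, h0]; simp [det3]
      exact ⟨(mul_eq_zero.1 h1).resolve_right h, (mul_eq_zero.1 h2).resolve_right h,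
        (mul_eq_zero.1 h3).resolve_right h⟩
    · exact absurd (by simpa only [ev_add, ev_smul] using hijk) (hp.ev_ne_zero h0)

theorem exists_mem_M_cubicExp {a b c : Fin 3 → ℤ} (ha : a ≠ 0) (hb : b ≠ 0) (hc : c ≠ 0)
    (d : Fin 3 → ℤ) : ∃ F : N, F ∈ M ∧ (F : InvAn).IsRep fun p =>
      e (cubicExp (ev a p.2) (ev b p.2) (ev c p.2) (p.1 + ev d p.2)) := by
  set D : Set X := {p | p.2 2 ≠ 0 ∧ ev a p.2 ≠ 0 ∧ ev b p.2 ≠ 0 ∧ ev c p.2 ≠ 0}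
  have hopen : IsOpen D := isOpen_x₃.inter ((isOpen_ne_fun (by fun_prop) continuous_const).inter
    ((isOpen_ne_fun (by fun_prop) continuous_const).inter
      (isOpen_ne_fun (by fun_prop) continuous_const)))
  have hdense : Dense D := dense_x₃.inter_of_isOpen_left
    ((dense_of_mem_residual eventually_isGen).mono fun p hp =>
      ⟨hp.ev_ne_zero ha, hp.ev_ne_zero hb, hp.ev_ne_zero hc⟩) isOpen_x₃
  have hd : DifferentiableOn ℂ (fun p : X =>
      e (cubicExp (ev a p.2) (ev b p.2) (ev c p.2) (p.1 + ev d p.2))) D := by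
    refine differentiable_e.comp_differentiableOn fun p hp => ?_
    have h1 : DifferentiableAt ℂ (fun p : X => 6 * (ev a p.2 * ev b p.2 * ev c p.2)) p := by
      fun_prop
    have h0 : 6 * (ev a p.2 * ev b p.2 * ev c p.2) ≠ 0 := by
      obtain ⟨-, h1, h2, h3⟩ := hp
      exact mul_ne_zero (by norm_num) (mul_ne_zero (mul_ne_zero h1 h2) h3)
    simp only [cubicExp, div_eq_mul_inv (_ : ℂ) (6 * _)]
    refine DifferentiableAt.differentiableWithinAt (DifferentiableAt.fun_mul ?_ (h1.fun_inv h0))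
    fun_prop
  let A : AnPair := ⟨D, hopen, hdense, _, hd, fun _ _ => e_ne_zero _⟩
  have hA : InvAn.IsRep (Quotient.mk _ A) fun p =>
    e (cubicExp (ev a p.2) (ev b p.2) (ev c p.2) (p.1 + ev d p.2)) := ⟨A, rfl, fun _ _ => rfl⟩
  refine ⟨⟨Quotient.mk _ A, fun l => (hA.scale l).eq hA (eventually_isGen.mono fun p hp => ?_)⟩,
    ?_, hA⟩
  · have h1 := hp.ev_ne_zero ha
    have h2 := hp.ev_ne_zero hb
    have h3 := hp.ev_ne_zero hc
    have hl : (l : ℂ) ≠ 0 := l.ne_zero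
    simp only [ev_scale, scale_fst, cubicExp]
    congr 1
    field_simp
  · let X₀ : MvPolynomial (Fin 2) ℚ := MvPolynomial.X 0
    let X₁ : MvPolynomial (Fin 2) ℚ := MvPolynomial.X 1
    let Y₀ : MvPolynomial (Fin 3) ℚ := MvPolynomial.X 0
    let Y₁ : MvPolynomial (Fin 3) ℚ := MvPolynomial.X 1
    let Y₂ : MvPolynomial (Fin 3) ℚ := MvPolynomial.X 2
    let L : (Fin 3 → ℤ) → MvPolynomial (Fin 3) ℚ := fun c => linForm c Y₀ Y₁
    -- Z is twice the centred variable of `cubicExp`, divided by x₃. Clearing the halves turns the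
    -- denominator 6 into 48.
    let Z : MvPolynomial (Fin 3) ℚ := 2 * (Y₂ + L d) - (L a + L b + L c)
    let P : MvPolynomial (Fin 3) ℚ := -(Z ^ 3 - (L a ^ 2 + L b ^ 2 + L c ^ 2) * Z)
    let Q : MvPolynomial (Fin 2) ℚ := 48 * (linForm a X₀ X₁ * linForm b X₀ X₁ * linForm c X₀ X₁)
    have key : ∀ p ∈ D, p.2 2 ≠ 0 ∧
        MvPolynomial.aeval ![p.2 0 / p.2 2, p.2 1 / p.2 2] Q ≠ 0 ∧
        A.toFun p = e (MvPolynomial.aeval ![p.2 0 / p.2 2, p.2 1 / p.2 2, p.1 / p.2 2] P /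
          MvPolynomial.aeval ![p.2 0 / p.2 2, p.2 1 / p.2 2] Q) := by
      rintro p ⟨hx, h1, h2, h3⟩
      set v : Fin 2 → ℂ := ![p.2 0 / p.2 2, p.2 1 / p.2 2] with hv
      set w : Fin 3 → ℂ := ![p.2 0 / p.2 2, p.2 1 / p.2 2, p.1 / p.2 2] with hw
      have hX : ∀ c, MvPolynomial.aeval v (linForm c X₀ X₁) = ev c p.2 / p.2 2 :=
        fun i => aeval_linForm _ _ _ _ _ hx (by simp [X₀, hv]) (by simp [X₁, hv])
      have hY : ∀ c, MvPolynomial.aeval w (L c) = ev c p.2 / p.2 2 :=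
        fun i => aeval_linForm _ _ _ _ _ hx (by simp [Y₀, hw]) (by simp [Y₁, hw])
      have hZ : MvPolynomial.aeval w Y₂ = p.1 / p.2 2 := by simp [Y₂, hw]
      have hQ : MvPolynomial.aeval v Q =
          48 * (ev a p.2 / p.2 2 * (ev b p.2 / p.2 2) * (ev c p.2 / p.2 2)) := by
        simp only [Q, map_mul, hX, map_ofNat]
      refine ⟨hx, ?_, ?_⟩
      · rw [hQ]
        exact mul_ne_zero (by norm_num) (mul_ne_zero (mul_ne_zero (div_ne_zero h1 hx)
          (div_ne_zero h2 hx)) (div_ne_zero h3 hx))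
      · change e _ = _
        rw [hQ]
        simp only [P, Z, map_neg, map_sub, map_mul, map_pow, map_add, hY, hZ, map_ofNat, cubicExp]
        congr 1
        field_simp
        ring
    refine ⟨P, Q, fun h0 => ?_, A, rfl, key⟩
    obtain ⟨p, hp⟩ := hdense.nonempty
    exact (key p hp).2.1 (by rw [h0, map_zero])

/-- This is `tripleGamma_eq` at generic points; the exponential of the cubic lies in `M` because its
denominator depends on x alone. -/
theorem gN_triple_mem {a b c : Fin 3 → ℤ} (h : det3 a b c ≠ 0) (d : Fin 3 → ℤ) :
    gN d a b c * gN d b c a * gN d c a b ∈ M := by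
  have h1 : crossProduct b c ≠ 0 := cross_ne_zero_of_det3 h
  have h2 : crossProduct c a ≠ 0 := cross_ne_zero_of_det3 (by rwa [det3_rotate])
  have h3 : crossProduct a b ≠ 0 := cross_ne_zero_of_det3 (by rwa [det3_rotate b c a, det3_rotate])
  obtain ⟨F, hF, hF'⟩ := exists_mem_M_cubicExp (cross_ne_zero_left h3) (cross_ne_zero_left h1)
    (cross_ne_zero_left h2) d
  convert hF
  refine N.eq_of_isRep (((gN_isRep d (cross_symm_ne_zero h2) h1).mul
    (gN_isRep d (cross_symm_ne_zero h3) h2)).mul (gN_isRep d (cross_symm_ne_zero h1) h3)) hF'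
    fun p hp => ?_
  rw [← tripleGamma_eq (hp.generic h), tripleGamma]
  · simp only [gammaFun]
    ring
  · intro i j k hijk
    refine hp.lin 1 (d + (-i) • a + (-j) • b + (-k) • c) (Or.inl one_ne_zero) ?_
    simp only [ev_add, ev_smul]
    push_cast
    linear_combination hijk

/-! ### Products of gamma functions over lattice boxes. -/

theorem dotProduct_eq (a b : Fin 3 → ℤ) : a ⬝ᵥ b = a 0 * b 0 + a 1 * b 1 + a 2 * b 2 := by
  simp [dotProduct, Fin.sum_univ_three]

/-- Expansion in the basis dual to a, b, c: a lattice point is determined by its three values once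
the determinant is nonzero, so boxes are finite. -/
theorem det3_smul_eq (a b c d : Fin 3 → ℤ) : det3 a b c • d =
    (d ⬝ᵥ a) • crossProduct b c + (d ⬝ᵥ b) • crossProduct c a + (d ⬝ᵥ c) • crossProduct a b := by
  ext i
  fin_cases i <;>
  · simp [det3_eq, dotProduct_eq, cross_apply]
    ring

theorem det3_smul_eq' (a b c d : Fin 3 → ℤ) : det3 a b c • d =
    det3 d b c • a + det3 a d c • b + det3 a b d • c := by
  ext i
  fin_cases i <;>
  · simp [det3_eq]
    ring

theorem det3_swap_neg (a b c : Fin 3 → ℤ) : det3 b a (-c) = det3 a b c := by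
  simp only [det3_eq, Pi.neg_apply]
  ring

theorem cross_cross_left (a b c : Fin 3 → ℤ) :
    crossProduct (crossProduct b c) (crossProduct a b) = -(det3 a b c • b) := by
  ext i
  fin_cases i <;>
  · simp [det3_eq, cross_apply]
    ring

theorem cross_cross_right (a b c : Fin 3 → ℤ) :
    crossProduct (crossProduct c a) (crossProduct a b) = det3 a b c • a := by
  ext i
  fin_cases i <;>
  · simp [det3_eq, cross_apply]
    ring

theorem cross_cross_left_ne_zero {a b c : Fin 3 → ℤ} (h : det3 a b c ≠ 0) :
    crossProduct (crossProduct b c) (crossProduct a b) ≠ 0 := by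
  rw [cross_cross_left]
  exact neg_ne_zero.2 (smul_ne_zero h (cross_ne_zero_left (cross_ne_zero_of_det3 h)))

theorem cross_cross_right_ne_zero {a b c : Fin 3 → ℤ} (h : det3 a b c ≠ 0) :
    crossProduct (crossProduct c a) (crossProduct a b) ≠ 0 := by
  rw [cross_cross_right]
  refine smul_ne_zero h fun h0 => h (by simp [det3, h0])

theorem det3_cross (a b c : Fin 3 → ℤ) :
    det3 (crossProduct b c) (crossProduct c a) (crossProduct a b) = det3 a b c ^ 2 := by
  simp [det3_eq, cross_apply]
  ring

/-- Integral affine functions `(k, a)` on the dual lattice. -/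
abbrev V : Type := ℤ × (Fin 3 → ℤ)

/-- The value `k + δ · a` of `(k, a)` at `δ`. -/
def V.val (v : V) (δ : Fin 3 → ℤ) : ℤ := v.1 + δ ⬝ᵥ v.2

/-- The lattice points at which `v`, `w`, `y` take values in `[0, D)`, with `D` the determinant of
their linear parts. -/
def boxSet (v w y : V) : Set (Fin 3 → ℤ) :=
  {δ | v.val δ ∈ Set.Ico 0 (det3 v.2 w.2 y.2) ∧ w.val δ ∈ Set.Ico 0 (det3 v.2 w.2 y.2) ∧
    y.val δ ∈ Set.Ico 0 (det3 v.2 w.2 y.2)}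

theorem finite_boxSet (v w y : V) : (boxSet v w y).Finite := by
  by_cases h : det3 v.2 w.2 y.2 = 0
  · refine Set.Finite.subset Set.finite_empty fun δ hδ => ?_
    have := hδ.1
    simp [h] at this
  · refine Set.Finite.of_finite_image (f := fun δ => (v.val δ, w.val δ, y.val δ)) ?_ ?_
    · refine Set.Finite.subset ((Set.finite_Ico 0 (det3 v.2 w.2 y.2)).prod
        ((Set.finite_Ico 0 (det3 v.2 w.2 y.2)).prod (Set.finite_Ico 0 (det3 v.2 w.2 y.2)))) ?_
      rintro _ ⟨δ, hδ, rfl⟩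
      exact ⟨hδ.1, hδ.2.1, hδ.2.2⟩
    · intro δ _ δ' _ hδ
      simp only [V.val, Prod.mk.injEq, add_right_inj] at hδ
      have h1 := det3_smul_eq v.2 w.2 y.2 δ
      rw [hδ.1, hδ.2.1, hδ.2.2, ← det3_smul_eq] at h1
      exact smul_right_injective _ h h1

/-- `boxSet` as a finset. -/
def box (v w y : V) : Finset (Fin 3 → ℤ) := (finite_boxSet v w y).toFinset

theorem mem_box {v w y : V} {δ : Fin 3 → ℤ} : δ ∈ box v w y ↔
    v.val δ ∈ Set.Ico 0 (det3 v.2 w.2 y.2) ∧ w.val δ ∈ Set.Ico 0 (det3 v.2 w.2 y.2) ∧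
      y.val δ ∈ Set.Ico 0 (det3 v.2 w.2 y.2) :=
  Set.Finite.mem_toFinset _

theorem det3_pos_of_mem_box {v w y : V} {δ : Fin 3 → ℤ} (h : δ ∈ box v w y) :
    0 < det3 v.2 w.2 y.2 :=
  (mem_box.1 h).1.1.trans_lt (mem_box.1 h).1.2

theorem box_rotate (v w y : V) : box w y v = box v w y := by
  ext δ
  simp only [mem_box, det3_rotate]
  tauto

/-- The product of the elliptic gamma functions `Γ((z + δ · x) / γ, α / γ, β / γ)` over the points
`δ` of the box of `v`, `w`, `y`; here `(α, β, γ)` is `D` times the basis dual to the linear parts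
of `v`, `w`, `y`. -/
def gam (v w y : V) : N := ∏ δ ∈ box v w y,
  gN δ (crossProduct w.2 y.2) (crossProduct y.2 v.2) (crossProduct v.2 w.2)

/-- A cyclic rotation fixes the box and rotates (α, β, γ), so the three products combine point by
point into modular relations. -/
theorem gam_triple_mem (v w y : V) : gam v w y * gam w y v * gam y v w ∈ M := by
  rw [gam, gam, gam, box_rotate, box_rotate w y v, box_rotate, ← Finset.prod_mul_distrib,
    ← Finset.prod_mul_distrib]
  refine Subgroup.prod_mem _ fun δ hδ => gN_triple_mem ?_ δ
  rw [det3_cross]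
  exact pow_ne_zero 2 (det3_pos_of_mem_box hδ).ne'

/-- The third affine function f is replaced by D - 1 - f, which takes values in [0, D) exactly when
f does. The box is unchanged, while γ changes sign and α, β are exchanged. -/
theorem gam_swap (v w : V) (m : ℤ) (c : Fin 3 → ℤ) :
    gam w v (det3 v.2 w.2 c - 1 - m, -c) = (gam v w (m, c))⁻¹ := by
  have hb : box w v (det3 v.2 w.2 c - 1 - m, -c) = box v w (m, c) := by
    ext δ
    simp only [mem_box, det3_swap_neg, V.val, dotProduct_neg, Set.mem_Ico]
    omega
  rw [gam, gam, hb, ← Finset.prod_inv_distrib]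
  refine Finset.prod_congr rfl fun δ hδ => ?_
  have h := (det3_pos_of_mem_box hδ).ne'
  rw [← gN_neg δ (cross_cross_left_ne_zero h) (cross_cross_right_ne_zero h)]
  simp only [map_neg, LinearMap.neg_apply, cross_anticomm]

/-- Passing from c to n c + i a + j b multiplies D by n, keeps γ, and turns α, β into n α - i γ, n β
- j γ. The multiples of γ are invisible to Γ, and the distribution relation splits each old factor
into n² factors, which are those of the new box. -/
theorem gam_refine (v w : V) {m m' : ℤ} {c c' : Fin 3 → ℤ} (hD : 0 < det3 v.2 w.2 c) {n : ℕ}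
    (hn : 0 < n) (i j : ℤ) (hc : c' = (n : ℤ) • c + i • v.2 + j • w.2) :
    gam v w (m', c') = gam v w (m, c) := by
  obtain ⟨k, a⟩ := v
  obtain ⟨l, b⟩ := w
  simp only at hD hc
  set D := det3 a b c with hDdef
  set α := crossProduct b c with hα
  set β := crossProduct c a with hβ
  set γ := crossProduct a b with hγ
  have hn' : (0 : ℤ) < n := by exact_mod_cast hn
  have hD' : det3 a b c' = n * D := by
    rw [hDdef, hc]; simp only [det3_eq, Pi.add_apply, Pi.smul_apply, smul_eq_mul]; ring
  have hα' : crossProduct b c' = (n : ℤ) • α + (-i) • γ := by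
    rw [hc, hα, hγ]; ext r
    fin_cases r <;>
    · simp [cross_apply]
      ring
  have hβ' : crossProduct c' a = (n : ℤ) • β + (-j) • γ := by
    rw [hc, hβ, hγ]; ext r
    fin_cases r <;>
    · simp [cross_apply]
      ring
  have h1 : crossProduct α γ ≠ 0 := cross_cross_left_ne_zero hD.ne'
  have h2 : crossProduct β γ ≠ 0 := cross_cross_right_ne_zero hD.ne'
  have αa : α ⬝ᵥ a = D := by
    simp only [hα, hDdef, det3_eq, dotProduct_eq, cross_apply, Matrix.cons_val]; ring
  have αb : α ⬝ᵥ b = 0 := by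
    simp only [hα, dotProduct_eq, cross_apply, Matrix.cons_val]; ring
  have αc : α ⬝ᵥ c = 0 := by
    simp only [hα, dotProduct_eq, cross_apply, Matrix.cons_val]; ring
  have βa : β ⬝ᵥ a = 0 := by
    simp only [hβ, dotProduct_eq, cross_apply, Matrix.cons_val]; ring
  have βb : β ⬝ᵥ b = D := by
    simp only [hβ, hDdef, det3_eq, dotProduct_eq, cross_apply, Matrix.cons_val]; ring
  have βc : β ⬝ᵥ c = 0 := by
    simp only [hβ, dotProduct_eq, cross_apply, Matrix.cons_val]; ring
  have γa : γ ⬝ᵥ a = 0 := by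
    simp only [hγ, dotProduct_eq, cross_apply, Matrix.cons_val]; ring
  have γb : γ ⬝ᵥ b = 0 := by
    simp only [hγ, dotProduct_eq, cross_apply, Matrix.cons_val]; ring
  have γc : γ ⬝ᵥ c = D := by
    simp only [hγ, hDdef, det3_eq, dotProduct_eq, cross_apply, Matrix.cons_val]; ring
  have γc' : γ ⬝ᵥ c' = n * D := by
    rw [hc, dotProduct_add, dotProduct_add, dotProduct_smul, dotProduct_smul, dotProduct_smul,
      γa, γb, γc]
    simp
  have hnD : 0 < n * D := mul_pos hn' hD
  have hsplit : ∀ {E u q : ℤ}, 0 < E → 0 ≤ u → u < E → (u + q * E) / E = q := by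
    intro E u q hE hu hu'
    rw [Int.add_mul_ediv_right _ _ hE.ne', Int.ediv_eq_zero_of_lt hu hu', zero_add]
  have hmod : ∀ {E : ℤ} (u : ℤ), 0 < E → 0 ≤ u - u / E * E ∧ u - u / E * E < E := by
    intro E u hE
    have e1 := Int.emod_nonneg u hE.ne'
    have e2 := Int.emod_lt_of_pos u hE
    have e3 := Int.emod_add_mul_ediv u E
    constructor <;> nlinarith
  -- Adding α or β raises the first or second value by D. Since γ · c' = n D and γ is orthogonal to
  -- a and b, exactly one translate by a multiple of γ has its third value in [0, n D).
  let f : (Fin 3 → ℤ) × ℕ × ℕ → Fin 3 → ℤ := fun q =>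
    q.1 + (q.2.1 : ℤ) • α + (q.2.2 : ℤ) • β -
      ((m' + (q.1 + (q.2.1 : ℤ) • α + (q.2.2 : ℤ) • β) ⬝ᵥ c') / (n * D)) • γ
  -- For the inverse map, the quotients by D of the first two values recover the multiples of α and
  -- β; a multiple of γ then restores the third condition.
  let δ₁ : (Fin 3 → ℤ) → Fin 3 → ℤ := fun δ =>
    δ - ((k + δ ⬝ᵥ a) / D) • α - ((l + δ ⬝ᵥ b) / D) • β
  let f' : (Fin 3 → ℤ) → (Fin 3 → ℤ) × ℕ × ℕ := fun δ =>
    (δ₁ δ - ((m + δ₁ δ ⬝ᵥ c) / D) • γ, ((k + δ ⬝ᵥ a) / D).toNat, ((l + δ ⬝ᵥ b) / D).toNat)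
  have fa : ∀ q, f q ⬝ᵥ a = q.1 ⬝ᵥ a + q.2.1 * D := fun q => by
    simp only [f, sub_dotProduct, add_dotProduct, smul_dotProduct, αa, βa, γa, smul_eq_mul]; ring
  have fb : ∀ q, f q ⬝ᵥ b = q.1 ⬝ᵥ b + q.2.2 * D := fun q => by
    simp only [f, sub_dotProduct, add_dotProduct, smul_dotProduct, αb, βb, γb, smul_eq_mul]; ring
  have f'a : ∀ δ, (f' δ).1 ⬝ᵥ a = δ ⬝ᵥ a - (k + δ ⬝ᵥ a) / D * D := fun δ => by
    simp only [f', δ₁, sub_dotProduct, smul_dotProduct, αa, βa, γa, smul_eq_mul]; ring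
  have f'b : ∀ δ, (f' δ).1 ⬝ᵥ b = δ ⬝ᵥ b - (l + δ ⬝ᵥ b) / D * D := fun δ => by
    simp only [f', δ₁, sub_dotProduct, smul_dotProduct, αb, βb, γb, smul_eq_mul]; ring
  have hbox : ∀ δ, δ ∈ box (k, a) (l, b) (m, c) ↔ (0 ≤ k + δ ⬝ᵥ a ∧ k + δ ⬝ᵥ a < D) ∧
      (0 ≤ l + δ ⬝ᵥ b ∧ l + δ ⬝ᵥ b < D) ∧ (0 ≤ m + δ ⬝ᵥ c ∧ m + δ ⬝ᵥ c < D) := fun δ => mem_box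
  have hbox' : ∀ δ, δ ∈ box (k, a) (l, b) (m', c') ↔ (0 ≤ k + δ ⬝ᵥ a ∧ k + δ ⬝ᵥ a < n * D) ∧
      (0 ≤ l + δ ⬝ᵥ b ∧ l + δ ⬝ᵥ b < n * D) ∧ (0 ≤ m' + δ ⬝ᵥ c' ∧ m' + δ ⬝ᵥ c' < n * D) :=
    fun δ => by rw [← hD']; exact mem_box
  have hquot : ∀ u : ℤ, 0 ≤ u → u < n * D → ((u / D).toNat : ℤ) = u / D ∧ (u / D).toNat < n := by
    intro u h0 h1
    have e1 : ((u / D).toNat : ℤ) = u / D := Int.toNat_of_nonneg (Int.ediv_nonneg h0 hD.le)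
    refine ⟨e1, ?_⟩
    have e2 : u / D < n := Int.ediv_lt_of_lt_mul hD h1
    omega
  have hprod : gam (k, a) (l, b) (m, c) = ∏ q ∈ box (k, a) (l, b) (m, c) ×ˢ
      (Finset.range n ×ˢ Finset.range n),
        gN (q.1 + (q.2.1 : ℤ) • α + (q.2.2 : ℤ) • β) ((n : ℤ) • α) ((n : ℤ) • β) γ := by
    rw [Finset.prod_product]
    refine Finset.prod_congr rfl fun δ _ => ?_
    rw [Finset.prod_product]
    exact gN_distrib δ h1 h2 hn
  rw [hprod, gam]
  symm
  have h1' : crossProduct ((n : ℤ) • α) γ ≠ 0 := cross_zsmul_ne_zero h1 hn'.ne'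
  have h2' : crossProduct ((n : ℤ) • β) γ ≠ 0 := cross_zsmul_ne_zero h2 hn'.ne'
  refine Finset.prod_nbij' f f' ?_ ?_ ?_ ?_ ?_
  · rintro q hq
    simp only [Finset.mem_product, Finset.mem_range, hbox] at hq
    obtain ⟨⟨⟨q1, q2⟩, ⟨q3, q4⟩, -⟩, q5, q6⟩ := hq
    rw [hbox', fa, fb]
    have e1 : (q.2.1 : ℤ) + 1 ≤ n := by exact_mod_cast q5
    have e2 : (q.2.2 : ℤ) + 1 ≤ n := by exact_mod_cast q6
    have e3 : (0 : ℤ) ≤ q.2.1 := Int.natCast_nonneg _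
    have e4 : (0 : ℤ) ≤ q.2.2 := Int.natCast_nonneg _
    refine ⟨⟨by nlinarith, by nlinarith⟩, ⟨by nlinarith, by nlinarith⟩, ?_⟩
    have := hmod (m' + (q.1 + (q.2.1 : ℤ) • α + (q.2.2 : ℤ) • β) ⬝ᵥ c') hnD
    simp only [f]
    rw [sub_dotProduct, smul_dotProduct, γc', smul_eq_mul, ← add_sub_assoc]
    exact this
  · intro δ hδ
    rw [hbox'] at hδ
    obtain ⟨⟨d1, d2⟩, ⟨d3, d4⟩, -⟩ := hδ
    simp only [Finset.mem_product, Finset.mem_range, hbox, f'a, f'b]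
    refine ⟨⟨by rw [← add_sub_assoc]; exact hmod _ hD, by rw [← add_sub_assoc]; exact hmod _ hD, ?_⟩,
      (hquot _ d1 d2).2, (hquot _ d3 d4).2⟩
    have := hmod (m + δ₁ δ ⬝ᵥ c) hD
    simp only [f']
    rw [sub_dotProduct, smul_dotProduct, γc, smul_eq_mul, ← add_sub_assoc]
    exact this
  · rintro q hq
    simp only [Finset.mem_product, Finset.mem_range, hbox] at hq
    obtain ⟨⟨⟨q1, q2⟩, ⟨q3, q4⟩, ⟨q5, q6⟩⟩, -, -⟩ := hq
    have e1 : (k + f q ⬝ᵥ a) / D = q.2.1 := by rw [fa, ← add_assoc]; exact hsplit hD q1 q2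
    have e2 : (l + f q ⬝ᵥ b) / D = q.2.2 := by rw [fb, ← add_assoc]; exact hsplit hD q3 q4
    set r := (m' + (q.1 + (q.2.1 : ℤ) • α + (q.2.2 : ℤ) • β) ⬝ᵥ c') / (n * D) with hr
    have e3 : δ₁ (f q) = q.1 + (-r) • γ := by
      simp only [δ₁, e1, e2]
      simp only [f, ← hr]
      module
    have e4 : (m + δ₁ (f q) ⬝ᵥ c) / D = -r := by
      rw [e3, add_dotProduct, smul_dotProduct, γc, smul_eq_mul, ← add_assoc]
      exact hsplit hD q5 q6
    refine Prod.ext ?_ (Prod.ext ?_ ?_)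
    · simp only [f']
      rw [e4, e3]
      module
    · simp only [f', e1]; simp
    · simp only [f', e2]; simp
  · intro δ hδ
    rw [hbox'] at hδ
    obtain ⟨⟨d1, d2⟩, ⟨d3, d4⟩, ⟨d5, d6⟩⟩ := hδ
    set r := (m + δ₁ δ ⬝ᵥ c) / D with hr
    have e3 : (f' δ).1 + ((f' δ).2.1 : ℤ) • α + ((f' δ).2.2 : ℤ) • β = δ + (-r) • γ := by
      simp only [f', (hquot _ d1 d2).1, (hquot _ d3 d4).1]
      simp only [δ₁] at hr ⊢
      rw [← hr]
      module
    simp only [f]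
    rw [e3, add_dotProduct, smul_dotProduct, γc', smul_eq_mul, ← add_assoc, hsplit hnD d5 d6]
    module
  · intro q _
    simp only
    rw [hα', hβ', gN_add_zsmul_left _ h1' (by rwa [cross_add_zsmul]),
      gN_add_zsmul_right _ h1' h2']
    simp only [f]
    rw [sub_eq_add_neg, ← neg_smul, gN_add_zsmul _ h1' h2']

/-! ### Equivariance under `G`. -/

/-- The action `(A, n) (k, a) = (k + n · a, A a)` on integral affine functions. -/
instance : MulAction G V where
  smul g v := (v.1 + g.n ⬝ᵥ v.2, g.A.1 *ᵥ v.2)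
  one_smul v := by
    refine Prod.ext ?_ ?_
    · change v.1 + (0 : Fin 3 → ℤ) ⬝ᵥ v.2 = v.1
      rw [zero_dotProduct, add_zero]
    · exact Matrix.one_mulVec v.2
  mul_smul g h v := by
    refine Prod.ext ?_ ?_
    · change v.1 + (h.n + g.n ᵥ* h.A.1) ⬝ᵥ v.2 = v.1 + h.n ⬝ᵥ v.2 + g.n ⬝ᵥ (h.A.1 *ᵥ v.2)
      rw [add_dotProduct, Matrix.dotProduct_mulVec, add_assoc]
    · exact (Matrix.mulVec_mulVec v.2 g.A.1 h.A.1).symm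

theorem V.smul_fst (g : G) (v : V) : (g • v).1 = v.1 + g.n ⬝ᵥ v.2 := rfl

theorem V.smul_snd (g : G) (v : V) : (g • v).2 = g.A.1 *ᵥ v.2 := rfl

theorem inv_A_mul (g : G) : (g⁻¹).A.1 * g.A.1 = 1 :=
  congrArg Subtype.val (inv_mul_cancel g.A)

theorem mul_inv_A (g : G) : g.A.1 * (g⁻¹).A.1 = 1 :=
  congrArg Subtype.val (mul_inv_cancel g.A)

theorem inv_n (g : G) : (g⁻¹).n = -(g.n ᵥ* (g⁻¹).A.1) := rfl

/-- Cross products transform by the cofactor matrix, and the adjugate of a matrix of determinant 1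
is its inverse. -/
theorem cross_mulVec (g : G) (a b : Fin 3 → ℤ) :
    crossProduct (g.A.1 *ᵥ a) (g.A.1 *ᵥ b) = crossProduct a b ᵥ* (g⁻¹).A.1 := by
  have : (g⁻¹).A.1 = g.A.1.adjugate := Matrix.SpecialLinearGroup.coe_inv g.A
  rw [this, Matrix.adjugate_fin_three]
  ext i
  fin_cases i <;>
  · simp [cross_apply, Matrix.mulVec, Matrix.vecMul, dotProduct, Fin.sum_univ_three]
    ring

/-- The transformation of lattice points for which `V.val_smul` holds. -/
def pull (g : G) (δ : Fin 3 → ℤ) : Fin 3 → ℤ := δ ᵥ* (g⁻¹).A.1 + (g⁻¹).n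

theorem V.val_smul (g : G) (v : V) (δ : Fin 3 → ℤ) : (g • v).val (pull g δ) = v.val δ := by
  rw [V.val, V.val, V.smul_fst, V.smul_snd, pull, inv_n, add_dotProduct, neg_dotProduct,
    Matrix.dotProduct_mulVec, Matrix.dotProduct_mulVec, Matrix.vecMul_vecMul,
    Matrix.vecMul_vecMul, inv_A_mul, Matrix.vecMul_one, Matrix.vecMul_one]
  ring

theorem pull_inv_pull (g : G) (δ : Fin 3 → ℤ) : pull g⁻¹ (pull g δ) = δ := by
  rw [pull, pull, inv_inv, inv_n, Matrix.add_vecMul, Matrix.vecMul_vecMul, Matrix.neg_vecMul,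
    Matrix.vecMul_vecMul, inv_A_mul, Matrix.vecMul_one, Matrix.vecMul_one, neg_add_cancel_right]

theorem pull_pull_inv (g : G) (δ : Fin 3 → ℤ) : pull g (pull g⁻¹ δ) = δ := by
  simpa using pull_inv_pull g⁻¹ δ

theorem det3_smul (g : G) (v w y : V) :
    det3 (g • v).2 (g • w).2 (g • y).2 = det3 v.2 w.2 y.2 := by
  rw [det3, V.smul_snd, V.smul_snd, V.smul_snd, cross_mulVec, dotProduct_comm,
    Matrix.dotProduct_mulVec, Matrix.vecMul_vecMul, inv_A_mul, Matrix.vecMul_one, dotProduct_comm,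
    det3]

theorem vecMul_ne_zero (g : G) {a : Fin 3 → ℤ} (h : a ≠ 0) : a ᵥ* g.A.1 ≠ 0 := fun h0 => h (by
  have := congrArg (· ᵥ* (g⁻¹).A.1) h0
  simpa [Matrix.vecMul_vecMul, mul_inv_A] using this)

theorem mulVec_ne_zero (g : G) {a : Fin 3 → ℤ} (h : a ≠ 0) : g.A.1 *ᵥ a ≠ 0 := fun h0 => h (by
  have := congrArg ((g⁻¹).A.1 *ᵥ ·) h0
  simpa [Matrix.mulVec_mulVec, inv_A_mul] using this)

/-- The map `pull g` preserves the three affine values and the determinant, so it is a bijection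
between the two boxes. -/
theorem smul_gam (g : G) (v w y : V) : g • gam v w y = gam (g • v) (g • w) (g • y) := by
  rw [gam, Finset.smul_prod', gam]
  refine Finset.prod_nbij' (pull g) (pull g⁻¹) ?_ ?_ ?_ ?_ ?_
  · intro δ hδ
    simpa only [mem_box, V.val_smul, det3_smul] using hδ
  · intro δ hδ
    have hs : ∀ v : V, v.val (pull g⁻¹ δ) = (g • v).val δ := fun v => by
      have := V.val_smul g⁻¹ (g • v) δ
      rwa [inv_smul_smul] at this
    simpa only [mem_box, hs, det3_smul] using hδ
  · exact fun δ _ => pull_inv_pull g δ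
  · exact fun δ _ => pull_pull_inv g δ
  · intro δ hδ
    have h := (det3_pos_of_mem_box hδ).ne'
    have h' : det3 (g • v).2 (g • w).2 (g • y).2 ≠ 0 := by rwa [det3_smul]
    have h1 := cross_cross_left_ne_zero h'
    have h2 := cross_cross_right_ne_zero h'
    simp only [V.smul_snd, cross_mulVec] at h1 h2 ⊢
    exact smul_gN δ (cross_cross_left_ne_zero h) (cross_cross_right_ne_zero h) g h1 h2

/-- A common refinement: by Cramer's rule det(v,w,c) c' is det(v,w,c') c plus a combination of the
linear parts of v and w. It refines c, and it is also a positive multiple of c'. -/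
theorem gam_eq_gam {v w y y' : V} (h : 0 < det3 v.2 w.2 y.2) (h' : 0 < det3 v.2 w.2 y'.2) :
    gam v w y = gam v w y' := by
  obtain ⟨m, c⟩ := y
  obtain ⟨m', c'⟩ := y'
  simp only at h h'
  have hc := det3_smul_eq' v.2 w.2 c c'
  have e1 : ((det3 v.2 w.2 c').toNat : ℤ) = det3 v.2 w.2 c' := Int.toNat_of_nonneg h'.le
  have e2 : ((det3 v.2 w.2 c).toNat : ℤ) = det3 v.2 w.2 c := Int.toNat_of_nonneg h.le
  rw [← gam_refine v w (m' := 0) (c' := det3 v.2 w.2 c • c') h (n := (det3 v.2 w.2 c').toNat)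
      (by omega) (det3 c' w.2 c) (det3 v.2 c' c) (by rw [hc, e1]; abel),
    gam_refine v w h' (n := (det3 v.2 w.2 c).toNat) (by omega) 0 0 (by rw [e2]; simp)]

/-! ### The two-point classes and their cocycle relation. -/

/-- The class in `N ⧸ M` of `gam v w y` for any `y` for which the determinant is positive. -/
def cls (v w : V) : N ⧸ M := QuotientGroup.mk (gam v w (0, crossProduct v.2 w.2))

theorem det3_cross_pos {a b : Fin 3 → ℤ} (h : crossProduct a b ≠ 0) :
    0 < det3 a b (crossProduct a b) := by
  have e : det3 a b (crossProduct a b) = crossProduct a b 0 ^ 2 + crossProduct a b 1 ^ 2 +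
      crossProduct a b 2 ^ 2 := by
    simp only [det3_eq, cross_apply, Matrix.cons_val]; ring
  rw [e]
  by_contra h0
  refine h ?_
  have h0 : crossProduct a b 0 = 0 ∧ crossProduct a b 1 = 0 ∧ crossProduct a b 2 = 0 := by
    refine ⟨?_, ?_, ?_⟩ <;>
    nlinarith [sq_nonneg (crossProduct a b 0), sq_nonneg (crossProduct a b 1),
      sq_nonneg (crossProduct a b 2)]
  ext i
  fin_cases i
  exacts [h0.1, h0.2.1, h0.2.2]

theorem det3_rotate' (a b c : Fin 3 → ℤ) : det3 c a b = det3 a b c :=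
  (det3_rotate c a b).symm

theorem cross_ne_zero_of_det3' {a b c : Fin 3 → ℤ} (h : det3 a b c ≠ 0) :
    crossProduct a b ≠ 0 := cross_ne_zero_of_det3 (a := c) (by rwa [det3_rotate'])

theorem mk_gam {v w y : V} (h : 0 < det3 v.2 w.2 y.2) : (gam v w y : N ⧸ M) = cls v w := by
  rw [cls, gam_eq_gam (y' := (0, crossProduct v.2 w.2)) h (det3_cross_pos (cross_ne_zero_of_det3' h.ne'))]

theorem cls_swap (v w : V) : cls w v = (cls v w)⁻¹ := by
  by_cases h : crossProduct v.2 w.2 = 0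
  · have h' : crossProduct w.2 v.2 = 0 := by rw [← cross_anticomm, h, neg_zero]
    have : ∀ v w : V, crossProduct v.2 w.2 = 0 → cls v w = 1 := fun v w h => by
      rw [cls, gam, Finset.prod_eq_one fun δ hδ => ?_, QuotientGroup.mk_one]
      have := det3_pos_of_mem_box hδ
      simp [h, det3] at this
    rw [this v w h, this w v h', inv_one]
  · have hp := det3_cross_pos h
    have h1 : cls w v = (gam w v (det3 v.2 w.2 (crossProduct v.2 w.2) - 1 - 0,
        -crossProduct v.2 w.2) : N ⧸ M) := (mk_gam (by rwa [det3_swap_neg])).symm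
    rw [h1, gam_swap]
    rfl

theorem cls_smul (g : G) (v w : V) : g • cls v w = cls (g • v) (g • w) := by
  by_cases h : crossProduct v.2 w.2 = 0
  · have h' : crossProduct (g • v).2 (g • w).2 = 0 := by
      rw [V.smul_snd, V.smul_snd, cross_mulVec, h, Matrix.zero_vecMul]
    have : ∀ v w : V, crossProduct v.2 w.2 = 0 → cls v w = 1 := fun v w h => by
      rw [cls, gam, Finset.prod_eq_one fun δ hδ => ?_, QuotientGroup.mk_one]
      have := det3_pos_of_mem_box hδ
      simp [h, det3] at this
    rw [this _ _ h, this _ _ h', smul_one]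
  · have e : g • cls v w = ((g • gam v w (0, crossProduct v.2 w.2) : N) : N ⧸ M) := rfl
    rw [e, smul_gam, mk_gam]
    rw [det3_smul]
    exact det3_cross_pos h

/-- For positive determinant the three classes may be computed with the respective third argument as
auxiliary covector, which gives `gam_triple_mem`. For negative determinant the order of the
arguments is reversed. -/
theorem cls_mul {v w y : V} (h : det3 v.2 w.2 y.2 ≠ 0) : cls v w * cls w y = cls v y := by
  have key : ∀ v w y : V, 0 < det3 v.2 w.2 y.2 → cls v w * cls w y = cls v y := by
    intro v w y h
    rw [← mk_gam h, ← mk_gam (v := w) (w := y) (y := v) (by rwa [det3_rotate]), cls_swap y v,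
      ← mk_gam (v := y) (w := v) (y := w) (by rwa [det3_rotate'])]
    rw [eq_inv_iff_mul_eq_one]
    exact (QuotientGroup.eq_one_iff _).2 (gam_triple_mem v w y)
  rcases h.lt_or_gt with h | h
  · have h1 := key y w v (by
      simp only [det3_eq] at h ⊢
      linarith)
    rw [cls_swap y v, ← h1, mul_inv, ← cls_swap, ← cls_swap, mul_comm]
  · exact key v w y h

/-! ### General position and pairs with dependent linear parts. -/

/-- On the curve (1, t, t²) each product with a is a nonzero polynomial in t, and finitely many of
these have a common non-root. -/
theorem exists_dotProduct_ne_zero (s : Finset (Fin 3 → ℤ)) (hs : ∀ a ∈ s, a ≠ 0) :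
    ∃ d : Fin 3 → ℤ, ∀ a ∈ s, a ⬝ᵥ d ≠ 0 := by
  let P : (Fin 3 → ℤ) → Polynomial ℤ := fun a =>
    Polynomial.C (a 0) + Polynomial.C (a 1) * Polynomial.X + Polynomial.C (a 2) * Polynomial.X ^ 2
  have hP : ∀ a, a ≠ 0 → P a ≠ 0 := by
    intro a ha h0
    refine ha (funext fun i => ?_)
    have hc : ∀ k, (P a).coeff k = 0 := fun k => by rw [h0, Polynomial.coeff_zero]
    have h0 := hc 0
    have h1 := hc 1
    have h2 := hc 2
    simp only [P, Polynomial.coeff_add, Polynomial.coeff_C_mul, Polynomial.coeff_C,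
      Polynomial.coeff_X, Polynomial.coeff_X_pow] at h0 h1 h2
    norm_num at h0 h1 h2
    fin_cases i
    exacts [h0, h1, h2]
  have hne : ∏ a ∈ s, P a ≠ 0 := Finset.prod_ne_zero_iff.2 fun a ha => hP a (hs a ha)
  obtain ⟨t, ht⟩ : ∃ t : ℤ, (∏ a ∈ s, P a).eval t ≠ 0 := by
    by_contra! h
    exact hne (Polynomial.funext fun t => by rw [h t, Polynomial.eval_zero])
  rw [Polynomial.eval_prod, Finset.prod_ne_zero_iff] at ht
  refine ⟨![1, t, t ^ 2], fun a ha => ?_⟩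
  have := ht a ha
  simp only [P, Polynomial.eval_add, Polynomial.eval_mul, Polynomial.eval_pow, Polynomial.eval_X,
    Polynomial.eval_C] at this
  simpa [dotProduct, Fin.sum_univ_three] using this

theorem exists_det3_ne_zero (s : List ((Fin 3 → ℤ) × (Fin 3 → ℤ)))
    (hs : ∀ q ∈ s, crossProduct q.1 q.2 ≠ 0) : ∃ d : Fin 3 → ℤ, ∀ q ∈ s, det3 q.1 q.2 d ≠ 0 := by
  classical
  obtain ⟨d, hd⟩ := exists_dotProduct_ne_zero (s.map fun q => crossProduct q.1 q.2).toFinset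
    (by
      intro a ha
      simp only [List.mem_toFinset, List.mem_map] at ha
      obtain ⟨q, hq, rfl⟩ := ha
      exact hs q hq)
  refine ⟨d, fun q hq => ?_⟩
  rw [← det3_rotate', det3, dotProduct_comm]
  exact hd _ (by simp only [List.mem_toFinset, List.mem_map]; exact ⟨q, hq, rfl⟩)

theorem exists_cross_ne_zero (s : List (Fin 3 → ℤ)) (hs : ∀ a ∈ s, a ≠ 0) :
    ∃ d : Fin 3 → ℤ, ∀ a ∈ s, crossProduct a d ≠ 0 := by
  have hx : ∀ a : Fin 3 → ℤ, a ≠ 0 → ∃ b, crossProduct a b ≠ 0 := by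
    intro a ha
    by_contra! h
    obtain ⟨d, hd⟩ := exists_dotProduct_ne_zero {a} (by simpa using ha)
    have h1 := cross_cross_right d a 0
    obtain ⟨i, hi⟩ := Function.ne_iff.1 ha
    have e0 := congrFun (h (Pi.single 0 1))
    have e1 := congrFun (h (Pi.single 1 1))
    have e2 := e0 2
    have e3 := e0 1
    have e4 := e1 2
    simp [cross_apply] at e2 e3 e4
    fin_cases i <;> simp_all
  choose! f hf using hx
  obtain ⟨d, hd⟩ := exists_det3_ne_zero (s.map fun a => (a, f a)) (by
    simp only [List.mem_map]
    rintro _ ⟨a, ha, rfl⟩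
    exact hf a (hs a ha))
  refine ⟨d, fun a ha h0 => hd (a, f a) (List.mem_map.2 ⟨a, ha, rfl⟩) ?_⟩
  have h1 : crossProduct d a = 0 := by rw [← cross_anticomm, h0, neg_zero]
  rw [← det3_rotate', ← det3_rotate', det3, h1, dotProduct_zero]

/-- When v and w have dependent linear parts the box is empty and `cls v w` carries no information,
so one goes through an auxiliary d. Both choices are compared with a c in general position, where
the class of (d, c) cancels. -/
theorem cls_mul_cls_eq {v w d d' : V} (h1 : crossProduct v.2 d.2 ≠ 0) (h2 : crossProduct w.2 d.2 ≠ 0)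
    (h3 : crossProduct v.2 d'.2 ≠ 0) (h4 : crossProduct w.2 d'.2 ≠ 0) :
    cls v d * cls d w = cls v d' * cls d' w := by
  obtain ⟨c, hc⟩ := exists_det3_ne_zero [(v.2, d.2), (w.2, d.2), (v.2, d'.2), (w.2, d'.2)] (by
    simp [h1, h2, h3, h4])
  simp only [List.mem_cons, List.not_mem_nil, or_false, forall_eq_or_imp, forall_eq] at hc
  obtain ⟨c1, c2, c3, c4⟩ := hc
  have key : ∀ d : V, det3 v.2 d.2 c ≠ 0 → det3 w.2 d.2 c ≠ 0 →
      cls v d * cls d w = cls v (0, c) * cls (0, c) w := by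
    intro d hv hw
    rw [← cls_mul (v := v) (w := d) (y := (0, c)) hv, cls_swap w (0, c),
      ← cls_mul (v := w) (w := d) (y := (0, c)) hw, mul_inv, ← cls_swap, mul_assoc,
      mul_comm (cls d w), mul_inv_cancel_left]
  rw [key d c1 c2, key d' c3 c4]

/-- The extension of `cls` to all pairs with nonzero linear parts. -/
def cls' (v w : V) : N ⧸ M :=
  open Classical in
  if h : ∃ d : V, crossProduct v.2 d.2 ≠ 0 ∧ crossProduct w.2 d.2 ≠ 0 then
    cls v h.choose * cls h.choose w else 1

theorem cls'_eq {v w d : V} (h1 : crossProduct v.2 d.2 ≠ 0) (h2 : crossProduct w.2 d.2 ≠ 0) :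
    cls' v w = cls v d * cls d w := by
  have h : ∃ d : V, crossProduct v.2 d.2 ≠ 0 ∧ crossProduct w.2 d.2 ≠ 0 := ⟨d, h1, h2⟩
  rw [cls', dif_pos h]
  exact cls_mul_cls_eq h.choose_spec.1 h.choose_spec.2 h1 h2

theorem cls'_mul {v w y : V} (hv : v.2 ≠ 0) (hw : w.2 ≠ 0) (hy : y.2 ≠ 0) :
    cls' v w * cls' w y = cls' v y := by
  obtain ⟨d, hd⟩ := exists_cross_ne_zero [v.2, w.2, y.2] (by simp [hv, hw, hy])
  simp only [List.mem_cons, List.not_mem_nil, or_false, forall_eq_or_imp, forall_eq] at hd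
  obtain ⟨d1, d2, d3⟩ := hd
  rw [cls'_eq (d := (0, d)) d1 d2, cls'_eq (d := (0, d)) d2 d3, cls'_eq (d := (0, d)) d1 d3,
    cls_swap w, mul_assoc, inv_mul_cancel_left]

theorem cls'_smul (g : G) {v w : V} (hv : v.2 ≠ 0) (hw : w.2 ≠ 0) :
    g • cls' v w = cls' (g • v) (g • w) := by
  obtain ⟨d, hd⟩ := exists_cross_ne_zero [v.2, w.2] (by simp [hv, hw])
  simp only [List.mem_cons, List.not_mem_nil, or_false, forall_eq_or_imp, forall_eq] at hd
  have hs : ∀ v : V, crossProduct v.2 d ≠ 0 → crossProduct (g • v).2 (g • ((0, d) : V)).2 ≠ 0 :=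
    fun v h => by
      rw [V.smul_snd, V.smul_snd, cross_mulVec]
      exact vecMul_ne_zero _ h
  rw [cls'_eq (d := (0, d)) hd.1 hd.2, cls'_eq (hs v hd.1) (hs w hd.2), smul_mul', cls_smul,
    cls_smul]

theorem cls'_self (v : V) : cls' v v = 1 := by
  rw [cls']
  split_ifs with h
  · rw [cls_swap v, mul_inv_cancel]
  · rfl

theorem cls'_eq_cls {v w : V} (h : crossProduct v.2 w.2 ≠ 0) : cls' v w = cls v w := by
  obtain ⟨d, hd⟩ := exists_det3_ne_zero [(v.2, w.2)] (by simpa using h)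
  have hd : det3 v.2 w.2 d ≠ 0 := hd _ (List.mem_singleton.2 rfl)
  have h0 : det3 v.2 d w.2 ≠ 0 := by
    rw [det3_swap, det3_rotate']
    exact neg_ne_zero.2 hd
  rw [cls'_eq (d := (0, d)) (cross_ne_zero_of_det3' h0) (cross_ne_zero_of_det3 hd)]
  exact cls_mul h0

/-! ### The cocycle `u₀` and its values on the generators. -/

/-- The covector `(0, E₂)`. -/
def baseV : V := (0, Pi.single 1 1)

theorem baseV_ne_zero : baseV.2 ≠ 0 := fun h => by
  have := congrFun h 1
  simp [baseV] at this

/-- The cocycle `g ↦ C(v, g v)` with `v = (0, E₂)`. -/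
def u₀ (g : G) : N ⧸ M := cls' baseV (g • baseV)

/-- C(v, gh v) = C(v, g v) C(g v, gh v), and the last factor is g C(v, h v) by equivariance. -/
theorem isMulCocycle₁_u₀ : groupCohomology.IsMulCocycle₁ u₀ := fun g h => by
  have hne : ∀ g : G, (g • baseV).2 ≠ 0 := fun g => mulVec_ne_zero g baseV_ne_zero
  rw [u₀, u₀, u₀, cls'_smul g baseV_ne_zero (hne h), mul_smul, mul_comm,
    cls'_mul baseV_ne_zero (hne g)]
  rw [← mul_smul]
  exact hne (g * h)

/-- For determinant 1 all three values must be 0, and then δ = 0. Hence `cls` is a single gamma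
function on unimodular pairs. -/
theorem box_eq_singleton {a b c : Fin 3 → ℤ} (h : det3 a b c = 1) :
    box (0, a) (0, b) (0, c) = {0} := by
  ext δ
  simp only [mem_box, h, V.val, zero_add, Set.mem_Ico, Finset.mem_singleton]
  constructor
  · intro hδ
    have h1 := det3_smul_eq a b c δ
    have e1 : δ ⬝ᵥ a = 0 := by omega
    have e2 : δ ⬝ᵥ b = 0 := by omega
    have e3 : δ ⬝ᵥ c = 0 := by omega
    simpa [h, e1, e2, e3] using h1
  · rintro rfl
    simp

theorem gam_eq_gN {a b c : Fin 3 → ℤ} (h : det3 a b c = 1) : gam (0, a) (0, b) (0, c) =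
    gN 0 (crossProduct b c) (crossProduct c a) (crossProduct a b) := by
  rw [gam, box_eq_singleton h, Finset.prod_singleton]

theorem cls_eq_gN {a b c : Fin 3 → ℤ} (h : det3 a b c = 1) : cls (0, a) (0, b) =
    gN 0 (crossProduct b c) (crossProduct c a) (crossProduct a b) := by
  rw [← gam_eq_gN h, mk_gam (by simp [h])]

/-- Translations, as elements of `SL(3, ℤ) ⋉ ℤ³`. -/
def tr (n : Fin 3 → ℤ) : G := ⟨1, n⟩

theorem tr_add (n m : Fin 3 → ℤ) : tr (n + m) = tr n * tr m := by
  refine G.ext (mul_one 1).symm ?_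
  change n + m = m + n ᵥ* (1 : Matrix (Fin 3) (Fin 3) ℤ)
  rw [Matrix.vecMul_one, add_comm]

theorem tr_zero : tr 0 = 1 := rfl

theorem tr_neg (n : Fin 3 → ℤ) : (tr n)⁻¹ = tr (-n) := by
  rw [inv_eq_iff_mul_eq_one, ← tr_add, add_neg_cancel, tr_zero]

theorem tr_smul (n : Fin 3 → ℤ) (p : X) : tr n • p = (p.1 + ev n p.2, p.2) := by
  refine Prod.ext rfl (funext fun i => ?_)
  rw [G.smul_snd]
  change ∑ j, (((1 : Matrix (Fin 3) (Fin 3) ℤ) i j : ℤ) : ℂ) * p.2 j = p.2 i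
  simp [Matrix.one_apply]

theorem tr_smul_V (n : Fin 3 → ℤ) (v : V) : tr n • v = (v.1 + n ⬝ᵥ v.2, v.2) :=
  Prod.ext rfl (Matrix.one_mulVec v.2)

/-- The element `Γ(z / x₁, x₂ / x₁, x₃ / x₁)` of `N`. -/
def Γ₀ : N := gN 0 ![0, 1, 0] ![0, 0, 1] ![1, 0, 0]

theorem gN_e12_isRep : (((gN ![0, -1, 0] ![1, -1, 0] ![-1, 0, 0] ![0, 0, 1])⁻¹ : N) :
    InvAn).IsRep (fun p =>
      (ellGamma ((p.1 - p.2 1) / p.2 2) ((p.2 0 - p.2 1) / p.2 2) (-(p.2 0 / p.2 2)))⁻¹) := by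
  refine (gN_isRep ![0, -1, 0] (a := ![1, -1, 0]) (b := ![-1, 0, 0]) (c := ![0, 0, 1])
    (by decide) (by decide)).inv.congr fun p => ?_
  simp [gammaFun, ev, Fin.sum_univ_three, sub_eq_add_neg, neg_div]

theorem gN_e32_isRep : ((gN 0 ![0, 1, -1] ![0, 0, 1] ![1, 0, 0] : N) :
    InvAn).IsRep (fun p =>
      ellGamma (p.1 / p.2 0) ((p.2 1 - p.2 2) / p.2 0) (p.2 2 / p.2 0)) := by
  refine (gN_isRep 0 (a := ![0, 1, -1]) (b := ![0, 0, 1]) (c := ![1, 0, 0])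
    (by decide) (by decide)).congr fun p => ?_
  simp [gammaFun, ev, Fin.sum_univ_three, sub_eq_add_neg]

theorem Γ₀_isRep : (Γ₀ : InvAn).IsRep fun p => ellGamma (p.1 / p.2 0) (p.2 1 / p.2 0)
    (p.2 2 / p.2 0) := by
  refine (gN_isRep 0 (a := ![0, 1, 0]) (b := ![0, 0, 1]) (c := ![1, 0, 0])
    (by decide) (by decide)).congr fun p => ?_
  simp [gammaFun, ev, Fin.sum_univ_three]

theorem tr_smul_Γ₀_isRep (n : Fin 3 → ℤ) : ((tr n • Γ₀ : N) : InvAn).IsRep fun p =>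
    ellGamma ((p.1 - ev n p.2) / p.2 0) (p.2 1 / p.2 0) (p.2 2 / p.2 0) := by
  refine (Γ₀_isRep.smul (tr n)).congr fun p => ?_
  rw [tr_neg, tr_smul, ev_neg, ← sub_eq_add_neg]

/-- The step Γ(w + τ) = θ₀(w, σ) Γ(w) at w = (z - x₂)/x₁. It is established on an open dense set
because a representative needs an open domain. -/
theorem theta_isRep : ((Γ₀ * (tr ![0, 1, 0] • Γ₀)⁻¹ : N) : InvAn).IsRep fun p =>
    theta₀ ((p.1 - p.2 1) / p.2 0) (p.2 2 / p.2 0) := by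
  have h1 : InvAn.IsRep _ _ := Γ₀_isRep.mul (tr_smul_Γ₀_isRep ![0, 1, 0]).inv
  have hsub : {p : X | IsGen p} ⊆ {p : X | (ev ![0, 1, 0] p.2 / ev ![1, 0, 0] p.2).im ≠ 0} ∩
      {p : X | (ev ![0, 0, 1] p.2 / ev ![1, 0, 0] p.2).im ≠ 0} := fun p hp =>
    ⟨hp.im _ _ (by decide), hp.im _ _ (by decide)⟩
  refine h1.congr_on ((isOpen_im_ne_zero ![0, 1, 0] ![1, 0, 0]).inter
    (isOpen_im_ne_zero ![0, 0, 1] ![1, 0, 0]))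
    ((dense_of_mem_residual eventually_isGen).mono hsub) ?_
  rintro p ⟨hp1, hp2⟩ h0
  simp only [ev, Fin.sum_univ_three, Set.mem_ofPred_eq] at hp1 hp2 h0 ⊢
  simp at hp1 hp2 h0 ⊢
  have e1 : p.1 / p.2 0 = (p.1 - p.2 1) / p.2 0 + p.2 1 / p.2 0 := by rw [← add_div, sub_add_cancel]
  have h2 : ellGamma ((p.1 - p.2 1) / p.2 0 + p.2 1 / p.2 0) (p.2 1 / p.2 0) (p.2 2 / p.2 0) ≠ 0 := by
    rw [← e1]; tauto
  rw [e1, ellGamma_comm, ellGamma_add_right_of_ne_zero hp2 hp1, ellGamma_comm, mul_assoc,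
    mul_inv_cancel₀, mul_one]
  · tauto
  · rw [ellGamma_comm]; tauto
  · rwa [ellGamma_comm]

/-- The generators e_{i,j} and t_j with j ≠ 2 fix (0, E₂), which is why the prescribed values there
are 1. -/
theorem u₀_eq_one {g : G} (h : g • baseV = baseV) : u₀ g = 1 := by
  rw [u₀, h, cls'_self]

theorem el_smul {i j : Fin 3} (h : i ≠ j) (k : ℤ) (a : Fin 3 → ℤ) :
    G.el h • ((k, a) : V) = (k, a + Pi.single i (a j)) := by
  refine Prod.ext ?_ ?_
  · change k + (0 : Fin 3 → ℤ) ⬝ᵥ a = k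
    simp
  · rw [V.smul_snd]
    change (Matrix.transvection i j 1) *ᵥ a = _
    rw [Matrix.transvection, Matrix.add_mulVec, Matrix.one_mulVec]
    congr 1
    ext r
    simp [Matrix.single_mulVec]
    rfl

/-- A translation leaves the linear part E₂ unchanged, so the class passes through the auxiliary
covector E₃, which the translation by n₂ in the second direction fixes. The class of (E₂, E₃) is Γ₀,
with E₁ completing the basis. -/
theorem u₀_tr (n : Fin 3 → ℤ) : u₀ (tr n) = ((Γ₀ * (tr ![0, n 1, 0] • Γ₀)⁻¹ : N) : N ⧸ M) := by
  have h2 : baseV = (0, ![0, 1, 0]) := by decide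
  have h0 : tr n • baseV = tr ![0, n 1, 0] • baseV := by
    rw [tr_smul_V, tr_smul_V, h2]
    simp [dotProduct, Fin.sum_univ_three]
  have h3 : tr ![0, n 1, 0] • ((0, ![0, 0, 1]) : V) = (0, ![0, 0, 1]) := by
    rw [tr_smul_V]; simp
  have h4 : cls (0, ![0, 1, 0]) (0, ![0, 0, 1]) = (Γ₀ : N ⧸ M) := by
    rw [cls_eq_gN (c := ![1, 0, 0]) (by decide), Γ₀]
    congr 2
  have h5 : ∀ g : G, g • (Γ₀ : N ⧸ M) = ((g • Γ₀ : N) : N ⧸ M) := fun _ => rfl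
  have h6 : cls (tr ![0, n 1, 0] • (0, ![0, 1, 0])) (0, ![0, 0, 1]) =
      tr ![0, n 1, 0] • cls (0, ![0, 1, 0]) (0, ![0, 0, 1]) := by rw [cls_smul, h3]
  have hc : crossProduct (tr ![0, n 1, 0] • baseV).2 ((0, ![0, 0, 1]) : V).2 ≠ 0 := by
    rw [tr_smul_V, h2]
    change crossProduct ![0, 1, 0] ![0, 0, 1] ≠ 0
    decide
  rw [u₀, h0, cls'_eq (d := (0, ![0, 0, 1])) (by decide)
    hc, cls_swap _ (0, ![0, 0, 1]), h2, h6, h4, h5]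
  rfl

theorem isExtension_u₀ : IsExtension (gN ![0, -1, 0] ![1, -1, 0] ![-1, 0, 0] ![0, 0, 1])⁻¹
    (gN 0 ![0, 1, -1] ![0, 0, 1] ![1, 0, 0]) (Γ₀ * (tr ![0, 1, 0] • Γ₀)⁻¹) u₀ where
  e₁₂ := by
    have h1 : G.el (i := 0) (j := 1) (by decide) • baseV = (0, ![1, 1, 0]) := by
      rw [baseV, el_smul]
      decide
    have h2 : baseV = (0, ![0, 1, 0]) := by decide
    -- The sign of the third covector makes the determinant +1, so that the box is a single point.
    have h3 : det3 ![0, 1, 0] ![1, 1, 0] ![0, 0, -1] = 1 := by decide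
    rw [u₀, h1, h2, cls'_eq_cls (by decide), cls_eq_gN h3]
    congr 1
    refine N.eq_of_isRep (gN_isRep _ (by decide) (by decide)) gN_e12_isRep fun p hp => ?_
    have i1 : ((p.2 0 - p.2 1) / p.2 2).im ≠ 0 := by
      have := hp.im ![1, -1, 0] ![0, 0, 1] (by decide)
      simpa [ev, Fin.sum_univ_three, sub_eq_add_neg] using this
    have i2 : (p.2 0 / p.2 2).im ≠ 0 := by
      have := hp.im ![1, 0, 0] ![0, 0, 1] (by decide)
      simpa [ev, Fin.sum_univ_three] using this
    have e1 : gammaFun 0 ((crossProduct ![1, 1, 0]) ![0, 0, -1]) ((crossProduct ![0, 0, -1])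
        ![0, 1, 0]) ((crossProduct ![0, 1, 0]) ![1, 1, 0]) p =
        ellGamma (-(p.1 / p.2 2)) ((p.2 0 - p.2 1) / p.2 2) (-(p.2 0 / p.2 2)) := by
      simp [gammaFun, ev, Fin.sum_univ_three, cross_apply, div_neg]
      congr 1
      ring
    -- Sign flips bring both sides to the inverse of Γ at (x₁ - z)/x₃ with parameters (x₁ - x₂)/x₃
    -- and x₁/x₃.
    rw [e1, ← ellGamma_neg_neg_neg _ i1 (by simpa using i2), neg_neg, ellGamma_neg_left _ _ i1,
      ellGamma_neg_right _ _ i2]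
    congr 2
    ring
  e₃₂ := by
    have h1 : G.el (i := 2) (j := 1) (by decide) • baseV = (0, ![0, 1, 1]) := by
      rw [baseV, el_smul]
      decide
    have h2 : baseV = (0, ![0, 1, 0]) := by decide
    have h3 : det3 ![0, 1, 0] ![0, 1, 1] ![1, 0, 0] = 1 := by decide
    rw [u₀, h1, h2, cls'_eq_cls (by decide), cls_eq_gN h3]
    congr 2
  e_ne i j h hj := u₀_eq_one (by
    rw [baseV, el_smul, Pi.single_eq_of_ne hj]
    simp)
  t₂ := by
    have h1 : G.t 1 = tr ![0, 1, 0] := by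
      rw [G.t, tr]; congr 1; decide
    rw [h1, u₀_tr]
    rfl
  t_ne j hj := u₀_eq_one (by
    have h1 : G.t j = tr (Pi.single j 1) := rfl
    rw [h1, tr_smul_V, baseV, dotProduct_single, Pi.single_eq_of_ne hj.symm]
    simp)

/-! ### Generation of SL(3, ℤ) ⋉ ℤ³ and uniqueness of the extension. -/

section Generation

open Matrix.SpecialLinearGroup (transvection)

theorem transvection_mulVec {i j : Fin 3} (h : i ≠ j) (c : ℤ) (v : Fin 3 → ℤ) :
    (transvection h c).1 *ᵥ v = Function.update v i (v i + c * v j) := by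
  change (Matrix.transvection i j c) *ᵥ v = _
  rw [Matrix.transvection, Matrix.add_mulVec, Matrix.one_mulVec, Matrix.single_mulVec]
  ext r
  rcases eq_or_ne r i with rfl | hr
  · simp
  · simp [hr]

/-- The Euclidean algorithm on the coordinates `i` and `j` by elementary row operations. -/
theorem exists_mulVec_eq_zero (H : Subgroup (Matrix.SpecialLinearGroup (Fin 3) ℤ))
    (hH : ∀ (i j : Fin 3) (h : i ≠ j) (c : ℤ), transvection h c ∈ H)
    {i j k : Fin 3} (hij : i ≠ j) (hik : i ≠ k) (hjk : j ≠ k) (v : Fin 3 → ℤ) :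
    ∃ h ∈ H, (h.1 *ᵥ v) j = 0 ∧ 0 ≤ (h.1 *ᵥ v) i ∧ (h.1 *ᵥ v) k = v k ∧
      ∀ w : Fin 3 → ℤ, w i = 0 → w j = 0 → h.1 *ᵥ w = w := by
  induction hn : (v j).natAbs using Nat.strong_induction_on generalizing v with
  | _ n ih =>
  -- The quarter turn (v_i, v_j) ↦ (-v_j, v_i); its square changes both signs and is used to make
  -- the i-th entry nonnegative.
  set r : Matrix.SpecialLinearGroup (Fin 3) ℤ :=
    transvection hij (-1) * transvection hij.symm 1 * transvection hij (-1) with hr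
  have hrH : r ∈ H := mul_mem (mul_mem (hH _ _ _ _) (hH _ _ _ _)) (hH _ _ _ _)
  have hrv : ∀ v : Fin 3 → ℤ, r.1 *ᵥ v =
      Function.update (Function.update v i (-v j)) j (v i) := by
    intro v
    have e : r.1 = (transvection hij (-1)).1 * (transvection hij.symm 1).1 *
      (transvection hij (-1)).1 := rfl
    rw [e, ← Matrix.mulVec_mulVec, ← Matrix.mulVec_mulVec, transvection_mulVec,
      transvection_mulVec, transvection_mulVec]
    ext s
    rcases eq_or_ne s i with rfl | h1
    · simp [hij, hij.symm]
    · rcases eq_or_ne s j with rfl | h2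
      · simp [hij, hij.symm]
      · simp [h1, h2]
  have hrw : ∀ w : Fin 3 → ℤ, w i = 0 → w j = 0 → r.1 *ᵥ w = w := by
    intro w hi hj
    rw [hrv, hi, hj, neg_zero]
    ext s
    rcases eq_or_ne s j with rfl | h2
    · simp [hj]
    · rcases eq_or_ne s i with rfl | h1
      · simp [hi, hij]
      · simp [h1, h2]
  by_cases hv : v j = 0
  · by_cases hi : 0 ≤ v i
    · exact ⟨1, one_mem _, by simp [hv], by simp [hi], by simp, by simp⟩
    · have e : (r * r).1 = r.1 * r.1 := rfl
      refine ⟨r * r, mul_mem hrH hrH, ?_⟩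
      simp only [e, ← Matrix.mulVec_mulVec]
      refine ⟨?_, ?_, ?_, fun w h1 h2 => by rw [hrw w h1 h2, hrw w h1 h2]⟩
      · simp [hrv, hij, hv]
      · simp [hrv, hij]
        omega
      · simp [hrv, hik.symm, hjk.symm]
  · have hv' : (transvection hij (-(v i / v j))).1 *ᵥ v = Function.update v i (v i % v j) := by
      rw [transvection_mulVec]
      congr 1
      have := Int.emod_add_mul_ediv (v i) (v j)
      linarith
    set s := r * transvection hij (-(v i / v j)) with hs
    have hsH : s ∈ H := mul_mem hrH (hH _ _ _ _)
    have es : s.1 = r.1 * (transvection hij (-(v i / v j))).1 := rfl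
    -- One Euclidean step: the remainder of v_i modulo v_j moves to position j, so the absolute
    -- value there decreases.
    have hsv : s.1 *ᵥ v = Function.update (Function.update v i (-v j)) j (v i % v j) := by
      rw [es, ← Matrix.mulVec_mulVec, hv', hrv]
      simp [hij.symm]
    have hlt : ((s.1 *ᵥ v) j).natAbs < n := by
      rw [hsv, Function.update_self, ← hn]
      have h1 := Int.emod_nonneg (v i) hv
      have h2 := Int.emod_lt (v i) hv
      omega
    obtain ⟨h, hh, h1, h2, h3, h4⟩ := ih _ hlt (s.1 *ᵥ v) rfl
    have e : (h * s).1 = h.1 * s.1 := rfl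
    refine ⟨h * s, mul_mem hh hsH, ?_⟩
    simp only [e, ← Matrix.mulVec_mulVec]
    refine ⟨h1, h2, ?_, fun w w1 w2 => ?_⟩
    · rw [h3, hsv]
      simp [hik.symm, hjk.symm]
    · have : s.1 *ᵥ w = w := by
        rw [es, ← Matrix.mulVec_mulVec, transvection_mulVec, w2, mul_zero, add_zero,
          Function.update_eq_self, hrw w w1 w2]
      rw [this, h4 w w1 w2]

/-- Row reduction to an upper triangular matrix with two nonnegative diagonal entries. Determinant 1
then makes the diagonal all ones, and three transvections clear the rest. -/
theorem eq_top_of_transvection_mem (H : Subgroup (Matrix.SpecialLinearGroup (Fin 3) ℤ))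
    (hH : ∀ (i j : Fin 3) (h : i ≠ j) (c : ℤ), transvection h c ∈ H) : H = ⊤ := by
  rw [Subgroup.eq_top_iff']
  intro A
  have hcol : ∀ (h A : Matrix.SpecialLinearGroup (Fin 3) ℤ) (a b : Fin 3),
      (h * A).1 a b = (h.1 *ᵥ (fun c => A.1 c b)) a := fun h A a b => by
    change (h.1 * A.1) a b = _
    rw [Matrix.mul_apply, Matrix.mulVec, dotProduct]
  have hdet : ∀ A : Matrix.SpecialLinearGroup (Fin 3) ℤ, A.1.det = 1 := fun A => A.2
  suffices ∃ h ∈ H, h * A = 1 by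
    obtain ⟨h, hh, h1⟩ := this
    rw [eq_inv_of_mul_eq_one_right h1]
    exact inv_mem hh
  obtain ⟨h₁, hh₁, a1, -, -, -⟩ := exists_mulVec_eq_zero H hH (i := 1) (j := 2) (k := 0)
    (by decide) (by decide) (by decide) (fun c => A.1 c 0)
  rw [← hcol] at a1
  obtain ⟨h₂, hh₂, b1, b2, b3, -⟩ := exists_mulVec_eq_zero H hH (i := 0) (j := 1) (k := 2)
    (by decide) (by decide) (by decide) (fun c => (h₁ * A).1 c 0)
  rw [← hcol] at b1 b2 b3
  simp only [a1] at b3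
  set B := h₂ * (h₁ * A) with hB
  -- `c4` ensures that reducing the second column leaves the first column, already zero in these two
  -- rows, untouched.
  obtain ⟨h₃, hh₃, c1, c2, -, c4⟩ := exists_mulVec_eq_zero H hH (i := 1) (j := 2) (k := 0)
    (by decide) (by decide) (by decide) (fun c => B.1 c 1)
  rw [← hcol] at c1 c2
  have hcol0 := c4 (fun c => B.1 c 0) b1 b3
  have d0 : ∀ a, (h₃ * B).1 a 0 = B.1 a 0 := fun a => by rw [hcol, hcol0]
  set C := h₃ * B with hC
  have e1 : C.1 1 0 = 0 := by rw [d0, b1]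
  have e2 : C.1 2 0 = 0 := by rw [d0, b3]
  have e0 : 0 ≤ C.1 0 0 := by rw [d0]; exact b2
  have hd := hdet C
  rw [Matrix.det_fin_three, e1, e2, c1] at hd
  have hd' : C.1 0 0 * (C.1 1 1 * C.1 2 2) = 1 := by linear_combination hd
  have f0 : C.1 0 0 = 1 := by
    rcases Int.isUnit_iff.1 (IsUnit.of_mul_eq_one _ hd') with h | h <;> omega
  rw [f0, one_mul] at hd'
  have f1 : C.1 1 1 = 1 := by
    rcases Int.isUnit_iff.1 (IsUnit.of_mul_eq_one _ hd') with h | h <;> omega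
  have f2 : C.1 2 2 = 1 := by rw [f1, one_mul] at hd'; exact hd'
  refine ⟨transvection (i := 0) (j := 1) (by decide) (-C.1 0 1) *
    (transvection (i := 0) (j := 2) (by decide) (-C.1 0 2) *
      (transvection (i := 1) (j := 2) (by decide) (-C.1 1 2) * (h₃ * (h₂ * h₁)))), ?_, ?_⟩
  · exact mul_mem (hH _ _ _ _) (mul_mem (hH _ _ _ _) (mul_mem (hH _ _ _ _)
      (mul_mem hh₃ (mul_mem hh₂ hh₁))))
  · have e : transvection (i := 0) (j := 1) (by decide) (-C.1 0 1) *
      (transvection (i := 0) (j := 2) (by decide) (-C.1 0 2) *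
        (transvection (i := 1) (j := 2) (by decide) (-C.1 1 2) * (h₃ * (h₂ * h₁)))) * A =
      transvection (i := 0) (j := 1) (by decide) (-C.1 0 1) *
      (transvection (i := 0) (j := 2) (by decide) (-C.1 0 2) *
        (transvection (i := 1) (j := 2) (by decide) (-C.1 1 2) * C)) := by
      simp only [hC, hB, mul_assoc]
    rw [e]
    ext a b
    rw [hcol]
    have hc1 : ∀ c, (transvection (i := 1) (j := 2) (by decide) (-C.1 1 2) * C).1 c b =
        Function.update (fun c => C.1 c b) 1 (C.1 1 b + -C.1 1 2 * C.1 2 b) c := fun c => by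
      rw [hcol, transvection_mulVec]
    have hc2 : ∀ c, (transvection (i := 0) (j := 2) (by decide) (-C.1 0 2) *
          (transvection (i := 1) (j := 2) (by decide) (-C.1 1 2) * C)).1 c b =
        Function.update (Function.update (fun c => C.1 c b) 1 (C.1 1 b + -C.1 1 2 * C.1 2 b)) 0
          (C.1 0 b + -C.1 0 2 * C.1 2 b) c := fun c => by
      rw [hcol, transvection_mulVec]
      simp only [hc1]
      rfl
    rw [transvection_mulVec]
    simp only [hc2]
    fin_cases a <;> fin_cases b <;>
      simp [Function.update, e1, e2, c1, f0, f1, f2]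

theorem tr_zsmul (l : ℤ) (n : Fin 3 → ℤ) : tr (l • n) = tr n ^ l := by
  let κ : Multiplicative (Fin 3 → ℤ) →* G :=
    { toFun := fun n => tr n.toAdd
      map_one' := rfl
      map_mul' := fun n m => tr_add _ _ }
  exact map_zpow κ (.ofAdd n) l

theorem t_zpow_mul (l m n : ℤ) : G.t 0 ^ l * G.t 1 ^ m * G.t 2 ^ n = tr ![l, m, n] := by
  have h : ∀ j, G.t j = tr (Pi.single j 1) := fun _ => rfl
  rw [h, h, h, ← tr_zsmul, ← tr_zsmul, ← tr_zsmul, ← tr_add, ← tr_add]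
  congr 1
  ext i
  fin_cases i <;> simp

/-- The elements `e_{i,j}` and `t_j` generate `SL(3, ℤ) ⋉ ℤ³`. -/
theorem eq_top_of_el_mem_of_t_mem (K : Subgroup G)
    (hel : ∀ (i j : Fin 3) (h : i ≠ j), G.el h ∈ K) (ht : ∀ j, G.t j ∈ K) : K = ⊤ := by
  let ι : Matrix.SpecialLinearGroup (Fin 3) ℤ →* G :=
    { toFun := fun A => ⟨A, 0⟩
      map_one' := rfl
      map_mul' := fun A B => G.ext rfl (by
        change (0 : Fin 3 → ℤ) = 0 + 0 ᵥ* B.1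
        rw [Matrix.zero_vecMul, add_zero]) }
  have h1 : K.comap ι = ⊤ := eq_top_of_transvection_mem _ fun i j h c => by
    have h1 : transvection h 1 ∈ K.comap ι := hel i j h
    have h2 : ∀ c : ℤ, transvection h c = transvection h 1 ^ c := by
      intro c
      induction c using Int.induction_on with
      | zero => simp
      | succ n ih => rw [Matrix.SpecialLinearGroup.transvection_add, ih, zpow_add_one]
      | pred n ih =>
        rw [sub_eq_add_neg, Matrix.SpecialLinearGroup.transvection_add, ih,
          ← Matrix.SpecialLinearGroup.transvection_inv, zpow_add, zpow_neg_one]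
    rw [h2]
    exact zpow_mem h1 c
  rw [Subgroup.eq_top_iff']
  intro g
  have hg : g = ι g.A * (G.t 0 ^ g.n 0 * G.t 1 ^ g.n 1 * G.t 2 ^ g.n 2) := by
    rw [t_zpow_mul]
    refine G.ext (mul_one _).symm ?_
    change g.n = ![g.n 0, g.n 1, g.n 2] + 0 ᵥ* (1 : Matrix (Fin 3) (Fin 3) ℤ)
    ext i
    fin_cases i <;> simp
  rw [hg]
  have h2 : ι g.A ∈ K := by
    have : g.A ∈ K.comap ι := by rw [h1]; trivial
    exact this
  exact mul_mem h2 (mul_mem (mul_mem (zpow_mem (ht 0) _) (zpow_mem (ht 1) _)) (zpow_mem (ht 2) _))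

end Generation

/-- Two cocycles agree on a subgroup, and this one contains the generators. The extension itself is
therefore unique, not only its class. -/
theorem eq_of_isExtension {a b c : N} {u u' : G → N ⧸ M} (hu : groupCohomology.IsMulCocycle₁ u)
    (hu' : groupCohomology.IsMulCocycle₁ u') (h : IsExtension a b c u)
    (h' : IsExtension a b c u') : u = u' := by
  let K : Subgroup G :=
    { carrier := {g | u g = u' g}
      one_mem' := by
        change u 1 = u' 1
        rw [groupCohomology.map_one_of_isMulCocycle₁ hu,
          groupCohomology.map_one_of_isMulCocycle₁ hu']
      mul_mem' := by
        intro g g' hg hg'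
        have hg : u g = u' g := hg
        have hg' : u g' = u' g' := hg'
        change u (g * g') = u' (g * g')
        rw [hu, hu', hg, hg']
      inv_mem' := by
        intro g hg
        have hg : u g = u' g := hg
        change u g⁻¹ = u' g⁻¹
        rw [← smul_left_cancel_iff g, groupCohomology.map_inv_of_isMulCocycle₁ hu,
          groupCohomology.map_inv_of_isMulCocycle₁ hu', hg] }
  have hK : K = ⊤ := by
    refine eq_top_of_el_mem_of_t_mem K (fun i j hij => ?_) fun j => ?_
    · change u _ = u' _
      by_cases hj : j = 1
      · subst hj
        have : i = 0 ∨ i = 2 := by revert hij; revert i; decide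
        rcases this with rfl | rfl
        · rw [h.e₁₂, h'.e₁₂]
        · rw [h.e₃₂, h'.e₃₂]
      · rw [h.e_ne i j hij hj, h'.e_ne i j hij hj]
    · change u _ = u' _
      by_cases hj : j = 1
      · subst hj
        rw [h.t₂, h'.t₂]
      · rw [h.t_ne j hj, h'.t_ne j hj]
  funext g
  exact (Subgroup.eq_top_iff' K).1 hK g

/-! ### The 2-cocycle on translations. -/

/-- If the multiplicative mixed difference is trivial on unit squares, it is trivial on all
rectangles. -/
theorem eq_of_mixed_difference {g : ℤ → ℤ → ℂ} (h0 : ∀ a b, g a b ≠ 0)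
    (h : ∀ a b, g a (b + 1) * g (a + 1) b = g (a + 1) (b + 1) * g a b) (a k n : ℤ) :
    g a n * g (a + k) 0 = g (a + k) n * g a 0 := by
  have per : ∀ f : ℤ → ℂ, (∀ a, f (a + 1) = f a) → ∀ a k, f (a + k) = f a := fun f hf a k => by
    have := Function.Periodic.int_mul (f := f) (c := 1) hf k a
    simpa using this
  have h1 := per (fun b => g a b / g (a + k) b) (fun b => by
    have h2 := per (fun a => g a (b + 1) / g a b) (fun a => by
      have := h a b
      rw [div_eq_div_iff (h0 _ _) (h0 _ _), this]) a k
    rw [div_eq_div_iff (h0 _ _) (h0 _ _)] at h2 ⊢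
    linear_combination -h2) 0 n
  simp only [zero_add] at h1
  rw [div_eq_div_iff (h0 _ _) (h0 _ _)] at h1
  linear_combination h1

/-- The mixed difference on one square compares θ₀(w, σ) with θ₀(w + σ, σ) = -e(-w) θ₀(w, σ); the
sign is the 1/2 in the exponent. -/
theorem ellGamma_mul_ellGamma {w τ σ : ℂ} (hτ : τ.im ≠ 0) (hσ : σ.im ≠ 0)
    (hw : OffLattice w τ σ) : ellGamma (w + τ) τ σ * ellGamma (w + σ) τ σ =
      e (w + 1 / 2) * (ellGamma w τ σ * ellGamma (w + τ + σ) τ σ) := by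
  rw [add_right_comm, ellGamma_add_left hτ hσ hw, ellGamma_add_left hτ hσ hw.add_right,
    theta₀_add _ hσ, e_add, e_half, e_neg]
  have := e_ne_zero w
  field_simp

theorem ellGamma_double_difference {z τ σ : ℂ} (hτ : τ.im ≠ 0) (hσ : σ.im ≠ 0)
    (hz : OffLattice z τ σ) (a k n : ℤ) :
    ellGamma (z - a * τ - n * σ) τ σ * ellGamma (z - (a + k) * τ) τ σ =
      e (n * k * (z + 1 / 2) - k * n * (n + 1) / 2 * σ - n * k * (k + 1 + 2 * a) / 2 * τ) *
      (ellGamma (z - (a + k) * τ - n * σ) τ σ * ellGamma (z - a * τ) τ σ) := by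
  have hoff : ∀ a b : ℤ, OffLattice (z - a * τ - b * σ) τ σ := fun a b i j l h =>
    hz i (j + a) (l + b) (by push_cast; linear_combination h)
  -- A polynomial whose mixed difference compensates that of Γ on each unit square, and which
  -- vanishes for b = 0.
  let h : ℤ → ℤ → ℂ := fun a b =>
    a * b * (z + 1 / 2) - b * a * (a + 1) / 2 * τ - a * b * (b + 1) / 2 * σ
  have key := eq_of_mixed_difference (g := fun a b => ellGamma (z - a * τ - b * σ) τ σ * e (h a b))
    (fun a b => mul_ne_zero (ellGamma_ne_zero hτ hσ (hoff a b)) (e_ne_zero _)) (fun a b => by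
      have := ellGamma_mul_ellGamma hτ hσ (hoff (a + 1) (b + 1))
      rw [show z - ((a + 1 : ℤ) : ℂ) * τ - ((b + 1 : ℤ) : ℂ) * σ + τ = z - a * τ - (b + 1 : ℤ) * σ by
          push_cast; ring,
        show z - ((a + 1 : ℤ) : ℂ) * τ - ((b + 1 : ℤ) : ℂ) * σ + σ = z - (a + 1 : ℤ) * τ - b * σ by
          push_cast; ring,
        show z - (a : ℂ) * τ - ((b + 1 : ℤ) : ℂ) * σ + σ = z - a * τ - b * σ by
          push_cast; ring] at this
      rw [mul_mul_mul_comm, this, mul_mul_mul_comm (ellGamma (z - ((a + 1 : ℤ) : ℂ) * τ - _) τ σ),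
        mul_comm (e _), mul_assoc, ← e_add, ← e_add, ← e_add]
      congr 2
      simp only [h]
      push_cast
      ring) a k n
  simp only [Int.cast_zero, zero_mul, sub_zero] at key
  have h0 : h (a + k) 0 = 0 := by simp [h]
  have h0' : h a 0 = 0 := by simp [h]
  rw [h0, h0', e_zero, mul_one, mul_one] at key
  have hE := e_ne_zero (h a n)
  have hexp : e (h (a + k) n) = e (n * k * (z + 1 / 2) - k * n * (n + 1) / 2 * σ -
      n * k * (k + 1 + 2 * a) / 2 * τ) * e (h a n) := by
    rw [← e_add]
    congr 1
    simp only [h]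
    push_cast
    ring
  push_cast at key
  rw [hexp] at key
  refine mul_right_cancel₀ hE ?_
  linear_combination key

/-- The lift of the cocycle `u₀` to `N` which is given by `Γ₀` on translations. -/
def lift₀ (g : G) : N :=
  open Classical in
  if g.A = 1 then Γ₀ * (tr ![0, g.n 1, 0] • Γ₀)⁻¹ else Quotient.out (u₀ g)

theorem lift₀_tr (n : Fin 3 → ℤ) : lift₀ (tr n) = Γ₀ * (tr ![0, n 1, 0] • Γ₀)⁻¹ := if_pos rfl

theorem mk_lift₀ (g : G) : (lift₀ g : N ⧸ M) = u₀ g := by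
  by_cases h : g.A = 1
  · have hg : g = tr g.n := G.ext h rfl
    rw [hg, lift₀_tr, u₀_tr]
  · rw [lift₀, if_neg h]
    exact Quotient.out_eq _

theorem lift₀_one : lift₀ 1 = 1 := by
  have h : tr ![0, 0, 0] = 1 := by
    rw [← tr_zero]; congr 1; decide
  have h1 := lift₀_tr 0
  rw [tr_zero] at h1
  rw [h1, Pi.zero_apply, h, one_smul, mul_inv_cancel]

theorem coboundary_lift₀_mem (g h : G) : lift₀ g * g • lift₀ h * (lift₀ (g * h))⁻¹ ∈ M := by
  rw [← QuotientGroup.eq_one_iff]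
  have h5 : ((lift₀ g * g • lift₀ h * (lift₀ (g * h))⁻¹ : N) : N ⧸ M) =
    (lift₀ g : N ⧸ M) * g • (lift₀ h : N ⧸ M) * (lift₀ (g * h) : N ⧸ M)⁻¹ := rfl
  rw [h5, mk_lift₀, mk_lift₀, mk_lift₀, isMulCocycle₁_u₀ g h, mul_comm (u₀ g), mul_inv_cancel]

/-- The coboundary of `lift₀`. -/
def φ₀ (q : G × G) : M :=
  ⟨lift₀ q.1 * q.1 • lift₀ q.2 * (lift₀ (q.1 * q.2))⁻¹, coboundary_lift₀_mem q.1 q.2⟩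

theorem isMulCocycle₂_φ₀ : groupCohomology.IsMulCocycle₂ φ₀ := fun g h j => by
  refine Subtype.ext ?_
  change lift₀ (g * h) * (g * h) • lift₀ j * (lift₀ (g * h * j))⁻¹ *
    (lift₀ g * g • lift₀ h * (lift₀ (g * h))⁻¹) =
    g • (lift₀ h * h • lift₀ j * (lift₀ (h * j))⁻¹) *
      (lift₀ g * g • lift₀ (h * j) * (lift₀ (g * (h * j)))⁻¹)
  rw [smul_mul', smul_mul', smul_inv', mul_smul, mul_assoc g h j]
  generalize lift₀ (g * h) = a
  generalize g • h • lift₀ j = b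
  generalize g • lift₀ h = c
  generalize g • lift₀ (h * j) = d
  have h1 : a * b * (lift₀ (g * (h * j)))⁻¹ * (lift₀ g * c * a⁻¹) =
      (a * a⁻¹) * (b * c * lift₀ g * (lift₀ (g * (h * j)))⁻¹) := by ac_rfl
  have h2 : c * b * d⁻¹ * (lift₀ g * d * (lift₀ (g * (h * j)))⁻¹) =
      (d * d⁻¹) * (b * c * lift₀ g * (lift₀ (g * (h * j)))⁻¹) := by ac_rfl
  rw [h1, h2, mul_inv_cancel, mul_inv_cancel]

theorem φ₀_one (g : G) : φ₀ (1, g) = 1 ∧ φ₀ (g, 1) = 1 := by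
  constructor
  · refine Subtype.ext ?_
    change lift₀ 1 * (1 : G) • lift₀ g * (lift₀ (1 * g))⁻¹ = 1
    rw [lift₀_one, one_mul, one_smul, one_mul, mul_inv_cancel]
  · refine Subtype.ext ?_
    change lift₀ g * g • lift₀ 1 * (lift₀ (g * 1))⁻¹ = 1
    rw [lift₀_one, smul_one, mul_one, mul_one, mul_inv_cancel]

theorem connecting_class₁_u₀ : connecting (class₁ isMulCocycle₁_u₀) = class₂ isMulCocycle₂_φ₀ := by
  refine (groupCohomology.δ₁_apply seqMN_shortExact
    (groupCohomology.cocyclesOfIsMulCocycle₁ isMulCocycle₁_u₀) (fun g => Additive.ofMul (lift₀ g))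
    (funext fun g => mk_lift₀ g) (fun q => Additive.ofMul (φ₀ q)) (funext fun q => ?_)).trans rfl
  change Additive.ofMul (lift₀ q.1 * q.1 • lift₀ q.2 * (lift₀ (q.1 * q.2))⁻¹ : N) =
    Additive.ofMul (q.1 • lift₀ q.2 / lift₀ (q.1 * q.2) * lift₀ q.1)
  congr 1
  rw [div_eq_mul_inv]
  ac_rfl

theorem exists_isRep_e {c : Fin 3 → ℤ} (hc : c ≠ 0) {f : X → ℂ}
    (hf : ∀ p, ev c p.2 ≠ 0 → DifferentiableAt ℂ f p) :
    ∃ F : InvAn, F.IsRep fun p => e (f p) := by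
  let A : AnPair := ⟨{p | ev c p.2 ≠ 0}, isOpen_ne_fun (by fun_prop) continuous_const,
    (dense_of_mem_residual eventually_isGen).mono fun p hp => hp.ev_ne_zero hc, fun p => e (f p),
    fun p hp => ((differentiable_e _).comp p (hf p hp)).differentiableWithinAt,
    fun _ _ => e_ne_zero _⟩
  exact ⟨Quotient.mk _ A, A, rfl, fun _ _ => rfl⟩

/-- In the coboundary of the lift, what survives is the double difference of Γ₀ with steps v₃ along
x₃ and w₂ along x₂. Shifts along x₁ disappear by periodicity. -/
theorem φ₀_tr_isRep (v w : Fin 3 → ℤ) : ((φ₀ (tr v, tr w) : N) : InvAn).IsRep fun p =>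
    e (v 2 * w 1 * (p.1 / p.2 0 + 1 / 2) - w 1 * v 2 * (v 2 + 1) / 2 * (p.2 2 / p.2 0)
      - v 2 * w 1 * (w 1 + 1 + 2 * v 1) / 2 * (p.2 1 / p.2 0)) := by
  have hval : (φ₀ (tr v, tr w) : N) = Γ₀ * (tr ![0, v 1, 0] • Γ₀)⁻¹ *
      ((tr v • Γ₀) * (tr (v + ![0, w 1, 0]) • Γ₀)⁻¹) *
        (Γ₀ * (tr ![0, v 1 + w 1, 0] • Γ₀)⁻¹)⁻¹ := by
    change lift₀ (tr v) * tr v • lift₀ (tr w) * (lift₀ (tr v * tr w))⁻¹ = _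
    rw [← tr_add, lift₀_tr, lift₀_tr, lift₀_tr, smul_mul', smul_inv', ← mul_smul, ← tr_add]
    rfl
  obtain ⟨H, hH⟩ := exists_isRep_e (c := ![1, 0, 0]) (by decide) (f := fun p : X =>
    v 2 * w 1 * (p.1 / p.2 0 + 1 / 2) - w 1 * v 2 * (v 2 + 1) / 2 * (p.2 2 / p.2 0)
      - v 2 * w 1 * (w 1 + 1 + 2 * v 1) / 2 * (p.2 1 / p.2 0)) (fun p hp => by
    have h0 : p.2 0 ≠ 0 := by simpa [ev, Fin.sum_univ_three] using hp
    have h1 : DifferentiableAt ℂ (fun p : X => (p.2 0)⁻¹) p := by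
      have : DifferentiableAt ℂ (fun p : X => p.2 0) p := by fun_prop
      exact this.fun_inv h0
    simp only [div_eq_mul_inv _ (_ : ℂ)]
    fun_prop)
  suffices h : ((φ₀ (tr v, tr w) : N) : InvAn) = H by rw [h]; exact hH
  rw [hval]
  refine InvAn.IsRep.eq (((Γ₀_isRep.mul (tr_smul_Γ₀_isRep _).inv).mul
    ((tr_smul_Γ₀_isRep _).mul (tr_smul_Γ₀_isRep _).inv)).mul
      (Γ₀_isRep.mul (tr_smul_Γ₀_isRep _).inv).inv) hH (eventually_isGen.mono fun p hp => ?_)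
  have i1 : (p.2 1 / p.2 0).im ≠ 0 := by
    have := hp.im ![0, 1, 0] ![1, 0, 0] (by decide)
    simpa [ev, Fin.sum_univ_three] using this
  have i2 : (p.2 2 / p.2 0).im ≠ 0 := by
    have := hp.im ![0, 0, 1] ![1, 0, 0] (by decide)
    simpa [ev, Fin.sum_univ_three] using this
  have h0 : p.2 0 ≠ 0 := by
    have := hp.ev_ne_zero (d := ![1, 0, 0]) (by decide)
    simpa [ev, Fin.sum_univ_three] using this
  have hoff : OffLattice (p.1 / p.2 0) (p.2 1 / p.2 0) (p.2 2 / p.2 0) := by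
    have := hp.offLattice (d := 0) (a := ![0, 1, 0]) (b := ![0, 0, 1]) (c := ![1, 0, 0]) (by decide)
    simpa [ev, Fin.sum_univ_three] using this
  have hS : ∀ n : Fin 3 → ℤ, ellGamma ((p.1 - ev n p.2) / p.2 0) (p.2 1 / p.2 0)
      (p.2 2 / p.2 0) = ellGamma (p.1 / p.2 0 - n 1 * (p.2 1 / p.2 0) - n 2 * (p.2 2 / p.2 0))
        (p.2 1 / p.2 0) (p.2 2 / p.2 0) := fun n => by
    refine ellGamma_congr (e_eq_e_iff.2 ⟨-n 0, ?_⟩) rfl rfl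
    simp only [ev, Fin.sum_univ_three]
    push_cast
    field_simp
    ring
  have hne : ∀ a b : ℤ, ellGamma (p.1 / p.2 0 - a * (p.2 1 / p.2 0) - b * (p.2 2 / p.2 0))
      (p.2 1 / p.2 0) (p.2 2 / p.2 0) ≠ 0 := fun a b =>
    ellGamma_ne_zero i1 i2 fun i j l h => hoff i (j + a) (l + b) (by push_cast; linear_combination h)
  have n1 := hne 0 0
  have n2 := hne (v 1) 0
  have n3 := hne (v 1 + w 1) (v 2)
  have n4 := hne (v 1 + w 1) 0
  have key := ellGamma_double_difference i1 i2 hoff (v 1) (w 1) (v 2)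
  simp only [hS, Pi.add_apply, Matrix.cons_val, Int.cast_zero, zero_mul, sub_zero, add_zero,
    Int.cast_add] at n1 n2 n3 n4 key ⊢
  have alg : ∀ {s₀ s₁ s₂ s₃ s₄ t : ℂ}, s₀ ≠ 0 → s₁ ≠ 0 → s₃ ≠ 0 → s₄ ≠ 0 →
      s₂ * s₄ = t * (s₃ * s₁) → s₀ * s₁⁻¹ * (s₂ * s₃⁻¹) * (s₀ * s₄⁻¹)⁻¹ = t := by
    intro s₀ s₁ s₂ s₃ s₄ t h0 h1 h3 h4 h
    field_simp
    linear_combination h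
  exact alg n1 n2 n3 n4 key

/-! ### Non-triviality of the class. -/

theorem differentiable_aeval {ι : Type} (P : MvPolynomial ι ℚ) {f : ι → ℂ → ℂ}
    (hf : ∀ i, Differentiable ℂ (f i)) :
    Differentiable ℂ fun z => MvPolynomial.aeval (fun i => f i z) P := by
  induction P using MvPolynomial.induction_on with
  | C a => simp
  | add p q hp hq => simpa only [map_add] using hp.fun_add hq
  | mul_X p i hp => simpa only [map_mul, MvPolynomial.aeval_X] using hp.fun_mul (hf i)

/-- Of the rational form of the exponent only its being entire in z for fixed x is kept; nothing
more is needed for the contradiction. -/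
theorem IsExpRat.exists_isRep_e {F : InvAn} (hF : IsExpRat F) : ∃ f : X → ℂ,
    (∀ x, Differentiable ℂ fun z => f (z, x)) ∧ F.IsRep fun p => e (f p) := by
  obtain ⟨P, Q, -, a, rfl, ha⟩ := hF
  refine ⟨fun p => MvPolynomial.aeval ![p.2 0 / p.2 2, p.2 1 / p.2 2, p.1 / p.2 2] P /
    MvPolynomial.aeval ![p.2 0 / p.2 2, p.2 1 / p.2 2] Q, fun x => ?_, a, rfl,
    fun p hp => (ha p hp).2.2⟩
  simp only [div_eq_mul_inv (MvPolynomial.aeval _ P)]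
  refine Differentiable.mul_const ?_ _
  have h := differentiable_aeval P (f := ![fun _ => x 0 / x 2, fun _ => x 1 / x 2,
    fun z => z / x 2]) (by
      intro i
      fin_cases i
      · exact differentiable_const _
      · exact differentiable_const _
      · exact differentiable_id.div_const _)
  have hv : ∀ z : ℂ, (fun i => ![fun _ : ℂ => x 0 / x 2, fun _ => x 1 / x 2,
      fun z => z / x 2] i z) = ![x 0 / x 2, x 1 / x 2, z / x 2] := fun z => by
    ext i
    fin_cases i <;> rfl
  simp only [hv] at h
  exact h

/-- By the identity theorem e ∘ f is identically 1, so f has zero derivative. -/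
theorem exists_int_of_e_eq_one {f : ℂ → ℂ} (hf : Differentiable ℂ f) {z₀ : ℂ}
    (h : ∀ᶠ z in 𝓝 z₀, e (f z) = 1) : ∃ k : ℤ, ∀ z, f z = k := by
  have hd : Differentiable ℂ fun z => e (f z) := differentiable_e.comp hf
  have h1 : (fun z => e (f z)) = fun _ => 1 :=
    AnalyticOnNhd.eq_of_eventuallyEq (z₀ := z₀) (fun z _ => hd.analyticAt z)
      (fun z _ => analyticAt_const) h
  have h2 : ∀ z, deriv f z = 0 := fun z => by
    have hz : HasDerivAt (fun z => e (f z)) (e (f z) * (2 * Real.pi * Complex.I * deriv f z)) z := by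
      unfold e
      exact (((hf z).hasDerivAt).const_mul _).cexp
    have h3 : deriv (fun z => e (f z)) z = 0 := by rw [h1]; simp
    rw [hz.deriv] at h3
    have h4 := (mul_eq_zero.1 h3).resolve_left (e_ne_zero _)
    exact (mul_eq_zero.1 h4).resolve_left Complex.two_pi_I_ne_zero
  obtain ⟨k, hk⟩ := e_eq_one_iff.1 (congrFun h1 z₀)
  exact ⟨k, fun z => by rw [is_const_of_deriv_eq_zero hf h2 z z₀, hk]⟩

theorem eventually_exists_int {f : X → ℂ} (hf : ∀ x, Differentiable ℂ fun z => f (z, x))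
    (h : InvAn.IsRep 1 fun p => e (f p)) :
    ∀ᶠ p : X in residual X, ∃ k : ℤ, ∀ z, f (z, p.2) = k := by
  obtain ⟨a, ha, ha'⟩ := h
  have h1 : ∀ p ∈ a.dom, e (f p) = 1 := fun p hp => by
    refine (ha' p hp).symm.trans ?_
    exact ((Quotient.exact ha) p ⟨trivial, hp⟩).symm
  refine (residual_of_dense_open a.isOpen_dom a.dense_dom : a.dom ∈ residual X) |> fun hr =>
    Filter.mem_of_superset hr fun p hp => ?_
  refine exists_int_of_e_eq_one (hf p.2) (z₀ := p.1) ?_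
  have hc : Continuous fun z : ℂ => ((z, p.2) : X) := by fun_prop
  filter_upwards [(a.isOpen_dom.preimage hc).mem_nhds hp] with z hz
  exact h1 _ hz

theorem tr_smul_Γ₀_of_x₁ : tr ![1, 0, 0] • Γ₀ = Γ₀ := by
  refine N.eq_of_isRep (tr_smul_Γ₀_isRep _) Γ₀_isRep fun p hp => ?_
  have h0 : p.2 0 ≠ 0 := by
    have := hp.ev_ne_zero (d := ![1, 0, 0]) (by decide)
    simpa [ev, Fin.sum_univ_three] using this
  refine ellGamma_congr (e_eq_e_iff.2 ⟨-1, ?_⟩) rfl rfl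
  simp [ev, Fin.sum_univ_three]
  field_simp
  ring

/-- The commutation relations between elements of `M` which would follow from the triviality of
the class of `u₀` cannot hold. -/
theorem false_of_commutation {ψ₁ ψ₂ ψ₃ : N} (h₁ : ψ₁ ∈ M) (h₂ : ψ₂ ∈ M) (h₃ : ψ₃ ∈ M)
    (h₁₂ : tr ![0, 1, 0] • ψ₁ * ψ₂ = tr ![1, 0, 0] • ψ₂ * ψ₁)
    (h₁₃ : tr ![0, 0, 1] • ψ₁ * ψ₃ = tr ![1, 0, 0] • ψ₃ * ψ₁)
    (h₂₃ : tr ![0, 0, 1] • ψ₂ * ψ₃ =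
      tr ![0, 1, 0] • ψ₃ * ψ₂ * (φ₀ (tr ![0, 0, 1], tr ![0, 1, 0]) : N)) : False := by
  obtain ⟨f₁, d₁, r₁⟩ := IsExpRat.exists_isRep_e h₁
  obtain ⟨f₂, d₂, r₂⟩ := IsExpRat.exists_isRep_e h₂
  obtain ⟨f₃, d₃, r₃⟩ := IsExpRat.exists_isRep_e h₃
  have hs : ∀ {ψ : N} {f : X → ℂ} (n : Fin 3 → ℤ), (ψ : InvAn).IsRep (fun p => e (f p)) →
      ((tr n • ψ : N) : InvAn).IsRep fun p => e (f (p.1 - ev n p.2, p.2)) := by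
    intro ψ f n h
    refine (h.smul (tr n)).congr fun p => ?_
    rw [tr_neg, tr_smul, ev_neg, ← sub_eq_add_neg]
  have hd : ∀ {f : X → ℂ} (n : Fin 3 → ℤ), (∀ x, Differentiable ℂ fun z => f (z, x)) →
      ∀ x, Differentiable ℂ fun z => f (z - ev n x, x) := fun n hf x =>
    (hf x).comp (differentiable_id.sub_const _)
  have pair : ∀ {ψ ψ' : N} {f f' : X → ℂ} (n n' : Fin 3 → ℤ) {c : N} {g : X → ℂ},
      (∀ x, Differentiable ℂ fun z => f (z, x)) → (∀ x, Differentiable ℂ fun z => f' (z, x)) →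
      (∀ x, Differentiable ℂ fun z => g (z, x)) →
      (ψ : InvAn).IsRep (fun p => e (f p)) → (ψ' : InvAn).IsRep (fun p => e (f' p)) →
      (c : InvAn).IsRep (fun p => e (g p)) → tr n • ψ * ψ' = tr n' • ψ' * ψ * c →
      ∀ᶠ p : X in residual X, ∃ k : ℤ, ∀ z, f (z - ev n p.2, p.2) + f' (z, p.2) -
        f' (z - ev n' p.2, p.2) - f (z, p.2) - g (z, p.2) = k := by
    intro ψ ψ' f f' n n' c g df df' dg rf rf' rg h
    have h1 : (tr n • ψ * ψ') * (tr n' • ψ' * ψ * c)⁻¹ = 1 := by rw [h, mul_inv_cancel]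
    refine eventually_exists_int (f := fun q => f (q.1 - ev n q.2, q.2) + f' q -
      f' (q.1 - ev n' q.2, q.2) - f q - g q) (fun x => ?_) ?_
    · exact ((((hd n df x).add (df' x)).sub (hd n' df' x)).sub (df x)).sub (dg x)
    · have h2 : (1 : InvAn) = ((tr n • ψ * ψ' * (tr n' • ψ' * ψ * c)⁻¹ : N) : InvAn) := by
        rw [h1]; rfl
      rw [h2]
      refine InvAn.IsRep.congr ((((hs n rf).mul rf').mul (((hs n' rf').mul rf).mul rg).inv)) ?_
      intro p
      rw [← e_add, ← e_add, ← e_add, ← e_neg, ← e_add]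
      congr 1
      ring
  have r0 : ((1 : N) : InvAn).IsRep fun _ => e 0 := by
    rw [e_zero]; exact InvAn.isRep_one
  have d0 : ∀ x : Fin 3 → ℂ, Differentiable ℂ fun z : ℂ => (fun _ : X => (0 : ℂ)) (z, x) :=
    fun x => differentiable_const _
  have rc := φ₀_tr_isRep ![0, 0, 1] ![0, 1, 0]
  have E₁₂ := pair _ _ d₁ d₂ d0 r₁ r₂ r0 (h₁₂.trans (mul_one _).symm)
  have E₁₃ := pair _ _ d₁ d₃ d0 r₁ r₃ r0 (h₁₃.trans (mul_one _).symm)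
  have E₂₃ := pair _ _ d₂ d₃ (by intro x; simp) r₂ r₃ rc h₂₃
  obtain ⟨p, hp, ⟨k, hk⟩, ⟨l, hl⟩, ⟨m, hm⟩⟩ := (dense_of_mem_residual
    (eventually_isGen.and (E₁₂.and (E₁₃.and E₂₃)))).nonempty
  have h0 : p.2 0 ≠ 0 := by
    have := hp.ev_ne_zero (d := ![1, 0, 0]) (by decide)
    simpa [ev, Fin.sum_univ_three] using this
  have v1 : ev ![1, 0, 0] p.2 = p.2 0 := by simp [ev, Fin.sum_univ_three]
  have v2 : ev ![0, 1, 0] p.2 = p.2 1 := by simp [ev, Fin.sum_univ_three]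
  have v3 : ev ![0, 0, 1] p.2 = p.2 2 := by simp [ev, Fin.sum_univ_three]
  simp only [v1, v2, v3, sub_zero] at hk hl hm
  simp only [Matrix.cons_val, Int.cast_one, Int.cast_zero] at hm
  -- Each relation is evaluated at 0 and at the translate by the third period. Subtraction removes
  -- the unknown integers, and then all values of f₁, f₂, f₃ cancel; only the exponent of the
  -- 2-cocycle changes, by 1, under z ↦ z - x₁.
  have m1 := hm 0
  have m2 := hm (0 - p.2 0)
  have k1 := hk 0
  have k2 := hk (0 - p.2 2)
  have l1 := hl 0
  have l2 := hl (0 - p.2 1)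
  rw [sub_right_comm 0 (p.2 0)] at m2
  rw [sub_right_comm 0 (p.2 0)] at m2
  rw [sub_right_comm 0 (p.2 2)] at k2
  have x0 : (0 - p.2 0) / p.2 0 = -1 := by field_simp; ring
  rw [x0] at m2
  have hfin : (1 : ℂ) = 0 := by
    linear_combination m2 - m1 + k2 - k1 + l1 - l2
  exact one_ne_zero hfin

/-- If u₀ is the coboundary of F, dividing the lifts of translations by that of F gives elements of
`M`. Since t₁, t₂, t₃ commute, their products in the two orders agree up to values of the 2-cocycle,
and only its value on (t₃, t₂) enters. -/
theorem class₁_u₀_ne_zero : class₁ isMulCocycle₁_u₀ ≠ 0 := by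
  intro h
  obtain ⟨F', hF'⟩ := groupCohomology.isMulCoboundary₁_of_mem_coboundaries₁ _
    ((groupCohomology.H1π_eq_zero_iff _).1 h)
  obtain ⟨F, rfl⟩ := QuotientGroup.mk_surjective F'
  have hmem : ∀ n : Fin 3 → ℤ,
      Γ₀ * (tr ![0, n 1, 0] • Γ₀)⁻¹ * (tr n • F)⁻¹ * F ∈ M := fun n => by
    rw [← QuotientGroup.eq_one_iff]
    have h1 : tr n • (F : N ⧸ M) / F = u₀ (tr n) := hF' (tr n)
    rw [u₀_tr, div_eq_iff_eq_mul] at h1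
    have h2 : tr n • (F : N ⧸ M) = ((tr n • F : N) : N ⧸ M) := rfl
    rw [h2] at h1
    rw [QuotientGroup.mk_mul, QuotientGroup.mk_mul _ _ (tr n • F)⁻¹, QuotientGroup.mk_inv _ (tr n • F),
      h1, mul_inv]
    group
  have hz : tr ![0, 0, 0] = 1 := by
    rw [← tr_zero]; congr 1; decide
  have m1 := hmem ![1, 0, 0]
  have m2 := hmem ![0, 1, 0]
  have m3 := hmem ![0, 0, 1]
  simp only [Matrix.cons_val, hz, one_smul, mul_inv_cancel, one_mul] at m1 m2 m3
  have c12 : tr ![0, 1, 0] * tr ![1, 0, 0] = tr ![1, 0, 0] * tr ![0, 1, 0] := by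
    rw [← tr_add, ← tr_add, add_comm]
  have c13 : tr ![0, 0, 1] * tr ![1, 0, 0] = tr ![1, 0, 0] * tr ![0, 0, 1] := by
    rw [← tr_add, ← tr_add, add_comm]
  have c23 : tr ![0, 0, 1] * tr ![0, 1, 0] = tr ![0, 1, 0] * tr ![0, 0, 1] := by
    rw [← tr_add, ← tr_add, add_comm]
  refine false_of_commutation m1 m2 m3 ?_ ?_ ?_
  · simp only [smul_mul', smul_inv', ← mul_smul, c12]
    -- The lift of t₁ is 1 and that of t₂ is built from Γ₀, so this relation needs Γ₀ to be
    -- invariant under t₁.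
    rw [← c12, mul_smul (tr ![0, 1, 0]) _ Γ₀, tr_smul_Γ₀_of_x₁]
    apply Additive.ofMul.injective
    simp only [ofMul_mul, ofMul_inv]
    abel
  · simp only [smul_mul', smul_inv', ← mul_smul, c13]
    apply Additive.ofMul.injective
    simp only [ofMul_mul, ofMul_inv]
    abel
  · change _ = _ * (lift₀ (tr ![0, 0, 1]) * tr ![0, 0, 1] • lift₀ (tr ![0, 1, 0]) *
      (lift₀ (tr ![0, 0, 1] * tr ![0, 1, 0]))⁻¹)
    rw [← tr_add, lift₀_tr, lift₀_tr, lift₀_tr]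
    simp only [smul_mul', smul_inv', ← mul_smul, c23, Pi.add_apply, Matrix.cons_val, zero_add,
      hz, one_smul]
    apply Additive.ofMul.injective
    simp only [ofMul_mul, ofMul_inv]
    abel

end EllipticGamma

end

/-- Indices are shifted by one: for `p = (z, x)`, `p.1 = z` and `p.2 0, p.2 1, p.2 2` are
`x₁, x₂, x₃`; `G.t 0, G.t 1, G.t 2` are `t₁, t₂, t₃`. -/
theorem mainTheorem2 :
    -- the given functions represent elements of `N`
    ∃ a b c : N,
      (a : InvAn).IsRep (fun p =>
        (ellGamma ((p.1 - p.2 1) / p.2 2) ((p.2 0 - p.2 1) / p.2 2) (-(p.2 0 / p.2 2)))⁻¹) ∧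
      (b : InvAn).IsRep (fun p =>
        ellGamma (p.1 / p.2 0) ((p.2 1 - p.2 2) / p.2 0) (p.2 2 / p.2 0)) ∧
      (c : InvAn).IsRep (fun p =>
        theta₀ ((p.1 - p.2 1) / p.2 0) (p.2 2 / p.2 0)) ∧
      -- their classes in `N / M` extend to a `1`-cocycle
      (∃ u : G → N ⧸ M, groupCohomology.IsMulCocycle₁ u ∧ IsExtension a b c u) ∧
      -- the cohomology class is independent of the extension
      (∀ (u u' : G → N ⧸ M) (hu : groupCohomology.IsMulCocycle₁ u)
        (hu' : groupCohomology.IsMulCocycle₁ u'),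
        IsExtension a b c u → IsExtension a b c u' → class₁ hu = class₁ hu') ∧
      ∀ (u : G → N ⧸ M) (hu : groupCohomology.IsMulCocycle₁ u), IsExtension a b c u →
        -- it is non-trivial
        class₁ hu ≠ 0 ∧
        -- its image under `δ_*` is represented by a normalized cocycle with the given restriction
        ∃ (φ : G × G → M) (hφ : groupCohomology.IsMulCocycle₂ φ),
          (∀ g, φ (1, g) = 1 ∧ φ (g, 1) = 1) ∧
          connecting (class₁ hu) = class₂ hφ ∧
          ∀ l m n l' m' n' : ℤ,
            (φ (G.t 0 ^ l * G.t 1 ^ m * G.t 2 ^ n, G.t 0 ^ l' * G.t 1 ^ m' * G.t 2 ^ n') :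
              InvAn).IsRep (fun p =>
                Complex.exp (Real.pi * Complex.I *
                  (n * m' * (2 * p.1 / p.2 0 + 1) - m' * n * (n + 1) * (p.2 2 / p.2 0)
                    - n * m' * (m' + 1 + 2 * m) * (p.2 1 / p.2 0)))) := by
  have huniq : ∀ u : G → N ⧸ M, groupCohomology.IsMulCocycle₁ u → IsExtension _ _ _ u → u = u₀ :=
    fun u hu h => eq_of_isExtension hu isMulCocycle₁_u₀ h isExtension_u₀
  refine ⟨_, _, _, gN_e12_isRep, gN_e32_isRep, theta_isRep, ⟨u₀, isMulCocycle₁_u₀, isExtension_u₀⟩,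
    fun u u' hu hu' h h' => ?_, fun u hu h => ?_⟩
  · obtain rfl := huniq u hu h
    obtain rfl := huniq u' hu' h'
    rfl
  · obtain rfl := huniq u hu h
    refine ⟨class₁_u₀_ne_zero, φ₀, isMulCocycle₂_φ₀, φ₀_one, connecting_class₁_u₀,
      fun l m n l' m' n' => ?_⟩
    rw [t_zpow_mul, t_zpow_mul]
    refine (φ₀_tr_isRep ![l, m, n] ![l', m', n']).congr fun p => ?_
    simp only [Matrix.cons_val, e]
    congr 1
    ring
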